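/- **Conventions.** For a simply-connected nilpotent Lie group $G$ of real dimension $2n$ with Lie algebra $\mathfrak g$, a *nilpotent complex structure* is a left-invariant integrable almost complex structure $J$ such that the series $\mathfrak a_0=0$, $\mathfrak a_{l}=\{X\in\mathfrak g: [X,\mathfrak g]\subseteq \mathfrak a_{l-1},\ [JX,\mathfrak g]\subseteq\mathfrak a_{l-1}\}$ satisfies $\mathfrak a_k=\mathfrak g$ for some $k>0$. A Hermitian metric $g$ with fundamental form $\omega=g(J\cdot,\cdot)$ on a complex manifold of dimension $n\ge 2$ is *astheno-Kähler* if $\partial\bar\partial\omega^{n-2}=0$. **Theorem.** (1) Let $n\ge 2$ and let $G$ be a simply-connected nilpotent Lie group of real dimension $2n$ with a nilpotent complex structure, and let $\alpha_1,\dots,\alpha_n$ be a basis of the left-invariant $(1,0)$-forms satisfying $$d\alpha_i=0\ (1\le i\le n-1),\qquad d\alpha_n=\sum_{i<j<n}A_{ij}\,\alpha_i\wedge\alpha_j+\sum_{k,l<n}B_{kl}\,\alpha_k\wedge\bar\alpha_l ,$$ with $A_{ij},B_{kl}\in\mathbb C$. If $$\sum_{i<j<n}|A_{ij}|^2+\sum_{i,j<n,\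 i\ne j}|B_{ij}|^2-2\,\mathrm{Re}\Big(\sum_{i<j<n}B_{ii}\overline{B_{jj}}\Big)=0,$$ then the left-invariant diagonal metric $g=\frac12\sum_{i=1}^n(\alpha_i\otimes\bar\alpha_i+\bar\alpha_i\otimes\alpha_i)$ is a Hermitian astheno-Kähler metric on $G$. (2) For every $n\ge 3$ there are a non-abelian simply-connected nilpotent Lie group $G$ of real dimension $2n$ with a nilpotent complex structure, which has structure equations as in (1) with coefficients satisfying the displayed condition, and a co-compact discrete subgroup $\Gamma\subset G$ such that the compact nilmanifold $\Gamma\backslash G$, with the complex structure induced from $G$, carries an astheno-Kähler metric induced by a left-invariant Hermitian metric on $G$. -/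

import Mathlib

open scoped Manifold ContDiff Topology ComplexConjugate
open Bundle Module

noncomputable section

namespace AsthenoKahler

/-! ### Complex-valued exterior algebra on a real vector space -/

section Algebra

variable {V : Type*} [AddCommGroup V] [Module ℝ V] [TopologicalSpace V]

/-- The tensor product `(v₁, …, v_{p+q}) ↦ a (v₁, …, v_p) * b (v_{p+1}, …, v_{p+q})`. -/
def tensorMul {p q : ℕ} (a : V [⋀^Fin p]→L[ℝ] ℂ) (b : V [⋀^Fin q]→L[ℝ] ℂ) :
    ContinuousMultilinearMap ℝ (fun _ : Fin (p + q) => V) ℂ where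
  toFun v := a (fun i => v (Fin.castAdd q i)) * b (fun j => v (Fin.natAdd p j))
  map_update_add' {inst} v i x y := by
    obtain rfl : inst = instDecidableEqFin (p + q) := Subsingleton.elim _ _
    induction i using Fin.addCases with
    | left i =>
      have h1 : ∀ z : V, (fun k => Function.update v (Fin.castAdd q i) z (Fin.castAdd q k))
          = Function.update (fun k => v (Fin.castAdd q k)) i z := fun z =>
        Function.update_comp_eq_of_injective v (Fin.castAdd_injective p q) i z
      have h2 : ∀ z : V, (fun k => Function.update v (Fin.castAdd q i) z (Fin.natAdd p k))
          = fun k => v (Fin.natAdd p k) := fun z => by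
        funext k
        exact Function.update_of_ne (by simp [Fin.ext_iff]; omega) _ _
      simp only [h1, h2, a.map_update_add, add_mul]
    | right i =>
      have h1 : ∀ z : V, (fun k => Function.update v (Fin.natAdd p i) z (Fin.natAdd p k))
          = Function.update (fun k => v (Fin.natAdd p k)) i z := fun z =>
        Function.update_comp_eq_of_injective v (Fin.natAdd_injective q p) i z
      have h2 : ∀ z : V, (fun k => Function.update v (Fin.natAdd p i) z (Fin.castAdd q k))
          = fun k => v (Fin.castAdd q k) := fun z => by
        funext k
        exact Function.update_of_ne (by simp [Fin.ext_iff]; omega) _ _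
      simp only [h1, h2, b.map_update_add, mul_add]
  map_update_smul' {inst} v i c x := by
    obtain rfl : inst = instDecidableEqFin (p + q) := Subsingleton.elim _ _
    induction i using Fin.addCases with
    | left i =>
      have h1 : ∀ z : V, (fun k => Function.update v (Fin.castAdd q i) z (Fin.castAdd q k))
          = Function.update (fun k => v (Fin.castAdd q k)) i z := fun z =>
        Function.update_comp_eq_of_injective v (Fin.castAdd_injective p q) i z
      have h2 : ∀ z : V, (fun k => Function.update v (Fin.castAdd q i) z (Fin.natAdd p k))
          = fun k => v (Fin.natAdd p k) := fun z => by
        funext k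
        exact Function.update_of_ne (by simp [Fin.ext_iff]; omega) _ _
      simp only [h1, h2, a.map_update_smul, smul_mul_assoc]
    | right i =>
      have h1 : ∀ z : V, (fun k => Function.update v (Fin.natAdd p i) z (Fin.natAdd p k))
          = Function.update (fun k => v (Fin.natAdd p k)) i z := fun z =>
        Function.update_comp_eq_of_injective v (Fin.natAdd_injective q p) i z
      have h2 : ∀ z : V, (fun k => Function.update v (Fin.natAdd p i) z (Fin.castAdd q k))
          = fun k => v (Fin.castAdd q k) := fun z => by
        funext k
        exact Function.update_of_ne (by simp [Fin.ext_iff]; omega) _ _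
      simp only [h1, h2, b.map_update_smul, mul_smul_comm]
  cont := (a.cont.comp (by fun_prop)).mul (b.cont.comp (by fun_prop))

/-- The wedge product, normalised so that `(a ∧ b)(v, w) = a v * b w - a w * b v` for one-forms. -/
def wedge {p q : ℕ} (a : V [⋀^Fin p]→L[ℝ] ℂ) (b : V [⋀^Fin q]→L[ℝ] ℂ) :
    V [⋀^Fin (p + q)]→L[ℝ] ℂ :=
  ((p.factorial * q.factorial : ℝ)⁻¹) •
    ContinuousMultilinearMap.alternatization (tensorMul a b)

/-- The exterior powers `η^k = η ∧ ⋯ ∧ η` of a two-form. -/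
def wedgePow (η : V [⋀^Fin 2]→L[ℝ] ℂ) : (k : ℕ) → V [⋀^Fin (2 * k)]→L[ℝ] ℂ
  | 0 => ContinuousAlternatingMap.constOfIsEmpty ℝ V (Fin 0) 1
  | k + 1 => wedge (wedgePow η k) η

/-- The complex conjugate of a form. -/
def conjForm {k : ℕ} (η : V [⋀^Fin k]→L[ℝ] ℂ) : V [⋀^Fin k]→L[ℝ] ℂ :=
  (Complex.conjCLE : ℂ →L[ℝ] ℂ).compContinuousAlternatingMap η

variable [IsTopologicalAddGroup V] [ContinuousSMul ℝ V]

/-- The rotation `e^{θ J} = cos θ + sin θ J` attached to a complex structure `J`. -/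
def rot (J : V →L[ℝ] V) (θ : ℝ) : V →L[ℝ] V :=
  Real.cos θ • ContinuousLinearMap.id ℝ V + Real.sin θ • J

/-- The component of type `(p, q)` of a complex-valued `k`-form with respect to a complex structure
`J` (it is `0` unless `p + q = k`). Pull-back by the rotation `e^{θ J}` multiplies the forms of type
`(r, s)` by `e^{i (r - s) θ}`; hence, for `p + q = r + s = k`, averaging
`e^{-i (p - q) θ} (e^{θ J})^* η` over the angles `θ = π m / (k + 1)`, `m = 0, …, k`, is the identity
on the forms of type `(p, q)` and kills those of every other type. -/
def typeProj (J : V →L[ℝ] V) {k : ℕ} (p q : ℕ) (η : V [⋀^Fin k]→L[ℝ] ℂ) : V [⋀^Fin k]→L[ℝ] ℂ :=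
  if p + q = k then
    ((k + 1 : ℂ)⁻¹) • ∑ m ∈ Finset.range (k + 1),
      Complex.exp (-(Complex.I * ((p : ℂ) - (q : ℂ)) * (Real.pi * m / (k + 1) : ℝ))) •
        η.compContinuousLinearMap (rot J (Real.pi * m / (k + 1)))
  else 0

end Algebra

/-! ### Differential forms and almost complex structures on a real manifold -/

section Manifold

variable {E : Type*} [NormedAddCommGroup E] [NormedSpace ℝ E]
  {M : Type*} [TopologicalSpace M] [ChartedSpace E M]

variable (E M) in
/-- Complex-valued differential `k`-forms on a manifold `M` modelled on `E`. -/
abbrev CForm (k : ℕ) : Type _ := ∀ x : M, TangentSpace 𝓘(ℝ, E) x [⋀^Fin k]→L[ℝ] ℂ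

/-- The exterior derivative of a form on a manifold: at `x`, write the form in the preferred chart
at `x`, apply the exterior derivative of the vector space `E`, and pull the result back. -/
def extD {k : ℕ} (η : CForm E M k) : CForm E M (k + 1) := fun x =>
  ContinuousAlternatingMap.compContinuousLinearMap
    (extDeriv (E := E) (fun y : E =>
      (η ((extChartAt 𝓘(ℝ, E) x).symm y)).compContinuousLinearMap
        (mfderiv 𝓘(ℝ, E) 𝓘(ℝ, E) (extChartAt 𝓘(ℝ, E) x).symm y)) (extChartAt 𝓘(ℝ, E) x x))
    (mfderiv 𝓘(ℝ, E) 𝓘(ℝ, E) (extChartAt 𝓘(ℝ, E) x) x)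

variable (E M) in
/-- A smooth almost complex structure on `M`. -/
structure AlmostComplexStructure [IsManifold 𝓘(ℝ, E) 1 M] where
  J (x : M) : TangentSpace 𝓘(ℝ, E) x →L[ℝ] TangentSpace 𝓘(ℝ, E) x
  sq (x : M) (v : TangentSpace 𝓘(ℝ, E) x) : J x (J x v) = -v
  contMDiff : ContMDiff 𝓘(ℝ, E) (𝓘(ℝ, E).prod 𝓘(ℝ, E →L[ℝ] E)) ∞
    (fun x => TotalSpace.mk' (E →L[ℝ] E)
      (E := fun y : M => TangentSpace 𝓘(ℝ, E) y →L[ℝ] TangentSpace 𝓘(ℝ, E) y) x (J x))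

/-- The operator `∂` of an almost complex structure: on forms of type `(p, q)` it is the component
of type `(p + 1, q)` of `d`. -/
def del [IsManifold 𝓘(ℝ, E) 1 M] (J : AlmostComplexStructure E M) {k : ℕ} (η : CForm E M k) :
    CForm E M (k + 1) := fun x =>
  ∑ pq ∈ Finset.HasAntidiagonal.antidiagonal k,
    typeProj (J.J x) (pq.1 + 1) pq.2 (extD (fun y => typeProj (J.J y) pq.1 pq.2 (η y)) x)

/-- The operator `∂̄` of an almost complex structure: on forms of type `(p, q)` it is the component
of type `(p, q + 1)` of `d`. -/
def delBar [IsManifold 𝓘(ℝ, E) 1 M] (J : AlmostComplexStructure E M) {k : ℕ} (η : CForm E M k) :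
    CForm E M (k + 1) := fun x =>
  ∑ pq ∈ Finset.HasAntidiagonal.antidiagonal k,
    typeProj (J.J x) pq.1 (pq.2 + 1) (extD (fun y => typeProj (J.J y) pq.1 pq.2 (η y)) x)

/-- A smooth Hermitian metric: a smooth Riemannian metric for which `J` is orthogonal. -/
structure HermitianMetric [IsManifold 𝓘(ℝ, E) 1 M] (J : AlmostComplexStructure E M) extends
    ContMDiffRiemannianMetric 𝓘(ℝ, E) ∞ E (fun x : M => TangentSpace 𝓘(ℝ, E) x) where
  inner_J (x : M) (v w : TangentSpace 𝓘(ℝ, E) x) : inner x (J.J x v) (J.J x w) = inner x v w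

/-- The fundamental form `(v, w) ↦ g (J v, w)`, regarded as a complex-valued two-form. -/
def HermitianMetric.fundamentalForm [IsManifold 𝓘(ℝ, E) 1 M] {J : AlmostComplexStructure E M}
    (g : HermitianMetric J) : CForm E M 2 := fun x =>
  { toFun := fun v => ((g.inner x (J.J x (v 0)) (v 1) : ℝ) : ℂ)
    map_update_add' := fun {inst} v i a b => by
      obtain rfl : inst = instDecidableEqFin 2 := Subsingleton.elim _ _
      fin_cases i <;> simp
    map_update_smul' := fun {inst} v i c a => by
      obtain rfl : inst = instDecidableEqFin 2 := Subsingleton.elim _ _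
      fin_cases i <;> simp
    cont := by
      refine Complex.continuous_ofReal.comp ?_
      let b : E →L[ℝ] E →L[ℝ] ℝ := g.inner x
      let j : E →L[ℝ] E := J.J x
      exact (b.continuous.comp (j.continuous.comp
        (continuous_apply (A := fun _ : Fin 2 => E) 0))).clm_apply
        (continuous_apply (A := fun _ : Fin 2 => E) 1)
    map_eq_zero_of_eq' := fun v i j hv hij => by
      have h01 : v 0 = v 1 := by fin_cases i <;> fin_cases j <;> simp_all
      have h1 := g.inner_J x (J.J x (v 0)) (v 0)
      rw [J.sq, map_neg, neg_apply, g.symm x (v 0)] at h1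
      have h2 : g.inner x (J.J x (v 0)) (v 0) = 0 := by linarith
      simp [← h01, h2] }

/-- A Hermitian metric on a manifold of complex dimension `n ≥ 2` is astheno-Kähler if its
fundamental form `F` satisfies `∂∂̄ F^(n-2) = 0`. -/
def HermitianMetric.IsAsthenoKahler [IsManifold 𝓘(ℝ, E) 1 M] {J : AlmostComplexStructure E M}
    (g : HermitianMetric J) (n : ℕ) : Prop :=
  del J (delBar J (fun x => wedgePow (g.fundamentalForm x) (n - 2))) = 0

end Manifold

/-! ### Invariant structures on Lie groups, nilmanifolds -/

section LieGroup

variable {E : Type*} [NormedAddCommGroup E] [NormedSpace ℝ E]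
  {G : Type*} [TopologicalSpace G] [ChartedSpace E G] [Group G]

/-- Left-invariant forms. -/
def IsLeftInvariantForm {k : ℕ} (η : CForm E G k) : Prop :=
  ∀ a x : G, (η (a * x)).compContinuousLinearMap
    (mfderiv 𝓘(ℝ, E) 𝓘(ℝ, E) (fun y : G => a * y) x) = η x

variable [IsManifold 𝓘(ℝ, E) 1 G]

/-- Left-invariant almost complex structures. -/
def AlmostComplexStructure.IsLeftInvariant (J : AlmostComplexStructure E G) : Prop :=
  ∀ (a x : G) (v : TangentSpace 𝓘(ℝ, E) x),
    mfderiv 𝓘(ℝ, E) 𝓘(ℝ, E) (fun y : G => a * y) x (J.J x v) =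
      J.J (a * x) (mfderiv 𝓘(ℝ, E) 𝓘(ℝ, E) (fun y : G => a * y) x v)

/-- Left-invariant Hermitian metrics. -/
def HermitianMetric.IsLeftInvariant {J : AlmostComplexStructure E G} (g : HermitianMetric J) :
    Prop :=
  ∀ (a x : G) (v w : TangentSpace 𝓘(ℝ, E) x),
    g.inner (a * x) (mfderiv 𝓘(ℝ, E) 𝓘(ℝ, E) (fun y : G => a * y) x v)
      (mfderiv 𝓘(ℝ, E) 𝓘(ℝ, E) (fun y : G => a * y) x w) = g.inner x v w

/-- Vanishing of the Nijenhuis tensor of a left-invariant almost complex structure. The tensor is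
left-invariant, so it is enough to test it on the Lie algebra. -/
def AlmostComplexStructure.IsIntegrable (J : AlmostComplexStructure E G) : Prop :=
  ∀ X Y : GroupLieAlgebra 𝓘(ℝ, E) G,
    ⁅J.J 1 X, J.J 1 Y⁆ = ⁅X, Y⁆ + J.J 1 ⁅J.J 1 X, Y⁆ + J.J 1 ⁅X, J.J 1 Y⁆

/-- The ascending series `𝔞₀ = 0`, `𝔞_{l+1} = {X | [X, 𝔤] ⊆ 𝔞_l and [J X, 𝔤] ⊆ 𝔞_l}`. -/
def AlmostComplexStructure.ascendingSeries (J : AlmostComplexStructure E G) :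
    ℕ → Set (GroupLieAlgebra 𝓘(ℝ, E) G)
  | 0 => {0}
  | l + 1 => {X | ∀ Y : GroupLieAlgebra 𝓘(ℝ, E) G,
      ⁅X, Y⁆ ∈ J.ascendingSeries l ∧ ⁅J.J 1 X, Y⁆ ∈ J.ascendingSeries l}

/-- A nilpotent complex structure: a left-invariant, integrable almost complex structure whose
ascending series reaches the whole Lie algebra. -/
structure AlmostComplexStructure.IsNilpotentComplexStructure (J : AlmostComplexStructure E G) :
    Prop where
  leftInvariant : J.IsLeftInvariant
  integrable : J.IsIntegrable
  nilpotent : ∃ k : ℕ, 0 < k ∧ J.ascendingSeries k = Set.univ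

/-- Left-invariant forms `α₁, …, αₙ` of type `(1, 0)`, linearly independent over `ℂ`
(hence a basis of the left-invariant `(1, 0)`-forms if `n` is the complex dimension). -/
structure IsInvariantCoframe (J : AlmostComplexStructure E G) {n : ℕ}
    (α : Fin n → CForm E G 1) : Prop where
  leftInvariant (i : Fin n) : IsLeftInvariantForm (α i)
  type_one_zero (i : Fin n) (x : G) (v : TangentSpace 𝓘(ℝ, E) x) :
    α i x ![J.J x v] = Complex.I * α i x ![v]
  linearIndependent : LinearIndependent ℂ (fun i => α i 1)

/-- The structure equations `dα_i = 0` for `i < n` and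
`dα_n = ∑_{i < j < n} A_{ij} α_i ∧ α_j + ∑_{k, l < n} B_{kl} α_k ∧ ᾱ_l`, with `n = m + 1`. -/
structure SatisfiesStructureEquations {m : ℕ} (A B : Fin m → Fin m → ℂ)
    (α : Fin (m + 1) → CForm E G 1) : Prop where
  closed (i : Fin m) : extD (α i.castSucc) = 0
  last (x : G) : extD (α (Fin.last m)) x =
    ∑ i, ∑ j ∈ Finset.Ioi i, A i j • wedge (α i.castSucc x) (α j.castSucc x) +
    ∑ k, ∑ l, B k l • wedge (α k.castSucc x) (conjForm (α l.castSucc x))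

/-- The diagonal metric `g = ½ ∑ (α_i ⊗ ᾱ_i + ᾱ_i ⊗ α_i)`, i.e. `g(v, w) = Re ∑ α_i(v) conj (α_i(w))`. -/
def HermitianMetric.IsDiagonal {J : AlmostComplexStructure E G} (g : HermitianMetric J) {n : ℕ}
    (α : Fin n → CForm E G 1) : Prop :=
  ∀ (x : G) (v w : TangentSpace 𝓘(ℝ, E) x),
    ((g.inner x v w : ℝ) : ℂ) =
      (1 / 2) * ∑ i, (α i x ![v] * conj (α i x ![w]) + conj (α i x ![v]) * α i x ![w])

end LieGroup

/-! ### The quotient `Γ \ G` -/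

section Quotient

/-- The space `Γ \ G` of the orbits of `Γ` acting on `G` by left translations. -/
abbrev LeftQuotient {G : Type*} [Group G] (Γ : Subgroup G) : Type _ :=
  MulAction.orbitRel.Quotient Γ G

/-- The projection `G → Γ \ G`. -/
abbrev leftQuotientMk {G : Type*} [Group G] (Γ : Subgroup G) (x : G) : LeftQuotient Γ :=
  Quotient.mk (MulAction.orbitRel Γ G) x

/-- A co-compact lattice of a nilpotent Lie group: a discrete subgroup with compact quotient. -/
structure IsCocompactLattice {G : Type*} [Group G] [TopologicalSpace G] (Γ : Subgroup G) :
    Prop where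
  discrete : DiscreteTopology Γ
  compact : CompactSpace (LeftQuotient Γ)

variable {E : Type*} [NormedAddCommGroup E] [NormedSpace ℝ E]
  {G : Type*} [TopologicalSpace G] [ChartedSpace E G] [Group G] [IsManifold 𝓘(ℝ, E) 1 G]
  {Γ : Subgroup G} [ChartedSpace E (LeftQuotient Γ)] [IsManifold 𝓘(ℝ, E) 1 (LeftQuotient Γ)]

/-- The almost complex structure `J'` of `Γ \ G` is induced by the one of `G`. -/
def AlmostComplexStructure.IsInducedBy (J' : AlmostComplexStructure E (LeftQuotient Γ))
    (J : AlmostComplexStructure E G) : Prop :=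
  ∀ (x : G) (v : TangentSpace 𝓘(ℝ, E) x),
    mfderiv 𝓘(ℝ, E) 𝓘(ℝ, E) (leftQuotientMk Γ) x (J.J x v) =
      J'.J (leftQuotientMk Γ x) (mfderiv 𝓘(ℝ, E) 𝓘(ℝ, E) (leftQuotientMk Γ) x v)

/-- The Hermitian metric `g'` of `Γ \ G` is induced by the one of `G`. -/
def HermitianMetric.IsInducedBy {J' : AlmostComplexStructure E (LeftQuotient Γ)}
    {J : AlmostComplexStructure E G} (g' : HermitianMetric J') (g : HermitianMetric J) : Prop :=
  ∀ (x : G) (v w : TangentSpace 𝓘(ℝ, E) x),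
    g'.inner (leftQuotientMk Γ x) (mfderiv 𝓘(ℝ, E) 𝓘(ℝ, E) (leftQuotientMk Γ) x v)
      (mfderiv 𝓘(ℝ, E) 𝓘(ℝ, E) (leftQuotientMk Γ) x w) = g.inner x v w

end Quotient

/-- The quadratic condition
`∑_{i<j} |A_{ij}|² + ∑_{i≠j} |B_{ij}|² = 2 Re ∑_{i<j} B_{ii} conj B_{jj}`. -/
def QuadraticCondition {m : ℕ} (A B : Fin m → Fin m → ℂ) : Prop :=
  ∑ i, ∑ j ∈ Finset.Ioi i, ‖A i j‖ ^ 2 + ∑ i, ∑ j ∈ Finset.univ.erase i, ‖B i j‖ ^ 2 -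
    2 * (∑ i, ∑ j ∈ Finset.Ioi i, B i i * conj (B j j)).re = 0

end AsthenoKahler

end

open AsthenoKahler

/-!
# Astheno-Kähler metrics on nilpotent Lie groups and nilmanifolds

**Diagonal metrics.** Let `α_0, …, α_m` be a coframe of `(1, 0)`-forms with `dα_i = 0` for `i < m`
and `dα_m = a + β`, where `a = ∑ A_ij α_i ∧ α_j` and `β = ∑ B_kl α_k ∧ ᾱ_l`. The fundamental form of
the diagonal metric is `F = (i / 2) (F₀ + α_m ∧ ᾱ_m)` with `F₀ = ∑_{i < m} α_i ∧ ᾱ_i`. Since `F₀` is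
closed and `α_m ∧ ᾱ_m` has square zero, `∂̄ F ^ (k + 1)` is a multiple of
`F₀ ^ k ∧ (β ∧ ᾱ_m - α_m ∧ ā)`, and its exterior derivative is the same multiple of
`F₀ ^ k ∧ (β ∧ β̄ - a ∧ ā)`. For `k = m - 2`, that is `k + 1 = n - 2` with `n = m + 1`, this is a
form of top degree in the `α_i`, `ᾱ_i` with `i < m`. In that degree a product `α_k ∧ α_s ∧ ᾱ_l ∧ ᾱ_r`
multiplied by `F₀ ^ (m - 2)` survives only if `{k, s} = {l, r}`, and is then up to sign a fixed
volume element; the coefficient of the form is a multiple of the left-hand side of the quadratic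
condition (`top_degree_vanishing`).

These computations take place in the exterior algebra on the symbols `α_i`, `ᾱ_i`, and are
transported to forms by the substitution `evalForm`. Three facts make this possible: the wedge
product with `α ∧ ᾱ` is the action of the exterior algebra (`wedge_oneWedge_oneWedge`), a product of
`p` forms `α_i` and `q` forms `ᾱ_i` is recognized by the projections onto types through its weight
`p - q` under the rotations `e^{θ J}` (`typeProj_of_isWeight`), and exterior derivatives follow the
Leibniz rule (`HasExtDeriv.gen_mul`). The conclusion, `isAsthenoKahler_of_hasDiagonalForm`, is about
a coframe on any manifold. On a Lie group a left-invariant coframe is smooth and separates tangent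
vectors, so that the diagonal metric exists (`exists_hermitianMetric_hasDiagonalForm`) and is
left-invariant.

**Nilmanifolds.** On `ℂ ^ m × ℂ` the law `(z, w) (z', w') = (z + z', w + w' + ∑ d_k conj(z_k) z'_k)`
has holomorphic left translations, and the left-invariant forms `dz_k` and
`dw - ∑ d_k conj(z_k) dz_k` satisfy the structure equations with `A = 0` and `B` diagonal with
entries `d_k`. The quadratic condition then reads `∑_{j < k} Re (d_j conj(d_k)) = 0`, which holds
for `d = (1, i, 0, …, 0)`. As the `d_k` are Gaussian integers, the points with Gaussian integer
coordinates form a lattice `Γ`. Its elements other than `1` displace each point by at least `1`, so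
that the projection to `Γ \ G` is injective on balls of radius `1 / 2`; the inverses are charts with
left translations as transitions, in which the induced coframe is given by the same formulas
as on `G` (`IsModelledOn`). So `isAsthenoKahler_of_hasDiagonalForm` applies to `Γ \ G` directly.
-/

noncomputable section

namespace AsthenoKahler

section

/-! ### The exterior algebra acting on alternating forms -/

open ContinuousAlternatingMap

variable {V : Type*} [NormedAddCommGroup V] [NormedSpace ℝ V]
  {W : Type*} [NormedAddCommGroup W] [NormedSpace ℝ W]

/-- Families `(a₀, a₁, …)` of complex-valued alternating forms, one of each degree, on a real
normed space: a module on which the exterior algebra acts without casts between degrees. -/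
abbrev Forms (V : Type*) [NormedAddCommGroup V] [NormedSpace ℝ V] : Type _ :=
  ∀ k : ℕ, V [⋀^Fin k]→L[ℝ] ℂ

/-- The exterior product `η ↦ f ∧ η` with a one-form, on forms of degree `k`. -/
def oneWedge {k : ℕ} (f : V →L[ℝ] ℂ) (η : V [⋀^Fin k]→L[ℝ] ℂ) : V [⋀^Fin (k + 1)]→L[ℝ] ℂ :=
  alternatizeUncurryFin (f.smulRight η)

lemma oneWedge_apply {k : ℕ} (f : V →L[ℝ] ℂ) (η : V [⋀^Fin k]→L[ℝ] ℂ) (v : Fin (k + 1) → V) :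
    oneWedge f η v = ∑ i : Fin (k + 1), (-1) ^ (i : ℕ) * (f (v i) * η (i.removeNth v)) := by
  simp [oneWedge, alternatizeUncurryFin_apply, zsmul_eq_mul]

/-- Left multiplication by a one-form on families of forms. -/
def extMul : (V →L[ℝ] ℂ) →ₗ[ℂ] Module.End ℂ (Forms V) where
  toFun f :=
    -- The product has no component of degree `0`.
    { toFun := fun a k => match k with
        | 0 => 0
        | k + 1 => oneWedge f (a k)
      map_add' := fun a b => by
        funext k; cases k with
        | zero => simp
        | succ k =>
          ext v
          simp [oneWedge_apply, mul_add, Finset.sum_add_distrib]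
      map_smul' := fun c a => by
        funext k; cases k with
        | zero => exact (smul_zero (A := V [⋀^Fin 0]→L[ℝ] ℂ) c).symm
        | succ k =>
          ext v
          simp only [oneWedge_apply, Pi.smul_apply, ContinuousAlternatingMap.smul_apply,
            RingHom.id_apply, smul_eq_mul, Finset.mul_sum]
          exact Finset.sum_congr rfl fun i _ => by ring }
  map_add' f g := by
    ext a k v
    cases k with
    | zero => simp
    | succ k => simp [oneWedge_apply, add_mul, mul_add, Finset.sum_add_distrib]
  map_smul' c f := by
    ext a k v
    cases k with
    | zero => simp
    | succ k =>
      simp only [oneWedge_apply, Pi.smul_apply, ContinuousAlternatingMap.smul_apply,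
            RingHom.id_apply, smul_eq_mul, Finset.mul_sum, LinearMap.smul_apply, LinearMap.coe_mk,
            AddHom.coe_mk, _root_.smul_apply]
      exact Finset.sum_congr rfl fun i _ => by ring

@[simp] lemma extMul_zero_deg (f : V →L[ℝ] ℂ) (a : Forms V) : extMul f a 0 = 0 := rfl

@[simp] lemma extMul_succ (f : V →L[ℝ] ℂ) (a : Forms V) (k : ℕ) :
    extMul f a (k + 1) = oneWedge f (a k) := rfl

/-- For a bilinear map `B : V × V → ℂ` and a `k`-form `η`, the alternatization of
`(u, w) ↦ B u w • η`. It depends only on the antisymmetric part of `B` and equals `f ∧ g ∧ η` if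
`B u w = f u * g w`. -/
def bilinWedge {k : ℕ} (B : V →L[ℝ] V →L[ℝ] ℂ) (η : V [⋀^Fin k]→L[ℝ] ℂ) :
    V [⋀^Fin (k + 2)]→L[ℝ] ℂ :=
  alternatizeUncurryFin (alternatizeUncurryFinCLM ℝ V ℂ ∘L
    (ContinuousLinearMap.compL ℝ V ℂ (V [⋀^Fin k]→L[ℝ] ℂ)
      ((ContinuousLinearMap.id ℝ ℂ).smulRight η) ∘L B))

lemma bilinWedge_apply {k : ℕ} (B : V →L[ℝ] V →L[ℝ] ℂ) (η : V [⋀^Fin k]→L[ℝ] ℂ)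
    (v : Fin (k + 2) → V) :
    bilinWedge B η v = ∑ (i : Fin (k + 1)), ∑ j ≥ i, (-1 : ℤ) ^ (i + j : ℕ) •
      ((B (v i.castSucc) (v j.succ) - B (v j.succ) (v i.castSucc)) *
        η (j.removeNth <| i.castSucc.removeNth v)) := by
  rw [bilinWedge, alternatizeUncurryFin_alternatizeUncurryFinCLM_comp_apply]
  simp [sub_mul]

lemma bilinWedge_congr {k : ℕ} {B B' : V →L[ℝ] V →L[ℝ] ℂ}
    (h : ∀ u w, B u w - B w u = B' u w - B' w u) (η : V [⋀^Fin k]→L[ℝ] ℂ) :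
    bilinWedge B η = bilinWedge B' η := by
  ext v
  simp only [bilinWedge_apply, h]

/-- The bilinear map `(u, w) ↦ f u * g w`. -/
def tensorOne (f g : V →L[ℝ] ℂ) : V →L[ℝ] V →L[ℝ] ℂ := f.smulRight g

@[simp] lemma tensorOne_apply (f g : V →L[ℝ] ℂ) (u w : V) : tensorOne f g u w = f u * g w := by
  simp [tensorOne]

lemma bilinWedge_tensorOne {k : ℕ} (f g : V →L[ℝ] ℂ) (η : V [⋀^Fin k]→L[ℝ] ℂ) :
    bilinWedge (tensorOne f g) η = oneWedge f (oneWedge g η) := by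
  rw [bilinWedge, oneWedge, oneWedge]
  congr 1
  ext u v
  simp [alternatizeUncurryFin_apply, Finset.mul_sum, zsmul_eq_mul, mul_assoc, mul_left_comm]

lemma oneWedge_self {k : ℕ} (f : V →L[ℝ] ℂ) (η : V [⋀^Fin k]→L[ℝ] ℂ) :
    oneWedge f (oneWedge f η) = 0 := by
  rw [← bilinWedge_tensorOne]
  ext v
  simp [bilinWedge_apply, mul_comm]

lemma extMul_mul_self (f : V →L[ℝ] ℂ) : extMul f * extMul f = 0 := by
  ext a k : 2
  match k with
  | 0 => rfl
  | 1 =>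
    show oneWedge f 0 = 0
    ext v; simp [oneWedge_apply]
  | k + 2 => exact oneWedge_self f (a k)

/-- The linear combination of the one-forms `f i`. -/
def combo {ι : Type*} [Fintype ι] (f : ι → V →L[ℝ] ℂ) : (ι → ℂ) →ₗ[ℂ] (V →L[ℝ] ℂ) :=
  Fintype.linearCombination ℂ f

/-- The action of the exterior algebra on `ι` generators on families of forms, the `i`-th
generator acting by multiplication with the one-form `f i`. -/
def extAct {ι : Type*} [Fintype ι] (f : ι → V →L[ℝ] ℂ) :
    ExteriorAlgebra ℂ (ι → ℂ) →ₐ[ℂ] Module.End ℂ (Forms V) :=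
  ExteriorAlgebra.lift ℂ ⟨extMul ∘ₗ combo f, fun _ => extMul_mul_self _⟩

/-- The generators of the exterior algebra. -/
def gen {ι : Type*} [DecidableEq ι] (i : ι) : ExteriorAlgebra ℂ (ι → ℂ) :=
  ExteriorAlgebra.ι ℂ (Pi.single i 1)

/-- The family consisting of the constant `1` in degree `0`. -/
def unitForm : Forms V := fun k => match k with
  | 0 => ContinuousAlternatingMap.constOfIsEmpty ℝ V (Fin 0) 1
  | _ + 1 => 0

section
variable {ι : Type*}

lemma extAct_gen [Fintype ι] [DecidableEq ι] (f : ι → V →L[ℝ] ℂ) (i : ι) :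
    extAct f (gen i) = extMul (f i) := by
  simp [extAct, gen, combo, Fintype.linearCombination_apply_single]

/-- The family of forms obtained from an element of the exterior algebra by substituting the
one-forms `f i` for the generators. -/
def evalForm [Fintype ι] (f : ι → V →L[ℝ] ℂ) : ExteriorAlgebra ℂ (ι → ℂ) →ₗ[ℂ] Forms V :=
  (LinearMap.applyₗ unitForm) ∘ₗ (extAct f).toLinearMap

lemma evalForm_mul [Fintype ι] (f : ι → V →L[ℝ] ℂ) (a b : ExteriorAlgebra ℂ (ι → ℂ)) :
    evalForm f (a * b) = extAct f a (evalForm f b) := by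
  simp [evalForm]

lemma evalForm_one [Fintype ι] (f : ι → V →L[ℝ] ℂ) : evalForm f 1 = unitForm := by
  simp [evalForm]

lemma evalForm_gen_mul_succ [Fintype ι] [DecidableEq ι] (f : ι → V →L[ℝ] ℂ) (i : ι)
    (a : ExteriorAlgebra ℂ (ι → ℂ)) (k : ℕ) :
    evalForm f (gen i * a) (k + 1) = oneWedge (f i) (evalForm f a k) := by
  rw [evalForm_mul, extAct_gen, extMul_succ]

lemma evalForm_gen_mul_zero [Fintype ι] [DecidableEq ι] (f : ι → V →L[ℝ] ℂ) (i : ι)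
    (a : ExteriorAlgebra ℂ (ι → ℂ)) :
    evalForm f (gen i * a) 0 = 0 := by
  rw [evalForm_mul, extAct_gen, extMul_zero_deg]

lemma gen_mul_gen_self [DecidableEq ι] (i : ι) :
    (gen i * gen i : ExteriorAlgebra ℂ (ι → ℂ)) = 0 := by
  simp [gen]

lemma gen_mul_gen_comm [DecidableEq ι] (i j : ι) :
    (gen i * gen j : ExteriorAlgebra ℂ (ι → ℂ)) = -(gen j * gen i) :=
  eq_neg_of_add_eq_zero_left (ExteriorAlgebra.ι_add_mul_swap _ _)

end

end

section

/-! ### The exterior product of a form and a two-form -/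

open ContinuousAlternatingMap

variable {V : Type*} [NormedAddCommGroup V] [NormedSpace ℝ V]

/-- Every permutation of `{0, …, p}` is uniquely a permutation of the last `p` elements followed by
the cycle moving `0` to `i`. -/
lemma sum_perm_succ {M : Type*} [AddCommMonoid M] {p : ℕ} (F : Equiv.Perm (Fin (p + 1)) → M) :
    ∑ σ, F σ = ∑ i : Fin (p + 1), ∑ τ : Equiv.Perm (Fin p),
      F (i.cycleRange.symm * Equiv.Perm.decomposeFin.symm (0, τ)) := by
  rw [← Fintype.sum_prod_type']
  let e : Fin (p + 1) × Equiv.Perm (Fin p) → Equiv.Perm (Fin (p + 1)) := fun x =>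
    x.1.cycleRange.symm * Equiv.Perm.decomposeFin.symm (0, x.2)
  have he : Function.Injective e := by
    rintro ⟨i, τ⟩ ⟨j, τ'⟩ h
    have h0 : i = j := by
      have := congrArg (fun σ => σ 0) h
      simpa [e] using this
    subst h0
    have := mul_left_cancel h
    simpa using this
  have hb : Function.Bijective e := (Fintype.bijective_iff_injective_and_card e).2
    ⟨he, by simp [Fintype.card_perm, Nat.factorial_succ]⟩
  exact ((Equiv.ofBijective e hb).sum_comp F).symm

/-- The alternatization of `f ⊗ t` is `f ∧ alternatization t`. -/
lemma alternatization_eq_oneWedge {p : ℕ} (f : V →L[ℝ] ℂ)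
    (t : ContinuousMultilinearMap ℝ (fun _ : Fin p => V) ℂ)
    (s : ContinuousMultilinearMap ℝ (fun _ : Fin (p + 1) => V) ℂ)
    (hs : ∀ v, s v = f (v 0) * t (fun i => v i.succ)) :
    ContinuousMultilinearMap.alternatization s =
      oneWedge f (ContinuousMultilinearMap.alternatization t) := by
  ext v
  rw [oneWedge_apply, ContinuousMultilinearMap.alternatization_apply_apply, sum_perm_succ]
  refine Finset.sum_congr rfl fun i _ => ?_
  rw [ContinuousMultilinearMap.alternatization_apply_apply, Finset.mul_sum, Finset.mul_sum]
  refine Finset.sum_congr rfl fun τ _ => ?_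
  have h1 : Equiv.Perm.sign (i.cycleRange.symm * Equiv.Perm.decomposeFin.symm (0, τ)) =
      (-1) ^ (i : ℕ) * Equiv.Perm.sign τ := by
    simp [Fin.sign_cycleRange]
  rw [h1, hs]
  have h2 : (fun k : Fin p =>
      (v ∘ (i.cycleRange.symm * Equiv.Perm.decomposeFin.symm (0, τ))) k.succ) = (i.removeNth v) ∘ τ := by
    funext k
    simp [Fin.removeNth_apply]
  rw [h2]
  simp [Units.smul_def]
  ring

/-- Permuting the arguments of a multilinear map multiplies its alternatization by the sign. -/
lemma alternatization_comp_perm {p : ℕ} (ρ : Equiv.Perm (Fin p))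
    (s s' : ContinuousMultilinearMap ℝ (fun _ : Fin p => V) ℂ) (h : ∀ v, s v = s' (v ∘ ρ)) :
    ContinuousMultilinearMap.alternatization s =
      Equiv.Perm.sign ρ • ContinuousMultilinearMap.alternatization s' := by
  ext v
  rw [ContinuousAlternatingMap.smul_apply, ContinuousMultilinearMap.alternatization_apply_apply,
    ContinuousMultilinearMap.alternatization_apply_apply, Finset.smul_sum]
  refine Eq.trans ?_ (Equiv.sum_comp (Equiv.mulRight ρ) _)
  refine Finset.sum_congr rfl fun σ _ => ?_
  have : Equiv.Perm.sign σ = Equiv.Perm.sign ρ * (Equiv.Perm.sign σ * Equiv.Perm.sign ρ) := by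
    rw [mul_comm (Equiv.Perm.sign σ), ← mul_assoc, Int.units_mul_self, one_mul]
  rw [h, this, mul_smul]
  simp [Function.comp_assoc]

/-- The multilinear map `f ⊗ t`, with `f` evaluated on the first argument. -/
def tensorLeft {p : ℕ} (f : V →L[ℝ] ℂ) (t : ContinuousMultilinearMap ℝ (fun _ : Fin p => V) ℂ) :
    ContinuousMultilinearMap ℝ (fun _ : Fin (p + 1) => V) ℂ :=
  ContinuousLinearMap.uncurryLeft (f.smulRight t)

@[simp] lemma tensorLeft_apply {p : ℕ} (f : V →L[ℝ] ℂ)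
    (t : ContinuousMultilinearMap ℝ (fun _ : Fin p => V) ℂ) (v : Fin (p + 1) → V) :
    tensorLeft f t v = f (v 0) * t (fun i => v i.succ) := rfl

lemma alternatization_alternating {p : ℕ} (a : V [⋀^Fin p]→L[ℝ] ℂ) :
    ContinuousMultilinearMap.alternatization a.toContinuousMultilinearMap =
      (p.factorial : ℂ) • a := by
  ext v
  simp only [ContinuousMultilinearMap.alternatization_apply_apply,
    ContinuousAlternatingMap.smul_apply, coe_toContinuousMultilinearMap, smul_eq_mul]
  have h : ∀ σ : Equiv.Perm (Fin p), a (v ∘ σ) = Equiv.Perm.sign σ • a v := fun σ =>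
    a.toAlternatingMap.map_perm v σ
  simp [h, smul_smul, Int.units_mul_self, Fintype.card_perm]

/-- The factor `p!` is the one by which the wedge product divides. -/
lemma alternatization_tensorLeft_tensorLeft {p : ℕ} (f g : V →L[ℝ] ℂ)
    (a : V [⋀^Fin p]→L[ℝ] ℂ) :
    ContinuousMultilinearMap.alternatization
        (tensorLeft f (tensorLeft g a.toContinuousMultilinearMap)) =
      (p.factorial : ℂ) • oneWedge f (oneWedge g a) := by
  rw [alternatization_eq_oneWedge f _ _ (tensorLeft_apply f _),
    alternatization_eq_oneWedge g _ _ (tensorLeft_apply g _), alternatization_alternating]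
  ext v
  simp [oneWedge_apply, Finset.mul_sum, mul_left_comm]

lemma oneWedge_oneWedge_const_apply (f g : V →L[ℝ] ℂ) (v : Fin 2 → V) :
    oneWedge f (oneWedge g (ContinuousAlternatingMap.constOfIsEmpty ℝ V (Fin 0) 1)) v =
      f (v 0) * g (v 1) - f (v 1) * g (v 0) := by
  simp [oneWedge_apply, Fin.sum_univ_two, Fin.removeNth_apply]
  ring

/-- The product of a `p`-form `a` with `f ∧ g`: since two-forms are central, it is
`f ∧ (g ∧ a)`. -/
lemma wedge_oneWedge_oneWedge {p : ℕ} (a : V [⋀^Fin p]→L[ℝ] ℂ) (f g : V →L[ℝ] ℂ) :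
    wedge a (oneWedge f (oneWedge g (ContinuousAlternatingMap.constOfIsEmpty ℝ V (Fin 0) 1))) =
      oneWedge f (oneWedge g a) := by
  set b := oneWedge f (oneWedge g (ContinuousAlternatingMap.constOfIsEmpty ℝ V (Fin 0) 1)) with hb
  -- The even permutation moving the two arguments of `b` in front of those of `a`.
  let ρ : Equiv.Perm (Fin (p + 2)) := (finRotate (p + 2))⁻¹ * (finRotate (p + 2))⁻¹
  have hsign : Equiv.Perm.sign ρ = 1 := by
    simp [ρ, Int.units_mul_self]
  have hρ : ∀ (v : Fin (p + 2) → V), tensorMul a b v =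
      (tensorLeft f (tensorLeft g a.toContinuousMultilinearMap) -
        tensorLeft g (tensorLeft f a.toContinuousMultilinearMap)) (v ∘ ρ) := by
    intro v
    have h0 : ρ 0 = Fin.natAdd p 0 := by
      simp only [ρ, Equiv.Perm.mul_apply, Equiv.Perm.inv_def, Equiv.symm_apply_eq]
      ext; simp [finRotate_apply, Fin.val_add_one, Fin.ext_iff]
    have h1 : ρ 1 = Fin.natAdd p 1 := by
      simp only [ρ, Equiv.Perm.mul_apply, Equiv.Perm.inv_def, Equiv.symm_apply_eq]
      ext; simp [finRotate_apply, Fin.val_add_one, Fin.ext_iff]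
    have h2 : ∀ k : Fin p, ρ k.succ.succ = Fin.castAdd 2 k := by
      intro k
      simp only [ρ, Equiv.Perm.mul_apply, Equiv.Perm.inv_def, Equiv.symm_apply_eq]
      have hk := k.2
      ext
      simp [finRotate_apply, Fin.val_add_one, Fin.ext_iff]
      grind
    have h3 : tensorMul a b v =
      a (fun i => v (Fin.castAdd 2 i)) * b (fun j => v (Fin.natAdd p j)) := rfl
    have h1' : ρ (Fin.succ 0) = Fin.natAdd p 1 := h1
    rw [h3, hb, oneWedge_oneWedge_const_apply]
    simp only [_root_.sub_apply, tensorLeft_apply, Function.comp_apply,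
      coe_toContinuousMultilinearMap, h0, h1', h2]
    ring
  rw [wedge, alternatization_comp_perm ρ _ _ hρ, hsign, one_smul, map_sub,
    alternatization_tensorLeft_tensorLeft, alternatization_tensorLeft_tensorLeft]
  have hanti : oneWedge g (oneWedge f a) = - oneWedge f (oneWedge g a) := by
    rw [← bilinWedge_tensorOne, ← bilinWedge_tensorOne]
    ext v
    simp only [bilinWedge_apply, ContinuousAlternatingMap.neg_apply, ← Finset.sum_neg_distrib,
      tensorOne_apply]
    refine Finset.sum_congr rfl fun i _ => Finset.sum_congr rfl fun j _ => ?_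
    simp only [zsmul_eq_mul]
    ring
  rw [hanti]
  ext v
  have : (p.factorial : ℂ) ≠ 0 := by exact_mod_cast p.factorial_ne_zero
  simp
  field_simp
  ring

lemma wedge_add_right {p q : ℕ} (a : V [⋀^Fin p]→L[ℝ] ℂ) (b b' : V [⋀^Fin q]→L[ℝ] ℂ) :
    wedge a (b + b') = wedge a b + wedge a b' := by
  have : tensorMul a (b + b') = tensorMul a b + tensorMul a b' := by
    ext v; exact mul_add _ _ _
  rw [wedge, this, map_add, smul_add]; rfl

lemma wedge_smul_right {p q : ℕ} (c : ℂ) (a : V [⋀^Fin p]→L[ℝ] ℂ) (b : V [⋀^Fin q]→L[ℝ] ℂ) :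
    wedge a (c • b) = c • wedge a b := by
  have : tensorMul a (c • b) = c • tensorMul a b := by
    ext v; exact mul_left_comm _ _ _
  rw [wedge, wedge, this, smul_comm c]
  congr 1
  ext v
  simp only [ContinuousMultilinearMap.alternatization_apply_apply,
    ContinuousAlternatingMap.smul_apply, Finset.smul_sum]
  exact Finset.sum_congr rfl fun σ _ => smul_comm _ _ _

/-- `wedge a` as a linear map. -/
def wedgeRight {p : ℕ} (q : ℕ) (a : V [⋀^Fin p]→L[ℝ] ℂ) :
    (V [⋀^Fin q]→L[ℝ] ℂ) →ₗ[ℂ] V [⋀^Fin (p + q)]→L[ℝ] ℂ where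
  toFun := wedge a
  map_add' := wedge_add_right a
  map_smul' c := wedge_smul_right c a

/-- The one-form `f` regarded as a linear functional. -/
def oneForm (f : V [⋀^Fin 1]→L[ℝ] ℂ) : V →L[ℝ] ℂ :=
  (ContinuousAlternatingMap.ofSubsingleton ℝ V ℂ (0 : Fin 1)).symm f

lemma oneForm_apply (f : V [⋀^Fin 1]→L[ℝ] ℂ) (v : V) : oneForm f v = f ![v] := by
  have : (![v] : Fin 1 → V) = fun _ => v := by ext i; fin_cases i; rfl
  rw [this]
  rfl

lemma oneWedge_oneForm (f : V [⋀^Fin 1]→L[ℝ] ℂ) :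
    oneWedge (oneForm f) (ContinuousAlternatingMap.constOfIsEmpty ℝ V (Fin 0) 1) = f := by
  ext v
  have : v = ![v 0] := by ext i; fin_cases i; rfl
  rw [this]
  simp [oneWedge_apply, oneForm_apply]

lemma wedge_one_one (f g : V [⋀^Fin 1]→L[ℝ] ℂ) :
    wedge f g = oneWedge (oneForm f)
      (oneWedge (oneForm g) (ContinuousAlternatingMap.constOfIsEmpty ℝ V (Fin 0) 1)) := by
  ext v
  rw [oneWedge_oneWedge_const_apply]
  have hT : ∀ u : Fin 2 → V, tensorMul f g u = oneForm f (u 0) * oneForm g (u 1) := by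
    intro u
    rw [oneForm_apply, oneForm_apply]
    show f _ * g _ = _
    congr 2 <;> (ext i; fin_cases i; rfl)
  have : wedge f g v = ∑ σ : Equiv.Perm (Fin 2), Equiv.Perm.sign σ • tensorMul f g (v ∘ σ) := by
    simp only [wedge, Nat.factorial_one, Nat.cast_one, mul_one, inv_one, one_smul]
    exact ContinuousMultilinearMap.alternatization_apply_apply _ _
  rw [this]
  simp only [hT]
  have huniv : (Finset.univ : Finset (Equiv.Perm (Fin 2))) = {1, Equiv.swap 0 1} := by decide
  rw [huniv, Finset.sum_pair (by decide)]
  simp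
  ring

end

section

open ContinuousAlternatingMap

/-! ### Weights and types -/

section Types

variable {V : Type*} [NormedAddCommGroup V] [NormedSpace ℝ V]
  {W : Type*} [NormedAddCommGroup W] [NormedSpace ℝ W]

lemma oneWedge_compContinuousLinearMap {k : ℕ} (f : V →L[ℝ] ℂ) (η : V [⋀^Fin k]→L[ℝ] ℂ)
    (A : W →L[ℝ] V) : (oneWedge f η).compContinuousLinearMap A =
      oneWedge (f ∘L A) (η.compContinuousLinearMap A) := by
  ext v
  simp only [oneWedge_apply, compContinuousLinearMap_apply]
  rfl

/-- Substitution of one-forms commutes with pull-back. -/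
lemma evalForm_compContinuousLinearMap {ι : Type*} [Fintype ι] (f : ι → V →L[ℝ] ℂ)
    (A : W →L[ℝ] V) (a : ExteriorAlgebra ℂ (ι → ℂ)) (k : ℕ) :
    (evalForm f a k).compContinuousLinearMap A = evalForm (fun i => f i ∘L A) a k := by
  have hcombo : ∀ c, combo f c ∘L A = combo (fun i => f i ∘L A) c := by
    intro c
    ext v
    simp [combo, Fintype.linearCombination_apply]
  have key : ∀ (b : Forms V) (k : ℕ), (extAct f a b k).compContinuousLinearMap A =
      extAct (fun i => f i ∘L A) a (fun j => (b j).compContinuousLinearMap A) k := by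
    induction a using ExteriorAlgebra.induction with
    | algebraMap r =>
      intro b k
      rw [AlgHom.commutes, AlgHom.commutes]
      rfl
    | ι x =>
      intro b k
      simp only [extAct, ExteriorAlgebra.lift_ι_apply, LinearMap.comp_apply]
      cases k with
      | zero => rfl
      | succ k => rw [extMul_succ, extMul_succ, oneWedge_compContinuousLinearMap, hcombo]
    | mul a b ha hb =>
      intro c k
      simp only [map_mul, Module.End.mul_apply, ha]
      have : (fun j => (extAct f b c j).compContinuousLinearMap A) =
          extAct (fun i => f i ∘L A) b (fun j => (c j).compContinuousLinearMap A) :=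
        funext fun j => hb c j
      rw [this]
    | add a b ha hb =>
      intro c k
      have h1 : extAct f (a + b) = extAct f a + extAct f b := (extAct f).toLinearMap.map_add a b
      have h2 : extAct (fun i => f i ∘L A) (a + b) =
          extAct (fun i => f i ∘L A) a + extAct (fun i => f i ∘L A) b :=
        (extAct fun i => f i ∘L A).toLinearMap.map_add a b
      rw [h1, h2, LinearMap.add_apply, LinearMap.add_apply, Pi.add_apply, Pi.add_apply,
        ← ha, ← hb]
      rfl
  have := key unitForm k
  have hu : (fun j => (unitForm (V := V) j).compContinuousLinearMap A) = unitForm (V := W) := by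
    funext j
    cases j <;> rfl
  rw [hu] at this
  exact this

/-- The rotations `e^{θ J}` act on the form by `e^{i w θ}`; a form of type `(p, q)` has weight
`p - q`. -/
def IsWeight (J : V →L[ℝ] V) {k : ℕ} (w : ℤ) (η : V [⋀^Fin k]→L[ℝ] ℂ) : Prop :=
  ∀ θ : ℝ, η.compContinuousLinearMap (rot J θ) = Complex.exp (Complex.I * w * θ) • η

lemma IsWeight.oneWedge {J : V →L[ℝ] V} {k : ℕ} {w w' : ℤ} {f : V →L[ℝ] ℂ}
    {η : V [⋀^Fin k]→L[ℝ] ℂ}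
    (hf : ∀ θ : ℝ, f ∘L rot J θ = Complex.exp (Complex.I * w * θ) • f) (hη : IsWeight J w' η) :
    IsWeight J (w + w') (oneWedge f η) := by
  intro θ
  rw [oneWedge_compContinuousLinearMap, hf, hη]
  ext v
  have : Complex.exp (Complex.I * (w + w' : ℤ) * θ) =
      Complex.exp (Complex.I * w * θ) * Complex.exp (Complex.I * w' * θ) := by
    rw [← Complex.exp_add]; congr 1; push_cast; ring
  rw [this]
  simp only [oneWedge_apply, ContinuousAlternatingMap.smul_apply, _root_.smul_apply, smul_eq_mul,
    Finset.mul_sum]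
  exact Finset.sum_congr rfl fun i _ => by ring

/-- Every homogeneous component of the family of forms has weight `w`. -/
def HasWeight {ι : Type*} [Fintype ι] (J : V →L[ℝ] V) (f : ι → V →L[ℝ] ℂ) (w : ℤ)
    (a : ExteriorAlgebra ℂ (ι → ℂ)) : Prop :=
  ∀ k, IsWeight J w (evalForm f a k)

section
variable {ι : Type*} [Fintype ι] {J : V →L[ℝ] V} {f : ι → V →L[ℝ] ℂ} {w w' : ℤ}
  {a b : ExteriorAlgebra ℂ (ι → ℂ)}

lemma HasWeight.one : HasWeight J f 0 1 := by
  intro k θ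
  rw [evalForm_one]
  cases k <;> (ext v; simp [unitForm])

lemma HasWeight.gen_mul [DecidableEq ι] {i : ι}
    (hf : ∀ θ : ℝ, f i ∘L rot J θ = Complex.exp (Complex.I * w * θ) • f i)
    (ha : HasWeight J f w' a) : HasWeight J f (w + w') (gen i * a) := by
  intro k
  cases k with
  | zero =>
    rw [evalForm_gen_mul_zero]
    intro θ
    ext v; simp
  | succ k =>
    rw [evalForm_gen_mul_succ]
    exact IsWeight.oneWedge hf (ha k)

lemma HasWeight.zero : HasWeight J f w 0 := by
  intro k θ
  ext v; simp

lemma HasWeight.add (ha : HasWeight J f w a) (hb : HasWeight J f w b) :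
    HasWeight J f w (a + b) := by
  intro k θ
  have h1 := ha k θ
  have h2 := hb k θ
  rw [map_add, Pi.add_apply, smul_add, ← h1, ← h2]
  rfl

lemma HasWeight.smul (c : ℂ) (ha : HasWeight J f w a) : HasWeight J f w (c • a) := by
  intro k θ
  have h1 := ha k θ
  rw [map_smul, Pi.smul_apply, smul_comm, ← h1]
  rfl

lemma HasWeight.neg (ha : HasWeight J f w a) : HasWeight J f w (-a) := by
  simpa using ha.smul (-1)

lemma HasWeight.sub (ha : HasWeight J f w a) (hb : HasWeight J f w b) :
    HasWeight J f w (a - b) := by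
  simpa [sub_eq_add_neg] using ha.add hb.neg

lemma HasWeight.sum {κ : Type*} (s : Finset κ) (x : κ → ExteriorAlgebra ℂ (ι → ℂ))
    (h : ∀ i ∈ s, HasWeight J f w (x i)) : HasWeight J f w (∑ i ∈ s, x i) := by
  classical
  induction s using Finset.induction_on with
  | empty => simpa using HasWeight.zero
  | insert i s hi ih =>
    rw [Finset.sum_insert hi]
    exact (h i (by simp)).add (ih fun j hj => h j (by simp [hj]))

end

/-- The averages defining `typeProj` separate the types: on a form of type `(r, s)` the average for
`(p, q)` is a sum over all powers of a root of unity, trivial exactly for `p = r`. -/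
lemma typeProj_of_isWeight (J : V →L[ℝ] V) {k p q r s : ℕ} (hpq : p + q = k) (hrs : r + s = k)
    {η : V [⋀^Fin k]→L[ℝ] ℂ} (hη : IsWeight J ((r : ℤ) - s) η) :
    typeProj J p q η = if p = r then η else 0 := by
  rw [typeProj, if_pos hpq]
  set ζ : ℂ := Complex.exp (2 * Real.pi * Complex.I * (((r : ℂ) - p) / (k + 1))) with hζ
  have hk : (k + 1 : ℂ) ≠ 0 := by exact_mod_cast k.succ_ne_zero
  have hterm : ∀ m ∈ Finset.range (k + 1),
      Complex.exp (-(Complex.I * ((p : ℂ) - (q : ℂ)) * (Real.pi * m / (k + 1) : ℝ))) •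
        η.compContinuousLinearMap (rot J (Real.pi * m / (k + 1))) = ζ ^ m • η := by
    intro m _
    rw [hη, smul_smul, ← Complex.exp_add, hζ, ← Complex.exp_nat_mul]
    congr 2
    have h1 : (q : ℂ) = k - p := by rw [← hpq]; push_cast; ring
    have h2 : (s : ℂ) = k - r := by rw [← hrs]; push_cast; ring
    push_cast
    rw [h1, h2]
    field_simp
    ring
  rw [Finset.sum_congr rfl hterm, ← Finset.sum_smul]
  split_ifs with h
  · subst h
    have : ζ = 1 := by simp [hζ]
    simp [this, smul_smul, hk]
  · have hζ1 : ζ ≠ 1 := by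
      rw [hζ, Ne, Complex.exp_eq_one_iff]
      rintro ⟨n, hn⟩
      have hpi : (2 * Real.pi * Complex.I : ℂ) ≠ 0 := Complex.two_pi_I_ne_zero
      have h1 : ((r : ℂ) - p) / (k + 1) = n := by
        apply mul_left_cancel₀ hpi
        rw [hn]; ring
      rw [div_eq_iff hk] at h1
      have h2 : (r : ℤ) - p = n * (k + 1) := by exact_mod_cast h1
      have h3 : n = 0 := by
        have hlt : |(r : ℤ) - p| < k + 1 := by rw [abs_lt]; omega
        rw [h2, abs_mul, abs_of_nonneg (by positivity : (0 : ℤ) ≤ k + 1)] at hlt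
        have : |n| < 1 := by
          by_contra hcon
          push Not at hcon
          nlinarith
        exact Int.abs_lt_one_iff.1 this
      rw [h3] at h2
      omega
    have hpow : ζ ^ (k + 1) = 1 := by
      rw [hζ, ← Complex.exp_nat_mul, Complex.exp_eq_one_iff]
      exact ⟨(r : ℤ) - p, by push_cast; field_simp⟩
    have hsum : ∑ m ∈ Finset.range (k + 1), ζ ^ m = 0 := by
      have := mul_geom_sum ζ (k + 1)
      rw [hpow, sub_self] at this
      exact (mul_eq_zero.1 this).resolve_left (sub_ne_zero.2 hζ1)
    simp [hsum]

end Types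

/-! ### Exterior derivatives of polynomials in one-forms -/

section Derivative

set_option maxSynthPendingDepth 4
set_option synthInstance.maxHeartbeats 200000

variable {E : Type*} [NormedAddCommGroup E] [NormedSpace ℝ E]

/-- The part of `d (f ∧ η)` in which `f` is differentiated. -/
lemma alternatizeUncurryFin_comp_eq_bilinWedge {k : ℕ} (F : E →L[ℝ] E →L[ℝ] E [⋀^Fin k]→L[ℝ] ℂ)
    (B : E →L[ℝ] E →L[ℝ] ℂ) (η : E [⋀^Fin k]→L[ℝ] ℂ) (h : ∀ u w, F u w = B u w • η) :
    alternatizeUncurryFin (alternatizeUncurryFinCLM ℝ E ℂ ∘L F) = bilinWedge B η := by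
  ext v
  rw [bilinWedge_apply, alternatizeUncurryFin_alternatizeUncurryFinCLM_comp_apply]
  simp [h, sub_mul]

/-- The part of `d (f ∧ η)` in which `η` is differentiated; the sign comes from exchanging the
direction of differentiation with the argument of `f`. -/
lemma alternatizeUncurryFin_comp_eq_neg_oneWedge {k : ℕ}
    (F : E →L[ℝ] E →L[ℝ] E [⋀^Fin k]→L[ℝ] ℂ) (f : E →L[ℝ] ℂ) (D : E →L[ℝ] E [⋀^Fin k]→L[ℝ] ℂ)
    (h : ∀ u w, F u w = f w • D u) :
    alternatizeUncurryFin (alternatizeUncurryFinCLM ℝ E ℂ ∘L F) =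
      -oneWedge f (alternatizeUncurryFin D) := by
  have h3 : f.smulRight (alternatizeUncurryFin D) =
      alternatizeUncurryFinCLM ℝ E ℂ ∘L ContinuousLinearMap.smulRight f D := by
    ext u w
    simp [alternatizeUncurryFin_apply, Finset.mul_sum, zsmul_eq_mul, mul_left_comm]
  rw [oneWedge, h3]
  ext v
  rw [ContinuousAlternatingMap.neg_apply,
    alternatizeUncurryFin_alternatizeUncurryFinCLM_comp_apply,
    alternatizeUncurryFin_alternatizeUncurryFinCLM_comp_apply, ← Finset.sum_neg_distrib]
  refine Finset.sum_congr rfl fun i _ => ?_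
  rw [← Finset.sum_neg_distrib]
  refine Finset.sum_congr rfl fun j _ => ?_
  simp [h]
  ring

/-- The product rule for the product of a one-form and a `k`-form. -/
lemma exists_hasFDerivAt_smulRight {k : ℕ} {f : E → E →L[ℝ] ℂ} {η : E → E [⋀^Fin k]→L[ℝ] ℂ} {y : E}
    (hf : DifferentiableAt ℝ f y) (hη : DifferentiableAt ℝ η y) :
    ∃ F₁ F₂ : E →L[ℝ] E →L[ℝ] E [⋀^Fin k]→L[ℝ] ℂ,
      HasFDerivAt (fun z => (f z).smulRight (η z)) (F₁ + F₂) y ∧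
      (∀ u w, F₁ u w = fderiv ℝ f y u w • η y) ∧ ∀ u w, F₂ u w = f y w • fderiv ℝ η y u := by
  let b : (E [⋀^Fin k]→L[ℝ] ℂ) →L[ℝ] (E →L[ℝ] ℂ) →L[ℝ] (E →L[ℝ] E [⋀^Fin k]→L[ℝ] ℂ) :=
    (ContinuousLinearMap.compL ℝ E ℂ (E [⋀^Fin k]→L[ℝ] ℂ)).comp
      (ContinuousLinearMap.lsmul ℝ ℂ).flip
  have hb : ∀ (η : E [⋀^Fin k]→L[ℝ] ℂ) (f : E →L[ℝ] ℂ), b η f = f.smulRight η :=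
    fun η f => by ext; simp [b]
  have h1 : HasFDerivAt (fun z => b (η z) (f z)) _ y :=
    b.hasFDerivAt_of_bilinear hη.hasFDerivAt hf.hasFDerivAt
  simp only [hb] at h1
  refine ⟨_, _, h1, fun u w => ?_, fun u w => ?_⟩
  · change b (η y) (fderiv ℝ f y u) w = _
    rw [hb, ContinuousLinearMap.smulRight_apply]
  · change b (fderiv ℝ η y u) (f y) w = _
    rw [hb, ContinuousLinearMap.smulRight_apply]

/-- The Leibniz rule for the product of a one-form and a `k`-form; the first term only depends on
`df`. -/
lemma extDeriv_oneWedge {k : ℕ} {f : E → E →L[ℝ] ℂ} {η : E → E [⋀^Fin k]→L[ℝ] ℂ} {y : E}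
    (hf : DifferentiableAt ℝ f y) (hη : DifferentiableAt ℝ η y) :
    DifferentiableAt ℝ (fun z => oneWedge (f z) (η z)) y ∧
    extDeriv (fun z => oneWedge (f z) (η z)) y =
      bilinWedge (fderiv ℝ f y) (η y) - oneWedge (f y) (extDeriv η y) := by
  obtain ⟨F₁, F₂, h, h₁, h₂⟩ := exists_hasFDerivAt_smulRight hf hη
  have h' : HasFDerivAt (fun z => oneWedge (f z) (η z))
      (alternatizeUncurryFinCLM ℝ E ℂ ∘L (F₁ + F₂)) y :=
    (alternatizeUncurryFinCLM ℝ E ℂ).hasFDerivAt.comp y h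
  refine ⟨h'.differentiableAt, ?_⟩
  rw [extDeriv, h'.fderiv, ContinuousLinearMap.comp_add, alternatizeUncurryFin_add,
    alternatizeUncurryFin_comp_eq_bilinWedge F₁ _ _ h₁,
    alternatizeUncurryFin_comp_eq_neg_oneWedge F₂ _ _ h₂, extDeriv, sub_eq_add_neg]

variable {ι : Type*} [Fintype ι]

/-- The forms obtained by substituting the one-forms `f i` into `a` are differentiable at `y`, and
their exterior derivatives at `y` are the forms of one degree more obtained from `b`. The elements
`a` and `b` need not be homogeneous. -/
structure HasExtDeriv (f : ι → E → E →L[ℝ] ℂ) (y : E) (a b : ExteriorAlgebra ℂ (ι → ℂ)) :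
    Prop where
  differentiableAt (k : ℕ) : DifferentiableAt ℝ (fun z => evalForm (fun i => f i z) a k) y
  extDeriv_eq (k : ℕ) :
    extDeriv (fun z => evalForm (fun i => f i z) a k) y = evalForm (fun i => f i y) b (k + 1)
  degree_zero : evalForm (fun i => f i y) b 0 = 0

variable {f : ι → E → E →L[ℝ] ℂ} {y : E} {a a' b b' : ExteriorAlgebra ℂ (ι → ℂ)}

lemma extDeriv_const {k : ℕ} (η : E [⋀^Fin k]→L[ℝ] ℂ) (y : E) :
    extDeriv (fun _ : E => η) y = 0 := by
  have : fderiv ℝ (fun _ : E => η) y = 0 := fderiv_const_apply η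
  rw [extDeriv, this]
  exact (alternatizeUncurryFinCLM ℝ E ℂ).map_zero

lemma HasExtDeriv.one : HasExtDeriv f y 1 0 := by
  refine ⟨fun k => ?_, fun k => ?_, ?_⟩
  · simp only [evalForm_one]
    exact differentiableAt_const _
  · simp only [evalForm_one]
    rw [extDeriv_const, LinearMap.map_zero]
    rfl
  · rw [LinearMap.map_zero]
    rfl

lemma HasExtDeriv.add (h : HasExtDeriv f y a b) (h' : HasExtDeriv f y a' b') :
    HasExtDeriv f y (a + a') (b + b') := by
  refine ⟨fun k => ?_, fun k => ?_, ?_⟩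
  · simp only [LinearMap.map_add, Pi.add_apply]
    exact (h.1 k).add (h'.1 k)
  · simp only [LinearMap.map_add, Pi.add_apply]
    rw [extDeriv_fun_add (h.1 k) (h'.1 k), h.2, h'.2]
  · rw [LinearMap.map_add, Pi.add_apply, h.3, h'.3, add_zero]

lemma HasExtDeriv.smul (c : ℂ) (h : HasExtDeriv f y a b) :
    HasExtDeriv f y (c • a) (c • b) := by
  refine ⟨fun k => ?_, fun k => ?_, ?_⟩
  · simp only [LinearMap.map_smul, Pi.smul_apply]
    exact (h.1 k).const_smul c
  · simp only [LinearMap.map_smul, Pi.smul_apply]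
    rw [← h.2, extDeriv, extDeriv, fderiv_fun_const_smul (h.1 k), alternatizeUncurryFin_smul]
  · rw [LinearMap.map_smul, Pi.smul_apply, h.3]
    ext v
    simp

lemma HasExtDeriv.neg (h : HasExtDeriv f y a b) : HasExtDeriv f y (-a) (-b) := by
  simpa using h.smul (-1)

lemma HasExtDeriv.sub (h : HasExtDeriv f y a b) (h' : HasExtDeriv f y a' b') :
    HasExtDeriv f y (a - a') (b - b') := by
  simpa [sub_eq_add_neg] using h.add h'.neg

lemma HasExtDeriv.zero : HasExtDeriv f y 0 0 := by
  simpa using (HasExtDeriv.one (f := f) (y := y)).smul 0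

lemma HasExtDeriv.sum {κ : Type*} (s : Finset κ) (x x' : κ → ExteriorAlgebra ℂ (ι → ℂ))
    (h : ∀ i ∈ s, HasExtDeriv f y (x i) (x' i)) :
    HasExtDeriv f y (∑ i ∈ s, x i) (∑ i ∈ s, x' i) := by
  classical
  induction s using Finset.induction_on with
  | empty => simpa using HasExtDeriv.zero
  | insert i s hi ih =>
    rw [Finset.sum_insert hi, Finset.sum_insert hi]
    exact (h i (by simp)).add (ih fun j hj => h j (by simp [hj]))

/-- The element `δ` of the exterior algebra acts as the two-form with the same antisymmetrization as
the bilinear map `B`. -/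
structure RepresentsBilin (f : ι → E →L[ℝ] ℂ) (B : E →L[ℝ] E →L[ℝ] ℂ)
    (δ : ExteriorAlgebra ℂ (ι → ℂ)) : Prop where
  zero (a : ExteriorAlgebra ℂ (ι → ℂ)) : evalForm f (δ * a) 0 = 0
  one (a : ExteriorAlgebra ℂ (ι → ℂ)) : evalForm f (δ * a) 1 = 0
  add_two (a : ExteriorAlgebra ℂ (ι → ℂ)) (k : ℕ) :
    evalForm f (δ * a) (k + 2) = bilinWedge B (evalForm f a k)

section RepresentsBilin

variable {g : ι → E →L[ℝ] ℂ} {B B' : E →L[ℝ] E →L[ℝ] ℂ} {δ δ' : ExteriorAlgebra ℂ (ι → ℂ)}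

lemma RepresentsBilin.gen_mul_gen [DecidableEq ι] (p q : ι) :
    RepresentsBilin g (tensorOne (g p) (g q)) (gen p * gen q) := by
  refine ⟨fun a => ?_, fun a => ?_, fun a k => ?_⟩
  · rw [mul_assoc, evalForm_gen_mul_zero]
  · rw [mul_assoc, evalForm_gen_mul_succ, evalForm_gen_mul_zero]
    ext v
    simp [oneWedge_apply]
  · rw [mul_assoc, evalForm_gen_mul_succ, evalForm_gen_mul_succ, bilinWedge_tensorOne]

lemma RepresentsBilin.add (h : RepresentsBilin g B δ) (h' : RepresentsBilin g B' δ') :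
    RepresentsBilin g (B + B') (δ + δ') := by
  refine ⟨fun a => ?_, fun a => ?_, fun a k => ?_⟩
  · rw [add_mul, LinearMap.map_add, Pi.add_apply, h.zero, h'.zero, add_zero]
  · rw [add_mul, LinearMap.map_add, Pi.add_apply, h.one, h'.one, add_zero]
  · rw [add_mul, LinearMap.map_add, Pi.add_apply, h.add_two, h'.add_two]
    ext v
    simp only [bilinWedge_apply, ContinuousAlternatingMap.add_apply, _root_.add_apply,
      ← Finset.sum_add_distrib]
    refine Finset.sum_congr rfl fun i _ => Finset.sum_congr rfl fun j _ => ?_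
    simp only [zsmul_eq_mul]
    ring

lemma RepresentsBilin.smul (c : ℂ) (h : RepresentsBilin g B δ) :
    RepresentsBilin g (c • B) (c • δ) := by
  refine ⟨fun a => ?_, fun a => ?_, fun a k => ?_⟩
  · rw [smul_mul_assoc, LinearMap.map_smul, Pi.smul_apply, h.zero]
    ext v
    simp
  · rw [smul_mul_assoc, LinearMap.map_smul, Pi.smul_apply, h.one]
    ext v
    simp
  · rw [smul_mul_assoc, LinearMap.map_smul, Pi.smul_apply, h.add_two]
    ext v
    simp only [bilinWedge_apply, ContinuousAlternatingMap.smul_apply, _root_.smul_apply,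
      smul_eq_mul, Finset.mul_sum]
    refine Finset.sum_congr rfl fun i _ => Finset.sum_congr rfl fun j _ => ?_
    simp only [zsmul_eq_mul]
    ring

lemma RepresentsBilin.of_zero : RepresentsBilin g 0 0 := by
  refine ⟨fun a => ?_, fun a => ?_, fun a k => ?_⟩
  · rw [zero_mul, LinearMap.map_zero]; rfl
  · rw [zero_mul, LinearMap.map_zero]; rfl
  · rw [zero_mul, LinearMap.map_zero]
    ext v
    simp [bilinWedge_apply]

lemma RepresentsBilin.sum {κ : Type*} (s : Finset κ) (B : κ → E →L[ℝ] E →L[ℝ] ℂ)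
    (δ : κ → ExteriorAlgebra ℂ (ι → ℂ)) (h : ∀ i ∈ s, RepresentsBilin g (B i) (δ i)) :
    RepresentsBilin g (∑ i ∈ s, B i) (∑ i ∈ s, δ i) := by
  classical
  induction s using Finset.induction_on with
  | empty => simpa using RepresentsBilin.of_zero
  | insert i s hi ih =>
    rw [Finset.sum_insert hi, Finset.sum_insert hi]
    exact (h i (by simp)).add (ih fun j hj => h j (by simp [hj]))

end RepresentsBilin

/-- The Leibniz rule `d (e ∧ a) = de ∧ a - e ∧ da` for a generator `e` with `de` given by `δ`. -/
lemma HasExtDeriv.gen_mul [DecidableEq ι] {i : ι} {B : E →L[ℝ] E →L[ℝ] ℂ}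
    {δ : ExteriorAlgebra ℂ (ι → ℂ)} (hf : DifferentiableAt ℝ (f i) y)
    (hδ : RepresentsBilin (fun i => f i y) B δ)
    (hB : ∀ u w, fderiv ℝ (f i) y u w - fderiv ℝ (f i) y w u = B u w - B w u)
    (h : HasExtDeriv f y a b) : HasExtDeriv f y (gen i * a) (δ * a - gen i * b) := by
  refine ⟨fun k => ?_, fun k => ?_, ?_⟩
  · cases k with
    | zero => simp only [evalForm_gen_mul_zero]; exact differentiableAt_const _
    | succ k =>
      simp only [evalForm_gen_mul_succ]
      exact (extDeriv_oneWedge hf (h.1 k)).1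
  · cases k with
    | zero =>
      simp only [evalForm_gen_mul_zero]
      rw [extDeriv_const, LinearMap.map_sub, Pi.sub_apply, hδ.one, evalForm_gen_mul_succ, h.3]
      ext v
      simp [oneWedge_apply]
    | succ k =>
      rw [LinearMap.map_sub, Pi.sub_apply, hδ.add_two]
      simp only [evalForm_gen_mul_succ]
      rw [(extDeriv_oneWedge hf (h.1 k)).2, h.2, bilinWedge_congr hB]
  · rw [LinearMap.map_sub, Pi.sub_apply, hδ.zero, evalForm_gen_mul_zero, sub_zero]

end Derivative

end

/-! ### Anticommuting elements of square zero -/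

section TopDegree

variable {R : Type*} [Ring R]

lemma add_pow_of_sq_zero {t s : R} (h : Commute t s) (ht : t * t = 0) (j : ℕ) :
    (t + s) ^ (j + 1) = s ^ (j + 1) + (j + 1) • (t * s ^ j) := by
  induction j with
  | zero => simp [add_comm]
  | succ j ih =>
    have hc : s ^ (j + 1) * t = t * s ^ (j + 1) := (h.pow_right (j + 1)).symm.eq
    have hz : t * s ^ j * t = 0 := by
      rw [mul_assoc, (h.pow_right j).symm.eq, ← mul_assoc, ht, zero_mul]
    rw [pow_succ, ih, add_mul, mul_add, mul_add, smul_mul_assoc, smul_mul_assoc, hz, smul_zero,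
      zero_add, mul_assoc, ← pow_succ, hc, ← pow_succ, succ_nsmul (t * s ^ (j + 1)) (j + 1)]
    abel

/-- Anticommuting elements `e i`, `f i` of square zero, as the one-forms `α_i`, `ᾱ_i` in an exterior
algebra. -/
structure IsAnticomm {κ : Type*} (e f : κ → R) : Prop where
  ee (i : κ) : e i * e i = 0
  ff (i : κ) : f i * f i = 0
  ee_swap (i j : κ) : e i * e j = -(e j * e i)
  ff_swap (i j : κ) : f i * f j = -(f j * f i)
  fe_swap (i j : κ) : f i * e j = -(e j * f i)

variable {κ : Type*} {e f : κ → R}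

namespace IsAnticomm

lemma commute_e (h : IsAnticomm e f) (i j : κ) : Commute (e i * f i) (e j) := by
  show e i * f i * e j = e j * (e i * f i)
  rw [mul_assoc, h.fe_swap, mul_neg, ← mul_assoc, h.ee_swap i j, neg_mul, neg_neg, mul_assoc]

lemma commute_f (h : IsAnticomm e f) (i j : κ) : Commute (e i * f i) (f j) := by
  show e i * f i * f j = f j * (e i * f i)
  rw [mul_assoc, h.ff_swap, mul_neg, ← mul_assoc, ← mul_assoc, h.fe_swap j i, neg_mul]

lemma commute_ef (h : IsAnticomm e f) (i j : κ) : Commute (e i * f i) (e j * f j) :=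
  (h.commute_e i j).mul_right (h.commute_f i j)

lemma mul_e (h : IsAnticomm e f) (i : κ) : e i * f i * e i = 0 := by
  rw [mul_assoc, h.fe_swap, mul_neg, ← mul_assoc, h.ee, zero_mul, neg_zero]

lemma mul_f (h : IsAnticomm e f) (i : κ) : e i * f i * f i = 0 := by
  rw [mul_assoc, h.ff, mul_zero]

lemma ef_sq (h : IsAnticomm e f) (i : κ) : (e i * f i) * (e i * f i) = 0 := by
  rw [← mul_assoc, h.mul_e, zero_mul]

lemma commute_sum (h : IsAnticomm e f) (i : κ) (s : Finset κ) :
    Commute (e i * f i) (∑ j ∈ s, e j * f j) :=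
  Commute.sum_right _ _ _ fun j _ => h.commute_ef i j

/-- A sum of fewer than `j` commuting elements of square zero has vanishing `j`-th power. -/
lemma sum_pow_eq_zero (h : IsAnticomm e f) (s : Finset κ) :
    ∀ j, s.card < j → (∑ i ∈ s, e i * f i) ^ j = 0 := by
  classical
  induction s using Finset.induction_on with
  | empty =>
    intro j hj
    simp at hj
    rw [Finset.sum_empty, zero_pow (by omega)]
  | insert a s ha ih =>
    intro j hj
    rw [Finset.card_insert_of_notMem ha] at hj
    obtain ⟨j, rfl⟩ : ∃ j', j = j' + 1 := ⟨j - 1, by omega⟩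
    rw [Finset.sum_insert ha, add_pow_of_sq_zero (h.commute_sum a s) (h.ef_sq a),
      ih (j + 1) (by omega), ih j (by omega), mul_zero, smul_zero, add_zero]

/-- A product is killed by the pair of each index occurring in it. -/
lemma mul_quad_eq_zero (h : IsAnticomm e f) {i k s l r : κ} (hi : i = k ∨ i = s ∨ i = l ∨ i = r) :
    e i * f i * (e k * e s * (f l * f r)) = 0 := by
  have he : ∀ j y, e i * f i * (e j * y) = e j * (e i * f i * y) := fun j y => by
    rw [← mul_assoc, (h.commute_e i j).eq, mul_assoc]
  have hf : ∀ j y, e i * f i * (f j * y) = f j * (e i * f i * y) := fun j y => by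
    rw [← mul_assoc, (h.commute_f i j).eq, mul_assoc]
  rw [mul_assoc (e k)]
  rcases hi with rfl | rfl | rfl | rfl
  · rw [← mul_assoc, h.mul_e, zero_mul]
  · rw [he, ← mul_assoc _ (e i), h.mul_e, zero_mul, mul_zero]
  · rw [he, he, ← mul_assoc _ (f i) , h.mul_f, zero_mul, mul_zero, mul_zero]
  · rw [he, he, hf, h.mul_f, mul_zero, mul_zero, mul_zero]

variable [Fintype κ] [DecidableEq κ]

/-- In front of `x`, the pairs `e i * f i` annihilating `x` may be dropped from a power of the
sum. -/
lemma sum_pow_mul (h : IsAnticomm e f) (U : Finset κ) {x : R}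
    (hx : ∀ i ∈ U, e i * f i * x = 0) (j : ℕ) :
    (∑ i, e i * f i) ^ j * x = (∑ i ∈ Uᶜ, e i * f i) ^ j * x := by
  have hN : (∑ i, e i * f i) = ∑ i ∈ Uᶜ, e i * f i + ∑ i ∈ U, e i * f i := by
    rw [add_comm, Finset.sum_add_sum_compl]
  have hU : (∑ i ∈ U, e i * f i) * x = 0 := by
    rw [Finset.sum_mul]; exact Finset.sum_eq_zero hx
  have hc : Commute (∑ i ∈ Uᶜ, e i * f i) (∑ i, e i * f i) :=
    Commute.sum_left _ _ _ fun i _ => h.commute_sum i _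
  induction j with
  | zero => simp
  | succ j ih =>
    have hstep : (∑ i, e i * f i) * x = (∑ i ∈ Uᶜ, e i * f i) * x := by
      rw [hN, add_mul, hU, add_zero]
    rw [pow_succ, mul_assoc, hstep, ← mul_assoc, (hc.symm.pow_left j).eq, mul_assoc, ih,
      ← mul_assoc, ← pow_succ']

/-- A product divisible by generators with more than two indices is killed by the power `m - 2` of
`∑ e i * f i`. -/
lemma sum_pow_mul_eq_zero (h : IsAnticomm e f) {m : ℕ} (hm : Fintype.card κ = m + 2) (U : Finset κ)
    (hU : 2 < U.card) {x : R} (hx : ∀ i ∈ U, e i * f i * x = 0) :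
    (∑ i, e i * f i) ^ m * x = 0 := by
  rw [h.sum_pow_mul U hx, h.sum_pow_eq_zero _ m, zero_mul]
  rw [Finset.card_compl]
  have := U.card_le_univ
  omega

/-- The top-degree product `(∑ e_i f_i) ^ m e_p f_p e_q f_q` does not depend on `p ≠ q`: it is a
fixed multiple of the volume element `(∑ e_i f_i) ^ (m + 2)`. -/
lemma sum_pow_mul_pair (h : IsAnticomm e f) {m : ℕ} (hm : Fintype.card κ = m + 2) {p q : κ}
    (hpq : p ≠ q) :
    ((m + 2) * (m + 1)) • ((∑ i, e i * f i) ^ m * (e p * f p * (e q * f q))) =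
      (∑ i, e i * f i) ^ (m + 2) := by
  set s := ∑ i ∈ ({p, q} : Finset κ)ᶜ, e i * f i with hs
  have hcard : (({p, q} : Finset κ)ᶜ).card = m := by
    rw [Finset.card_compl, Finset.card_pair hpq]; omega
  have h0 : ∀ j, m < j → s ^ j = 0 := fun j hj => h.sum_pow_eq_zero _ j (by omega)
  have hN : (∑ i, e i * f i) = e p * f p + (e q * f q + s) := by
    rw [hs, ← Finset.sum_add_sum_compl {p, q}, Finset.sum_pair hpq, add_assoc]
  have hps : Commute (e p * f p) s := h.commute_sum p _
  have hqs : Commute (e q * f q) s := h.commute_sum q _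
  rw [h.sum_pow_mul {p, q}, hN, add_pow_of_sq_zero ((h.commute_ef p q).add_right hps) (h.ef_sq p),
    add_pow_of_sq_zero hqs (h.ef_sq q), add_pow_of_sq_zero hqs (h.ef_sq q),
    h0 (m + 1 + 1) (by omega), h0 (m + 1) (by omega)]
  · rw [← hs, mul_zero, smul_zero, add_zero, zero_add, zero_add,
      ((hps.mul_left hqs).symm.pow_left m).eq, mul_smul_comm, smul_smul, mul_assoc (e p * f p)]
  · intro i hi
    simp only [Finset.mem_insert, Finset.mem_singleton] at hi
    rcases hi with rfl | rfl
    · rw [← mul_assoc, h.ef_sq, zero_mul]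
    · rw [← mul_assoc, (h.commute_ef i p).eq, mul_assoc, h.ef_sq, mul_zero]

variable [Algebra ℂ R]

/-- In the top degree, `e_k e_s f_l f_r` survives only if `{k, s} = {l, r}`, and then it is, up to
sign, independent of the indices. -/
lemma sum_pow_mul_quad (h : IsAnticomm e f) {m : ℕ} (hm : Fintype.card κ = m + 2) :
    ∃ τ : R, ∀ k s l r : κ, (∑ i, e i * f i) ^ m * (e k * e s * (f l * f r)) =
      (if k = s then 0 else
        (if k = r ∧ s = l then (1 : ℂ) else 0) - (if k = l ∧ s = r then 1 else 0)) • τ := by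
  let c : ℂ := (((m + 2) * (m + 1) : ℕ) : ℂ)
  have hc : c ≠ 0 := by
    exact Nat.cast_ne_zero.2 (by positivity)
  refine ⟨c⁻¹ • (∑ i, e i * f i) ^ (m + 2), fun k s l r => ?_⟩
  have hpair : ∀ p q : κ, p ≠ q → (∑ i, e i * f i) ^ m * (e p * f p * (e q * f q)) =
      c⁻¹ • (∑ i, e i * f i) ^ (m + 2) := by
    intro p q hpq
    rw [← h.sum_pow_mul_pair hm hpq, ← Nat.cast_smul_eq_nsmul ℂ, smul_smul, inv_mul_cancel₀ hc,
      one_smul]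
  by_cases hks : k = s
  · subst hks
    simp [h.ee]
  by_cases hlr : l = r
  · subst hlr
    have h1 : ¬(k = l ∧ s = l) := by rintro ⟨rfl, rfl⟩; exact hks rfl
    simp [h.ff, h1]
  rw [if_neg hks]
  by_cases h1 : k = l ∧ s = r
  · obtain ⟨rfl, rfl⟩ := h1
    have h2 : ¬(k = s ∧ s = k) := by rintro ⟨rfl, _⟩; exact hks rfl
    have : e k * e s * (f k * f s) = -(e k * f k * (e s * f s)) := by
      rw [mul_assoc (e k) (f k), ← mul_assoc (f k), h.fe_swap k s, neg_mul, mul_neg, neg_neg,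
        mul_assoc, mul_assoc]
    rw [this, mul_neg, hpair k s hks]
    simp [h2]
  by_cases h2 : k = r ∧ s = l
  · obtain ⟨rfl, rfl⟩ := h2
    have : e k * e s * (f s * f k) = e k * f k * (e s * f s) := by
      rw [mul_assoc (e k) (f k), (h.commute_f s k).symm.eq, mul_assoc, mul_assoc]
    rw [this, hpair k s hks]
    simp [h1]
  · -- In the remaining case at least three distinct indices occur.
    rw [if_neg h1, if_neg h2, sub_zero, zero_smul]
    refine h.sum_pow_mul_eq_zero hm {k, s, l, r} ?_ fun i hi => h.mul_quad_eq_zero ?_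
    · by_contra hcon
      push Not at hcon
      have hk2 : ({k, s} : Finset κ).card = 2 := Finset.card_pair hks
      have hl2 : ({l, r} : Finset κ).card = 2 := Finset.card_pair hlr
      have e1 : ({k, s} : Finset κ) = {k, s, l, r} :=
        Finset.eq_of_subset_of_card_le (by intro x; simp; tauto) (by omega)
      have e2 : ({l, r} : Finset κ) = {k, s, l, r} :=
        Finset.eq_of_subset_of_card_le (by intro x; simp; tauto) (by omega)
      have hl : l ∈ ({k, s} : Finset κ) := by rw [e1]; simp
      have hr : r ∈ ({k, s} : Finset κ) := by rw [e1]; simp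
      simp only [Finset.mem_insert, Finset.mem_singleton] at hl hr
      rcases hl with rfl | rfl <;> rcases hr with rfl | rfl
      · exact hlr rfl
      · exact h1 ⟨rfl, rfl⟩
      · exact h2 ⟨rfl, rfl⟩
      · exact hlr rfl
    · simpa using hi

end IsAnticomm

/-- The sum over ordered pairs of distinct indices, gathered by unordered pairs. -/
lemma sum_ne_eq_sum_Ioi {M : Type*} [AddCommMonoid M] {n : ℕ} (g : Fin n → Fin n → M) :
    ∑ k, ∑ s, (if k = s then 0 else g k s) = ∑ k, ∑ s ∈ Finset.Ioi k, (g k s + g s k) := by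
  have h : ∀ k s, (if k = s then 0 else g k s) =
      (if k < s then g k s else 0) + (if s < k then g k s else 0) := by
    intro k s
    rcases lt_trichotomy k s with h | h | h
    · simp [h, h.ne, h.not_gt]
    · simp [h]
    · simp [h, h.ne', h.not_gt]
  have h2 : ∀ k : Fin n, (Finset.Ioi k) = Finset.univ.filter (k < ·) := fun k => by ext; simp
  simp only [h, Finset.sum_add_distrib, h2, Finset.sum_filter]
  congr 1
  rw [Finset.sum_comm]

/-- The quadratic condition is the vanishing of the coefficient of `β ∧ β̄ - a ∧ ā` in the top
degree, for `β = ∑ B_kl e_k f_l` and `a = ∑ A_ij e_i e_j`. -/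
lemma top_degree_vanishing [Algebra ℂ R] {m : ℕ} {e f : Fin (m + 2) → R} (h : IsAnticomm e f)
    (A B : Fin (m + 2) → Fin (m + 2) → ℂ) (hq : QuadraticCondition A B) :
    (∑ i, e i * f i) ^ m *
      ((∑ k, ∑ l, B k l • (e k * f l)) * (∑ k, ∑ l, conj (B k l) • (f k * e l)) -
      (∑ i, ∑ j ∈ Finset.Ioi i, A i j • (e i * e j)) *
        (∑ i, ∑ j ∈ Finset.Ioi i, conj (A i j) • (f i * f j))) = 0 := by
  obtain ⟨τ, hτ⟩ := h.sum_pow_mul_quad (m := m) (by simp)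
  set N := (∑ i, e i * f i) ^ m
  -- The coefficient of `sum_pow_mul_quad` as nested indicators, to be summed over `r` and `s`.
  have hcoef : ∀ k s l r : Fin (m + 2), (if k = s then 0 else
        (if k = r ∧ s = l then (1 : ℂ) else 0) - (if k = l ∧ s = r then 1 else 0)) =
      (if r = k then (if s = l then (if k = l then 0 else 1) else 0) else 0) -
      (if l = k then (if r = s then (if k = s then 0 else 1) else 0) else 0) := by
    intro k s l r
    grind
  have hswap : ∀ k l r s, e k * f l * (f r * e s) = e k * e s * (f l * f r) := by
    intro k l r s
    have h1 : f l * (f r * e s) = e s * (f l * f r) := by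
      rw [h.fe_swap r s, mul_neg, ← mul_assoc, h.fe_swap l s, neg_mul, neg_neg, mul_assoc]
    rw [mul_assoc, h1, mul_assoc]
  have hgen : ∀ (X Y : Fin (m + 2) → Fin (m + 2) → ℂ) (u w : Fin (m + 2) → Fin (m + 2) → R),
      N * ((∑ k, ∑ l, X k l • u k l) * (∑ r, ∑ s, Y r s • w r s)) =
        ∑ k, ∑ l, ∑ r, ∑ s, (X k l * Y r s) • (N * (u k l * w r s)) := by
    intro X Y u w
    rw [Finset.sum_mul, Finset.mul_sum]
    refine Finset.sum_congr rfl fun k _ => ?_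
    rw [Finset.sum_mul, Finset.mul_sum]
    refine Finset.sum_congr rfl fun l _ => ?_
    rw [Finset.mul_sum, Finset.mul_sum]
    refine Finset.sum_congr rfl fun r _ => ?_
    rw [Finset.mul_sum, Finset.mul_sum]
    refine Finset.sum_congr rfl fun s _ => ?_
    rw [smul_mul_smul_comm, mul_smul_comm]
  have hB : N * ((∑ k, ∑ l, B k l • (e k * f l)) * (∑ k, ∑ l, conj (B k l) • (f k * e l))) =
      ((∑ k, ∑ l, if k = l then 0 else B k l * conj (B k l)) -
        ∑ k, ∑ l, if k = l then 0 else B k k * conj (B l l)) • τ := by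
    rw [hgen]
    simp only [hswap, hτ, smul_smul, ← Finset.sum_smul]
    congr 1
    simp only [hcoef, mul_sub, Finset.sum_sub_distrib, mul_ite, mul_zero, mul_one,
      Finset.sum_ite_eq, Finset.sum_ite_eq', Finset.mem_univ, if_true, Finset.sum_ite_irrel,
      Finset.sum_const_zero]
  have hIoi : ∀ (X : Fin (m + 2) → Fin (m + 2) → ℂ) (u : Fin (m + 2) → Fin (m + 2) → R),
      ∑ i, ∑ j ∈ Finset.Ioi i, X i j • u i j = ∑ i, ∑ j, (if i < j then X i j else 0) • u i j := by
    intro X u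
    have h2 : ∀ k : Fin (m + 2), (Finset.Ioi k) = Finset.univ.filter (k < ·) := fun k => by
      ext; simp
    simp only [h2, Finset.sum_filter, ite_smul, zero_smul]
  have hA : N * ((∑ i, ∑ j ∈ Finset.Ioi i, A i j • (e i * e j)) *
        (∑ i, ∑ j ∈ Finset.Ioi i, conj (A i j) • (f i * f j))) =
      (-∑ i, ∑ j ∈ Finset.Ioi i, A i j * conj (A i j)) • τ := by
    rw [hIoi, hIoi, hgen]
    simp only [hτ, smul_smul, ← Finset.sum_smul]
    congr 1
    have h2 : ∀ k : Fin (m + 2), (Finset.Ioi k) = Finset.univ.filter (k < ·) := fun k => by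
      ext; simp
    simp only [h2, Finset.sum_filter, ← Finset.sum_neg_distrib]
    refine Finset.sum_congr rfl fun i _ => Finset.sum_congr rfl fun j _ => ?_
    by_cases hij : i < j
    · have : ∀ r s : Fin (m + 2), (if i < j then A i j else 0) *
          (if r < s then conj (A r s) else 0) * (if i = j then 0 else
          (if i = s ∧ j = r then (1 : ℂ) else 0) - (if i = r ∧ j = s then 1 else 0)) =
          if r = i then (if s = j then -(A i j * conj (A i j)) else 0) else 0 := by
        intro r s
        rw [if_pos hij, if_neg hij.ne]
        by_cases h3 : r = i
        · subst h3
          by_cases h4 : s = j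
          · subst h4
            have : ¬(r = s ∧ s = r) := fun h => hij.ne h.1
            simp [hij, this]
          · have h4' : ¬ j = s := fun h => h4 h.symm
            have : ¬(r = s ∧ j = r) := fun h => hij.ne h.2.symm
            simp [h4, h4', this]
        · have h3' : ¬ i = r := fun h => h3 h.symm
          by_cases h5 : i = s ∧ j = r
          · obtain ⟨rfl, rfl⟩ := h5
            simp [hij.not_gt, hij.ne']
          · simp [h3, h3', h5]
      simp only [this]
      simp [hij]
    · simp [hij]
  rw [mul_sub, hB, hA, ← sub_smul]
  refine smul_eq_zero_of_left ?_ τ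
  rw [sum_ne_eq_sum_Ioi fun k l => B k k * conj (B l l)]
  have herase : ∀ k : Fin (m + 2), Finset.univ.erase k = Finset.univ.filter (fun l => ¬ k = l) :=
    fun k => by ext; simp [eq_comm]
  have hq' := congrArg (fun x : ℝ => (x : ℂ)) hq
  simp only [herase, Finset.sum_filter] at hq'
  have hre : ((2 * (∑ i, ∑ j ∈ Finset.Ioi i, B i i * conj (B j j)).re : ℝ) : ℂ) =
      ∑ i, ∑ j ∈ Finset.Ioi i, (B i i * conj (B j j) + B j j * conj (B i i)) := by
    rw [← Complex.add_conj]
    simp only [map_sum, map_mul, Complex.conj_conj, ← Finset.sum_add_distrib]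
    simp only [mul_comm]
  rw [Complex.ofReal_sub, hre] at hq'
  simp only [Complex.ofReal_add, Complex.ofReal_sum, Complex.ofReal_zero, Complex.ofReal_pow,
    apply_ite ((↑) : ℝ → ℂ), ite_not] at hq'
  simp only [Complex.mul_conj']
  linear_combination hq'

end TopDegree

/-! ### Powers of the fundamental form in the exterior algebra -/

section Model

/-- The exterior algebra on generators `e_i`, `ē_i`, `i ≤ m`, standing for `α_i` and `ᾱ_i`. -/
abbrev ModelAlgebra (m : ℕ) : Type :=
  ExteriorAlgebra ℂ (Fin (m + 1) ⊕ Fin (m + 1) → ℂ)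

variable {m : ℕ}

/-- The generator of the closed form `α_i`, `i < m`. -/
def genE (i : Fin m) : ModelAlgebra m := gen (Sum.inl i.castSucc)

/-- The generator of the closed form `ᾱ_i`, `i < m`. -/
def genEbar (i : Fin m) : ModelAlgebra m := gen (Sum.inr i.castSucc)

/-- The generator of the form `α_m`. -/
def lastE : ModelAlgebra m := gen (Sum.inl (Fin.last m))

/-- The generator of the form `ᾱ_m`. -/
def lastEbar : ModelAlgebra m := gen (Sum.inr (Fin.last m))

lemma isAnticomm_gen : IsAnticomm (genE (m := m)) genEbar where
  ee _ := gen_mul_gen_self _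
  ff _ := gen_mul_gen_self _
  ee_swap _ _ := gen_mul_gen_comm _ _
  ff_swap _ _ := gen_mul_gen_comm _ _
  fe_swap _ _ := gen_mul_gen_comm _ _

/-- `∑ α_i ∧ ᾱ_i` over the closed forms. -/
def baseForm : ModelAlgebra m := ∑ i : Fin m, genE i * genEbar i

/-- The `(2, 0)`-part of `dα_m`. -/
def partA (A : Fin m → Fin m → ℂ) : ModelAlgebra m :=
  ∑ i, ∑ j ∈ Finset.Ioi i, A i j • (genE i * genE j)

/-- The conjugate of the `(2, 0)`-part of `dα_m`. -/
def partAbar (A : Fin m → Fin m → ℂ) : ModelAlgebra m :=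
  ∑ i, ∑ j ∈ Finset.Ioi i, conj (A i j) • (genEbar i * genEbar j)

/-- The `(1, 1)`-part of `dα_m`. -/
def partB (B : Fin m → Fin m → ℂ) : ModelAlgebra m :=
  ∑ k, ∑ l, B k l • (genE k * genEbar l)

/-- The conjugate of the `(1, 1)`-part of `dα_m`. -/
def partBbar (B : Fin m → Fin m → ℂ) : ModelAlgebra m :=
  ∑ k, ∑ l, conj (B k l) • (genEbar k * genE l)

/-- The fundamental form `(i / 2) ∑ α_i ∧ ᾱ_i` of the diagonal metric. -/
def kahlerElt : ModelAlgebra m :=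
  (Complex.I / 2) • (lastE * lastEbar + baseForm)

/-- `∂̄ (F ^ (k + 1))` for the fundamental form `F`: with `F₀ = ∑ α_i ∧ ᾱ_i` over the closed forms,
a multiple of `F₀ ^ k ∧ (β ∧ ᾱ_m - α_m ∧ ā)`, where `dα_m = a + β`. -/
def delBarElt (A B : Fin m → Fin m → ℂ) (k : ℕ) : ModelAlgebra m :=
  ((Complex.I / 2) ^ (k + 1) * (k + 1)) •
    (baseForm ^ k * (partB B * lastEbar - lastE * partAbar A))

/-- `∂ (F ^ (k + 1))` for the fundamental form `F`. -/
def delElt (A B : Fin m → Fin m → ℂ) (k : ℕ) : ModelAlgebra m :=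
  ((Complex.I / 2) ^ (k + 1) * (k + 1)) •
    (baseForm ^ k * (partA A * lastEbar - lastE * partBbar B))

lemma commute_last_base : Commute (lastE * lastEbar : ModelAlgebra m) baseForm := by
  have h : IsAnticomm (fun i : Fin (m + 1) => (gen (Sum.inl i) : ModelAlgebra m))
      (fun i => gen (Sum.inr i)) :=
    { ee := fun _ => gen_mul_gen_self _
      ff := fun _ => gen_mul_gen_self _
      ee_swap := fun _ _ => gen_mul_gen_comm _ _
      ff_swap := fun _ _ => gen_mul_gen_comm _ _
      fe_swap := fun _ _ => gen_mul_gen_comm _ _ }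
  exact Commute.sum_right _ _ _ fun i _ => h.commute_ef _ _

lemma last_sq : (lastE * lastEbar * (lastE * lastEbar) : ModelAlgebra m) = 0 := by
  have h1 : (lastEbar * lastE : ModelAlgebra m) = -(lastE * lastEbar) := gen_mul_gen_comm _ _
  have h2 : (lastE * lastE : ModelAlgebra m) = 0 := gen_mul_gen_self _
  rw [mul_assoc, ← mul_assoc lastEbar, h1, neg_mul, mul_neg, mul_assoc, ← mul_assoc lastE lastE,
    h2, zero_mul, neg_zero]

lemma kahlerElt_pow_succ (k : ℕ) : (kahlerElt : ModelAlgebra m) ^ (k + 1) =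
    (Complex.I / 2) ^ (k + 1) •
      (baseForm ^ (k + 1) + (k + 1) • (baseForm ^ k * (lastE * lastEbar))) := by
  rw [kahlerElt, smul_pow, add_pow_of_sq_zero commute_last_base last_sq,
    (commute_last_base.pow_right k).eq]

/-! ### Types of the forms in the coframe -/

section Weight

variable {V : Type*} [NormedAddCommGroup V] [NormedSpace ℝ V]

/-- The one-forms `f (inl i)` are of type `(1, 0)` and `f (inr i)` are their conjugates. -/
structure IsTypedFrame (J : V →L[ℝ] V) (f : Fin (m + 1) ⊕ Fin (m + 1) → V →L[ℝ] ℂ) : Prop where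
  type_one_zero (i : Fin (m + 1)) (v : V) : f (Sum.inl i) (J v) = Complex.I * f (Sum.inl i) v
  inr_apply (i : Fin (m + 1)) (v : V) : f (Sum.inr i) v = conj (f (Sum.inl i) v)

variable {J : V →L[ℝ] V} {f : Fin (m + 1) ⊕ Fin (m + 1) → V →L[ℝ] ℂ} {w : ℤ} {a : ModelAlgebra m}

lemma IsTypedFrame.inl_rot (h : IsTypedFrame J f) (i : Fin (m + 1)) (θ : ℝ) :
    f (Sum.inl i) ∘L rot J θ = Complex.exp (Complex.I * (1 : ℤ) * θ) • f (Sum.inl i) := by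
  ext v
  have : Complex.exp (Complex.I * (1 : ℤ) * θ) = Real.cos θ + Real.sin θ * Complex.I := by
    rw [Int.cast_one, mul_one, mul_comm, Complex.exp_mul_I, Complex.ofReal_cos, Complex.ofReal_sin]
  rw [this]
  simp [rot, h.type_one_zero]
  ring

lemma IsTypedFrame.inr_rot (h : IsTypedFrame J f) (i : Fin (m + 1)) (θ : ℝ) :
    f (Sum.inr i) ∘L rot J θ = Complex.exp (Complex.I * (-1 : ℤ) * θ) • f (Sum.inr i) := by
  ext v
  have : Complex.exp (Complex.I * (-1 : ℤ) * θ) = Real.cos θ - Real.sin θ * Complex.I := by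
    have : (Complex.I * (-1 : ℤ) * θ) = ((-θ : ℝ) : ℂ) * Complex.I := by push_cast; ring
    rw [this, Complex.exp_mul_I, ← Complex.ofReal_cos, ← Complex.ofReal_sin]
    simp
    ring
  rw [this]
  simp [rot, h.type_one_zero, h.inr_apply]
  ring

lemma IsTypedFrame.inl_mul (h : IsTypedFrame J f) {i : Fin (m + 1)} (ha : HasWeight J f w a) :
    HasWeight J f (1 + w) (gen (Sum.inl i) * a) := HasWeight.gen_mul (h.inl_rot i) ha

lemma IsTypedFrame.inr_mul (h : IsTypedFrame J f) {i : Fin (m + 1)} (ha : HasWeight J f w a) :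
    HasWeight J f (-1 + w) (gen (Sum.inr i) * a) := HasWeight.gen_mul (h.inr_rot i) ha

lemma IsTypedFrame.base_mul (h : IsTypedFrame J f) (ha : HasWeight J f w a) :
    HasWeight J f w (baseForm * a) := by
  rw [baseForm, Finset.sum_mul]
  refine HasWeight.sum _ _ fun i _ => ?_
  rw [mul_assoc]
  simpa [genE, genEbar] using h.inl_mul (h.inr_mul ha)

lemma IsTypedFrame.base_pow_mul (h : IsTypedFrame J f) (ha : HasWeight J f w a) (k : ℕ) :
    HasWeight J f w (baseForm ^ k * a) := by
  induction k with
  | zero => simpa using ha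
  | succ k ih =>
    rw [pow_succ', mul_assoc]
    exact h.base_mul ih

lemma IsTypedFrame.last_mul (h : IsTypedFrame J f) : HasWeight J f 0 (lastE * lastEbar) := by
  simpa [lastE, lastEbar] using h.inl_mul (h.inr_mul HasWeight.one)

lemma IsTypedFrame.kahlerElt_pow (h : IsTypedFrame J f) (k : ℕ) :
    HasWeight J f 0 (kahlerElt ^ k) := by
  cases k with
  | zero => simpa using HasWeight.one
  | succ k =>
    rw [kahlerElt_pow_succ, ← Nat.cast_smul_eq_nsmul ℂ]
    refine HasWeight.smul _ (HasWeight.add ?_ (HasWeight.smul _ (h.base_pow_mul h.last_mul k)))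
    simpa using h.base_pow_mul HasWeight.one (k + 1)

lemma IsTypedFrame.delBarElt (h : IsTypedFrame J f) (A B : Fin m → Fin m → ℂ) (k : ℕ) :
    HasWeight J f (-1) (delBarElt A B k) := by
  refine HasWeight.smul _ (h.base_pow_mul (HasWeight.sub ?_ ?_) k)
  · simp only [partB, Finset.sum_mul, smul_mul_assoc, mul_assoc]
    refine HasWeight.sum _ _ fun i _ => HasWeight.sum _ _ fun j _ => HasWeight.smul _ ?_
    simpa [lastEbar, genE, genEbar] using h.inl_mul (h.inr_mul (h.inr_mul HasWeight.one))
  · simp only [partAbar, Finset.mul_sum, mul_smul_comm]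
    refine HasWeight.sum _ _ fun i _ => HasWeight.sum _ _ fun j _ => HasWeight.smul _ ?_
    simpa [lastE, genEbar] using h.inl_mul (h.inr_mul (h.inr_mul HasWeight.one))

lemma IsTypedFrame.delElt (h : IsTypedFrame J f) (A B : Fin m → Fin m → ℂ) (k : ℕ) :
    HasWeight J f 1 (delElt A B k) := by
  refine HasWeight.smul _ (h.base_pow_mul (HasWeight.sub ?_ ?_) k)
  · simp only [partA, Finset.sum_mul, smul_mul_assoc, mul_assoc]
    refine HasWeight.sum _ _ fun i _ => HasWeight.sum _ _ fun j _ => HasWeight.smul _ ?_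
    simpa [lastEbar, genE, genEbar] using h.inl_mul (h.inl_mul (h.inr_mul HasWeight.one))
  · simp only [partBbar, Finset.mul_sum, mul_smul_comm]
    refine HasWeight.sum _ _ fun i _ => HasWeight.sum _ _ fun j _ => HasWeight.smul _ ?_
    simpa [lastE, genEbar, genE] using h.inl_mul (h.inr_mul (h.inl_mul HasWeight.one))

end Weight

/-! ### Exterior derivatives from the structure equations -/

section Derivative

variable {E : Type*} [NormedAddCommGroup E] [NormedSpace ℝ E]

/-- The structure equations at a point `y` of a vector space, for a coframe `f (inl i)` and its
conjugate `f (inr i)`. -/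
structure StructureEquationsAt (A B : Fin m → Fin m → ℂ)
    (f : Fin (m + 1) ⊕ Fin (m + 1) → E → E →L[ℝ] ℂ) (y : E) : Prop where
  differentiableAt (i : Fin (m + 1)) : DifferentiableAt ℝ (f (Sum.inl i)) y
  inr_apply (i : Fin (m + 1)) (z v : E) : f (Sum.inr i) z v = conj (f (Sum.inl i) z v)
  closed (i : Fin m) (u v : E) : fderiv ℝ (f (Sum.inl i.castSucc)) y u v -
    fderiv ℝ (f (Sum.inl i.castSucc)) y v u = 0
  last (u v : E) : fderiv ℝ (f (Sum.inl (Fin.last m))) y u v -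
    fderiv ℝ (f (Sum.inl (Fin.last m))) y v u =
    ∑ i, ∑ j ∈ Finset.Ioi i, A i j * (f (Sum.inl i.castSucc) y u * f (Sum.inl j.castSucc) y v -
      f (Sum.inl i.castSucc) y v * f (Sum.inl j.castSucc) y u) +
    ∑ k, ∑ l, B k l * (f (Sum.inl k.castSucc) y u * f (Sum.inr l.castSucc) y v -
      f (Sum.inl k.castSucc) y v * f (Sum.inr l.castSucc) y u)

variable {A B : Fin m → Fin m → ℂ} {f : Fin (m + 1) ⊕ Fin (m + 1) → E → E →L[ℝ] ℂ} {y : E}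
  {a b : ModelAlgebra m}

namespace StructureEquationsAt

lemma inr_eq (h : StructureEquationsAt A B f y) (i : Fin (m + 1)) :
    f (Sum.inr i) = (ContinuousLinearMap.compL ℝ E ℂ ℂ (Complex.conjCLE : ℂ →L[ℝ] ℂ)) ∘
      f (Sum.inl i) := by
  funext z
  ext v
  simp [h.inr_apply]

lemma differentiableAt_inr (h : StructureEquationsAt A B f y) (i : Fin (m + 1)) :
    DifferentiableAt ℝ (f (Sum.inr i)) y := by
  rw [h.inr_eq]
  exact ((ContinuousLinearMap.compL ℝ E ℂ ℂ (Complex.conjCLE : ℂ →L[ℝ] ℂ)).differentiableAt).comp y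
    (h.differentiableAt i)

lemma fderiv_inr (h : StructureEquationsAt A B f y) (i : Fin (m + 1)) (u v : E) :
    fderiv ℝ (f (Sum.inr i)) y u v = (starRingEnd ℂ) (fderiv ℝ (f (Sum.inl i)) y u v) := by
  rw [h.inr_eq, ((ContinuousLinearMap.hasFDerivAt _).comp y
    (h.differentiableAt i).hasFDerivAt).fderiv]
  simp

lemma genE_mul (h : StructureEquationsAt A B f y) (i : Fin m) (hab : HasExtDeriv f y a b) :
    HasExtDeriv f y (genE i * a) (-(genE i * b)) := by
  simpa [genE] using HasExtDeriv.gen_mul (h.differentiableAt _) RepresentsBilin.of_zero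
    (by simpa using h.closed i) hab

lemma genEbar_mul (h : StructureEquationsAt A B f y) (i : Fin m) (hab : HasExtDeriv f y a b) :
    HasExtDeriv f y (genEbar i * a) (-(genEbar i * b)) := by
  have hB : ∀ u v, fderiv ℝ (f (Sum.inr i.castSucc)) y u v -
      fderiv ℝ (f (Sum.inr i.castSucc)) y v u = (0 : E →L[ℝ] E →L[ℝ] ℂ) u v -
      (0 : E →L[ℝ] E →L[ℝ] ℂ) v u := by
    intro u v
    rw [h.fderiv_inr, h.fderiv_inr, ← map_sub, h.closed]
    simp
  simpa [genEbar] using HasExtDeriv.gen_mul (h.differentiableAt_inr _) RepresentsBilin.of_zero hB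
    hab

lemma lastE_mul (h : StructureEquationsAt A B f y) (hab : HasExtDeriv f y a b) :
    HasExtDeriv f y (lastE * a) ((partA A + partB B) * a - lastE * b) := by
  refine HasExtDeriv.gen_mul (h.differentiableAt _) (RepresentsBilin.add
    (RepresentsBilin.sum _ _ _ fun i _ => RepresentsBilin.sum _ _ _ fun j _ =>
      (RepresentsBilin.gen_mul_gen _ _).smul _)
    (RepresentsBilin.sum _ _ _ fun i _ => RepresentsBilin.sum _ _ _ fun j _ =>
      (RepresentsBilin.gen_mul_gen _ _).smul _)) (fun u v => ?_) hab
  rw [h.last]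
  simp only [_root_.add_apply, _root_.sum_apply, _root_.smul_apply, tensorOne_apply,
    smul_eq_mul, add_sub_add_comm, ← Finset.sum_sub_distrib, ← mul_sub]

lemma lastEbar_mul (h : StructureEquationsAt A B f y) (hab : HasExtDeriv f y a b) :
    HasExtDeriv f y (lastEbar * a) ((partAbar A + partBbar B) * a - lastEbar * b) := by
  refine HasExtDeriv.gen_mul (h.differentiableAt_inr _) (RepresentsBilin.add
    (RepresentsBilin.sum _ _ _ fun i _ => RepresentsBilin.sum _ _ _ fun j _ =>
      (RepresentsBilin.gen_mul_gen _ _).smul _)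
    (RepresentsBilin.sum _ _ _ fun i _ => RepresentsBilin.sum _ _ _ fun j _ =>
      (RepresentsBilin.gen_mul_gen _ _).smul _)) (fun u v => ?_) hab
  rw [h.fderiv_inr, h.fderiv_inr, ← map_sub, h.last]
  simp only [_root_.add_apply, _root_.sum_apply, _root_.smul_apply, tensorOne_apply,
    smul_eq_mul, add_sub_add_comm, ← Finset.sum_sub_distrib, ← mul_sub, map_add, map_sum, map_mul,
    map_sub, h.inr_apply, Complex.conj_conj]

lemma base_mul (h : StructureEquationsAt A B f y) (hab : HasExtDeriv f y a b) :
    HasExtDeriv f y (baseForm * a) (baseForm * b) := by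
  rw [baseForm, Finset.sum_mul, Finset.sum_mul]
  refine HasExtDeriv.sum _ _ _ fun i _ => ?_
  rw [mul_assoc, mul_assoc]
  simpa using h.genE_mul i (h.genEbar_mul i hab)

lemma base_pow_mul (h : StructureEquationsAt A B f y) (hab : HasExtDeriv f y a b) (k : ℕ) :
    HasExtDeriv f y (baseForm ^ k * a) (baseForm ^ k * b) := by
  induction k with
  | zero => simpa using hab
  | succ k ih =>
    rw [pow_succ', mul_assoc, mul_assoc]
    exact h.base_mul ih

lemma kahlerElt_pow (h : StructureEquationsAt A B f y) (k : ℕ) :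
    HasExtDeriv f y (kahlerElt ^ (k + 1)) (delBarElt A B k + delElt A B k) := by
  have h1 : HasExtDeriv f y (lastE * lastEbar)
      ((partA A + partB B) * lastEbar - lastE * (partAbar A + partBbar B)) := by
    simpa using h.lastE_mul (h.lastEbar_mul HasExtDeriv.one)
  have h2 : HasExtDeriv f y (baseForm ^ (k + 1)) 0 := by
    simpa using h.base_pow_mul HasExtDeriv.one (k + 1)
  have h3 := (h2.add ((h.base_pow_mul h1 k).smul ((k + 1 : ℕ) : ℂ))).smul
    ((Complex.I / 2) ^ (k + 1))
  rw [kahlerElt_pow_succ, ← Nat.cast_smul_eq_nsmul ℂ]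
  convert h3 using 1
  rw [delBarElt, delElt, ← smul_add, ← mul_add, zero_add, smul_smul, Nat.cast_succ]
  congr 2
  rw [add_mul, mul_add]
  abel

/-- `d ∂̄ F ^ (k + 1)` is a multiple of `F₀ ^ k ∧ (β ∧ β̄ - a ∧ ā)`, where `F₀ = ∑ α_i ∧ ᾱ_i` is the
sum over the closed forms and `dα_m = a + β`. -/
lemma delBarElt (h : StructureEquationsAt A B f y) (k : ℕ) :
    HasExtDeriv f y (delBarElt A B k) (((Complex.I / 2) ^ (k + 1) * (k + 1)) •
      (baseForm ^ k * (partB B * partBbar B - partA A * partAbar A))) := by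
  have hB : HasExtDeriv f y (partB B * lastEbar) (partB B * (partAbar A + partBbar B)) := by
    have h1 : HasExtDeriv f y lastEbar (partAbar A + partBbar B) := by
      simpa using h.lastEbar_mul HasExtDeriv.one
    simp only [partB, Finset.sum_mul, smul_mul_assoc, mul_assoc]
    refine HasExtDeriv.sum _ _ _ fun i _ => HasExtDeriv.sum _ _ _ fun j _ => HasExtDeriv.smul _ ?_
    simpa using h.genE_mul i (h.genEbar_mul j h1)
  have hA : HasExtDeriv f y (partAbar A) 0 := by
    have : (0 : ModelAlgebra m) = ∑ i : Fin m, ∑ j ∈ Finset.Ioi i, conj (A i j) • 0 := by simp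
    rw [this, partAbar]
    refine HasExtDeriv.sum _ _ _ fun i _ => HasExtDeriv.sum _ _ _ fun j _ => HasExtDeriv.smul _ ?_
    simpa using h.genEbar_mul i (h.genEbar_mul j HasExtDeriv.one)
  have h3 := (h.base_pow_mul (hB.sub (h.lastE_mul hA)) k).smul
    ((Complex.I / 2) ^ (k + 1) * (k + 1))
  have h4 : partB B * (partAbar A + partBbar B) -
      ((partA A + partB B) * partAbar A - lastE * 0) =
      partB B * partBbar B - partA A * partAbar A := by
    rw [mul_add, add_mul, mul_zero, sub_zero]
    abel
  rw [h4] at h3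
  exact h3

end StructureEquationsAt

lemma baseForm_pow_mul_eq_zero {k : ℕ} {A B : Fin (k + 2) → Fin (k + 2) → ℂ}
    (hq : QuadraticCondition A B) :
    baseForm ^ k * (partB B * partBbar B - partA A * partAbar A) = 0 :=
  top_degree_vanishing isAnticomm_gen A B hq

end Derivative

end Model

/-! ### Differential forms in charts -/

section TypeProj

variable {V : Type*} [NormedAddCommGroup V] [NormedSpace ℝ V]

lemma typeProj_add (J : V →L[ℝ] V) {k p q : ℕ} (η η' : V [⋀^Fin k]→L[ℝ] ℂ) :
    typeProj J p q (η + η') = typeProj J p q η + typeProj J p q η' := by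
  unfold typeProj
  split_ifs
  · ext v
    simp only [ContinuousAlternatingMap.smul_apply, ContinuousAlternatingMap.sum_apply,
      ContinuousAlternatingMap.add_apply, ContinuousAlternatingMap.compContinuousLinearMap_apply,
      smul_eq_mul, mul_add, Finset.sum_add_distrib]
  · simp

lemma typeProj_zero (J : V →L[ℝ] V) {k p q : ℕ} :
    typeProj J p q (0 : V [⋀^Fin k]→L[ℝ] ℂ) = 0 := by
  have h := typeProj_add J (p := p) (q := q) (0 : V [⋀^Fin k]→L[ℝ] ℂ) 0
  rw [add_zero] at h
  exact left_eq_add.mp h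

lemma typeProj_add_eq_left (J : V →L[ℝ] V) {k p q : ℕ} {η η' : V [⋀^Fin k]→L[ℝ] ℂ}
    (h : typeProj J p q η = η) (h' : typeProj J p q η' = 0) :
    typeProj J p q (η + η') = η := by
  rw [typeProj_add, h, h', add_zero]

end TypeProj

section Chart

variable {E : Type*} [NormedAddCommGroup E] [NormedSpace ℝ E]
  {M : Type*} [TopologicalSpace M] [ChartedSpace E M]

/-- A form on the tangent space at `x`, as a form on the model space: the tangent space is the
model space, through the preferred chart at `x`. -/
def toModel {k : ℕ} (x : M) (η : TangentSpace 𝓘(ℝ, E) x [⋀^Fin k]→L[ℝ] ℂ) :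
    E [⋀^Fin k]→L[ℝ] ℂ := η

/-- The inverse of `toModel`. -/
def ofModel {k : ℕ} (x : M) (η : E [⋀^Fin k]→L[ℝ] ℂ) :
    TangentSpace 𝓘(ℝ, E) x [⋀^Fin k]→L[ℝ] ℂ := η

lemma toModel_injective {k : ℕ} {x : M} {η η' : TangentSpace 𝓘(ℝ, E) x [⋀^Fin k]→L[ℝ] ℂ}
    (h : toModel x η = toModel x η') : η = η' := h

@[simp] lemma toModel_ofModel {k : ℕ} (x : M) (η : E [⋀^Fin k]→L[ℝ] ℂ) :
    toModel x (ofModel x η) = η := rfl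

/-- The derivative of the inverse of the preferred chart at `x`, at the point `y`. -/
def chartSymmDeriv (x : M) (y : E) : E →L[ℝ] E :=
  mfderiv 𝓘(ℝ, E) 𝓘(ℝ, E) (extChartAt 𝓘(ℝ, E) x).symm y

/-- A one-form at a point as a functional on the model space. -/
def formAt (α : CForm E M 1) (x : M) : E →L[ℝ] ℂ := oneForm (toModel x (α x))

lemma formAt_apply (α : CForm E M 1) (x : M) (v : E) : formAt α x v = toModel x (α x) ![v] :=
  oneForm_apply _ _

/-- A one-form in the preferred chart at `x`. -/
def chartForm (α : CForm E M 1) (x : M) (y : E) : E →L[ℝ] ℂ :=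
  formAt α ((extChartAt 𝓘(ℝ, E) x).symm y) ∘L chartSymmDeriv x y

/-- The one-forms `α i` and their conjugates, at a point. -/
def frame {n : ℕ} (α : Fin n → CForm E M 1) (x : M) : Fin n ⊕ Fin n → E →L[ℝ] ℂ :=
  Sum.elim (fun i => formAt (α i) x)
    (fun i => (Complex.conjCLE : ℂ →L[ℝ] ℂ) ∘L formAt (α i) x)

lemma frame_inl {n : ℕ} (α : Fin n → CForm E M 1) (x : M) (i : Fin n) (v : E) :
    frame α x (Sum.inl i) v = toModel x (α i x) ![v] := formAt_apply _ _ _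

lemma frame_inr {n : ℕ} (α : Fin n → CForm E M 1) (x : M) (i : Fin n) (v : E) :
    frame α x (Sum.inr i) v = conj (toModel x (α i x) ![v]) :=
  congrArg (starRingEnd ℂ) (formAt_apply (α i) x v)

/-- The one-forms `α i` and their conjugates, in the preferred chart at `x`. -/
def chartFrame {n : ℕ} (α : Fin n → CForm E M 1) (x : M) (i : Fin n ⊕ Fin n) (y : E) :
    E →L[ℝ] ℂ :=
  frame α ((extChartAt 𝓘(ℝ, E) x).symm y) i ∘L chartSymmDeriv x y

/-- The tangent space at `x` is the model space through the chart at `x`, so that the derivative of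
this chart is the identity. -/
lemma mfderiv_extChartAt_self [IsManifold 𝓘(ℝ, E) 1 M] (x : M) :
    mfderiv 𝓘(ℝ, E) 𝓘(ℝ, E) (extChartAt 𝓘(ℝ, E) x) x = ContinuousLinearMap.id ℝ E := by
  have h : (extChartAt 𝓘(ℝ, E) x : M → E) = chartAt E x := by
    funext y; simp [extChartAt]
  rw [h, mfderiv_chartAt_eq_tangentCoordChange (mem_chart_source E x)]
  ext v
  exact tangentCoordChange_self (I := 𝓘(ℝ, E)) (mem_extChartAt_source x)

lemma chartSymmDeriv_self [IsManifold 𝓘(ℝ, E) 1 M] (x : M) :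
    chartSymmDeriv x (extChartAt 𝓘(ℝ, E) x x) = ContinuousLinearMap.id ℝ E := by
  have h := mfderivWithin_extChartAt_symm_comp_mfderiv_extChartAt (I := 𝓘(ℝ, E)) (x := x)
    (mem_extChartAt_target x)
  rw [extChartAt_to_inv, mfderiv_extChartAt_self, ModelWithCorners.range_eq_univ,
    mfderivWithin_univ] at h
  exact h

lemma chartFrame_self [IsManifold 𝓘(ℝ, E) 1 M] {n : ℕ} (α : Fin n → CForm E M 1) (x : M)
    (i : Fin n ⊕ Fin n) : chartFrame α x i (extChartAt 𝓘(ℝ, E) x x) = frame α x i := by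
  rw [chartFrame, chartSymmDeriv_self, extChartAt_to_inv]
  rfl

lemma toModel_extD [IsManifold 𝓘(ℝ, E) 1 M] {k : ℕ} (η : CForm E M k) (x : M) :
    toModel x (extD η x) = extDeriv (fun y : E =>
      (toModel _ (η ((extChartAt 𝓘(ℝ, E) x).symm y))).compContinuousLinearMap (chartSymmDeriv x y))
      (extChartAt 𝓘(ℝ, E) x x) := by
  have : toModel x (extD η x) =
      (extDeriv (fun y : E =>
        (toModel _ (η ((extChartAt 𝓘(ℝ, E) x).symm y))).compContinuousLinearMap
        (chartSymmDeriv x y)) (extChartAt 𝓘(ℝ, E) x x)).compContinuousLinearMap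
          (mfderiv 𝓘(ℝ, E) 𝓘(ℝ, E) (extChartAt 𝓘(ℝ, E) x) x : E →L[ℝ] E) := rfl
  rw [this, mfderiv_extChartAt_self]
  rfl

lemma extD_zero [IsManifold 𝓘(ℝ, E) 1 M] {k : ℕ} (x : M) :
    extD (fun _ => 0 : CForm E M k) x = 0 := by
  apply toModel_injective
  rw [toModel_extD]
  exact extDeriv_const (0 : E [⋀^Fin k]→L[ℝ] ℂ) _

/-- The differential form obtained by substituting the `α i` and their conjugates for the
generators. -/
def formOf {n : ℕ} (α : Fin n → CForm E M 1) (a : ExteriorAlgebra ℂ (Fin n ⊕ Fin n → ℂ)) (k : ℕ) :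
    CForm E M k := fun x => ofModel x (evalForm (frame α x) a k)

lemma formOf_add {m : ℕ} (α : Fin (m + 1) → CForm E M 1) (a b : ModelAlgebra m) (k : ℕ) (x : M) :
    toModel x (formOf α (a + b) k x) = toModel x (formOf α a k x) + toModel x (formOf α b k x) := by
  simp only [formOf, toModel_ofModel, map_add]
  rfl

lemma formOf_zero {m : ℕ} (α : Fin (m + 1) → CForm E M 1) (k : ℕ) :
    formOf α (0 : ModelAlgebra m) k = 0 := by
  funext x
  apply toModel_injective
  simp only [formOf, toModel_ofModel, map_zero]
  rfl

lemma extD_formOf [IsManifold 𝓘(ℝ, E) 1 M] {n : ℕ} (α : Fin n → CForm E M 1) (x : M)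
    {a b : ExteriorAlgebra ℂ (Fin n ⊕ Fin n → ℂ)}
    (h : HasExtDeriv (chartFrame α x) (extChartAt 𝓘(ℝ, E) x x) a b) (k : ℕ) :
    extD (formOf α a k) x = formOf α b (k + 1) x := by
  apply toModel_injective
  rw [toModel_extD]
  simp only [formOf, toModel_ofModel, evalForm_compContinuousLinearMap]
  refine (h.extDeriv_eq k).trans ?_
  simp only [chartFrame_self]

lemma bilinWedge_const_apply (B : E →L[ℝ] E →L[ℝ] ℂ) (v : Fin 2 → E) :
    bilinWedge B (ContinuousAlternatingMap.constOfIsEmpty ℝ E (Fin 0) (1 : ℂ)) v =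
      B (v 0) (v 1) - B (v 1) (v 0) := by
  rw [bilinWedge_apply]
  simp

/-- The exterior derivative of a one-form is the antisymmetrized derivative in the chart. -/
lemma extD_one_apply [IsManifold 𝓘(ℝ, E) 1 M] (α : CForm E M 1) (x : M)
    (h : DifferentiableAt ℝ (chartForm α x) (extChartAt 𝓘(ℝ, E) x x)) (u v : E) :
    toModel x (extD α x) ![u, v] = fderiv ℝ (chartForm α x) (extChartAt 𝓘(ℝ, E) x x) u v -
      fderiv ℝ (chartForm α x) (extChartAt 𝓘(ℝ, E) x x) v u := by
  have h1 : (fun y : E => (toModel _ (α ((extChartAt 𝓘(ℝ, E) x).symm y))).compContinuousLinearMap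
      (chartSymmDeriv x y)) = fun y => oneWedge (chartForm α x y)
        (ContinuousAlternatingMap.constOfIsEmpty ℝ E (Fin 0) (1 : ℂ)) := by
    funext y
    rw [chartForm, formAt, ← oneWedge_oneForm (toModel _ (α _)),
      oneWedge_compContinuousLinearMap, oneWedge_oneForm]
    rfl
  rw [toModel_extD, h1, (extDeriv_oneWedge h (differentiableAt_const _)).2, extDeriv_const,
    ContinuousAlternatingMap.sub_apply, bilinWedge_const_apply]
  simp [oneWedge_apply]

lemma wedge_apply_pair (a b : E [⋀^Fin 1]→L[ℝ] ℂ) (u v : E) :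
    wedge a b ![u, v] = a ![u] * b ![v] - a ![v] * b ![u] := by
  rw [wedge_one_one, oneWedge_oneWedge_const_apply]
  simp [oneForm_apply]

end Chart

/-! ### Diagonal metrics are astheno-Kähler -/

section Manifold

variable {E : Type*} [NormedAddCommGroup E] [NormedSpace ℝ E]
  {M : Type*} [TopologicalSpace M] [ChartedSpace E M] [IsManifold 𝓘(ℝ, E) 1 M]

/-- The one-forms `α i` are of type `(1, 0)`. -/
def IsTypeOneZero (J : AlmostComplexStructure E M) {n : ℕ} (α : Fin n → CForm E M 1) : Prop :=
  ∀ (i : Fin n) (x : M) (v : TangentSpace 𝓘(ℝ, E) x), α i x ![J.J x v] = Complex.I * α i x ![v]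

/-- Differentiable forms `α₀, …, α_m` subject to the structure equations with coefficients
`A`, `B`. -/
structure IsStructuredCoframe {m : ℕ} (A B : Fin m → Fin m → ℂ)
    (α : Fin (m + 1) → CForm E M 1) : Prop where
  differentiableAt (i : Fin (m + 1)) (x : M) :
    DifferentiableAt ℝ (chartForm (α i) x) (extChartAt 𝓘(ℝ, E) x x)
  closed (i : Fin m) : extD (α i.castSucc) = 0
  last (x : M) : toModel x (extD (α (Fin.last m)) x) =
    ∑ i, ∑ j ∈ Finset.Ioi i,
      A i j • wedge (toModel x (α i.castSucc x)) (toModel x (α j.castSucc x)) +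
    ∑ k, ∑ l,
      B k l • wedge (toModel x (α k.castSucc x)) (conjForm (toModel x (α l.castSucc x)))

lemma IsTypeOneZero.isTypedFrame {m : ℕ} {J : AlmostComplexStructure E M}
    {α : Fin (m + 1) → CForm E M 1} (h : IsTypeOneZero J α) (x : M) :
    IsTypedFrame (V := E) (J.J x) (frame α x) where
  type_one_zero i v := by
    rw [frame_inl, frame_inl]
    exact h i x v
  inr_apply i v := by rw [frame_inl, frame_inr]

lemma IsStructuredCoframe.structureEquationsAt {m : ℕ} {A B : Fin m → Fin m → ℂ}
    {α : Fin (m + 1) → CForm E M 1} (h : IsStructuredCoframe A B α) (x : M) :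
    StructureEquationsAt A B (chartFrame α x) (extChartAt 𝓘(ℝ, E) x x) where
  differentiableAt i := h.differentiableAt i x
  inr_apply i z v := rfl
  closed i u v := by
    have h1 := extD_one_apply (α i.castSucc) x (h.differentiableAt _ x) u v
    rw [h.closed] at h1
    exact h1.symm
  last u v := by
    refine (extD_one_apply (α (Fin.last m)) x (h.differentiableAt _ x) u v).symm.trans ?_
    rw [h.last]
    simp only [chartFrame_self, frame_inl, frame_inr]
    rw [ContinuousAlternatingMap.add_apply]
    simp only [ContinuousAlternatingMap.sum_apply, ContinuousAlternatingMap.smul_apply]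
    simp only [smul_eq_mul]
    have h2 : ∀ i j, wedge (toModel x (α i x)) (toModel x (α j x)) ![u, v] =
        toModel x (α i x) ![u] * toModel x (α j x) ![v] -
        toModel x (α i x) ![v] * toModel x (α j x) ![u] := fun i j => wedge_apply_pair _ _ u v
    have h3 : ∀ i j, wedge (toModel x (α i x)) (conjForm (toModel x (α j x))) ![u, v] =
        toModel x (α i x) ![u] * conj (toModel x (α j x) ![v]) -
        toModel x (α i x) ![v] * conj (toModel x (α j x) ![u]) :=
      fun i j => wedge_apply_pair _ _ u v
    simp only [h2, h3]

/-- The metric `g` is `½ ∑ (α_i ⊗ ᾱ_i + ᾱ_i ⊗ α_i)`. -/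
def HasDiagonalForm {J : AlmostComplexStructure E M} (g : HermitianMetric J) {n : ℕ}
    (α : Fin n → CForm E M 1) : Prop :=
  ∀ (x : M) (v w : TangentSpace 𝓘(ℝ, E) x),
    ((g.inner x v w : ℝ) : ℂ) =
      (1 / 2) * ∑ i, (α i x ![v] * conj (α i x ![w]) + conj (α i x ![v]) * α i x ![w])

variable {J : AlmostComplexStructure E M} {g : HermitianMetric J}

lemma toModel_fundamentalForm {n : ℕ} {α : Fin n → CForm E M 1} (hg : HasDiagonalForm g α)
    (hα : IsTypeOneZero J α) (x : M) :
    toModel x (g.fundamentalForm x) =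
      ∑ i, (Complex.I / 2) • oneWedge (frame α x (Sum.inl i)) (oneWedge (frame α x (Sum.inr i))
        (ContinuousAlternatingMap.constOfIsEmpty ℝ E (Fin 0) 1)) := by
  ext v
  have h1 : toModel x (g.fundamentalForm x) v = ((g.inner x (J.J x (v 0)) (v 1) : ℝ) : ℂ) := rfl
  rw [h1, ContinuousAlternatingMap.sum_apply]
  refine (hg x (J.J x (v 0)) (v 1)).trans ?_
  rw [Finset.mul_sum]
  refine Finset.sum_congr rfl fun i _ => ?_
  rw [ContinuousAlternatingMap.smul_apply, oneWedge_oneWedge_const_apply]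
  simp only [frame_inl, frame_inr, smul_eq_mul]
  have h2 : α i x ![J.J x (v 0)] = Complex.I * α i x ![v 0] := hα i x (v 0)
  have h3 : ∀ a b c : ℂ, c = Complex.I * a → (1 / 2 : ℂ) * (c * conj b + conj c * b) =
      Complex.I / 2 * (a * conj b - b * conj a) := by
    rintro a b c rfl
    simp only [map_mul, Complex.conj_I]
    ring
  exact h3 _ _ _ h2

lemma wedgePow_fundamentalForm {m : ℕ} {α : Fin (m + 1) → CForm E M 1} (hg : HasDiagonalForm g α)
    (hα : IsTypeOneZero J α) (k : ℕ) :
    (fun x => wedgePow (g.fundamentalForm x) k) = formOf α (kahlerElt ^ k) (2 * k) := by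
  funext x
  apply toModel_injective
  rw [formOf, toModel_ofModel]
  induction k with
  | zero =>
    rw [pow_zero, evalForm_one]
    rfl
  | succ k ih =>
    have h1 : toModel x (wedgePow (g.fundamentalForm x) (k + 1)) = wedgeRight 2
      (toModel x (wedgePow (g.fundamentalForm x) k)) (toModel x (g.fundamentalForm x)) := rfl
    rw [h1, ih, toModel_fundamentalForm hg hα, map_sum]
    have h3 : (kahlerElt : ModelAlgebra m) = ∑ i, (Complex.I / 2) •
        (gen (Sum.inl i) * gen (Sum.inr i)) := by
      rw [← Finset.smul_sum, Fin.sum_univ_castSucc, kahlerElt, add_comm (lastE * lastEbar)]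
      rfl
    have h4 : evalForm (frame α x) (kahlerElt ^ (k + 1)) (2 * (k + 1)) =
        ∑ i, (Complex.I / 2) • evalForm (frame α x)
          (gen (Sum.inl i) * (gen (Sum.inr i) * kahlerElt ^ k)) (2 * k + 2) := by
      rw [pow_succ', h3, Finset.sum_mul, _root_.map_sum, Finset.sum_apply, ← h3]
      refine Finset.sum_congr rfl fun i _ => ?_
      rw [smul_mul_assoc, LinearMap.map_smul, mul_assoc]
      rfl
    rw [h4]
    refine Finset.sum_congr rfl fun i _ => ?_
    rw [LinearMap.map_smul, evalForm_gen_mul_succ, evalForm_gen_mul_succ]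
    exact congrArg _ (wedge_oneWedge_oneWedge _ _ _)

lemma typeProj_formOf {m : ℕ} {α : Fin (m + 1) → CForm E M 1}
    {a : ModelAlgebra m} {k p q r s : ℕ} (hpq : p + q = k) (hrs : r + s = k)
    (ha : ∀ x, HasWeight (V := E) (J.J x) (frame α x) ((r : ℤ) - s) a) (x : M) :
    typeProj (J.J x) p q (formOf α a k x) = if p = r then formOf α a k x else 0 :=
  typeProj_of_isWeight (V := E) (J.J x) hpq hrs (ha x k)

/-- On a form of pure type `(r, s)` with exterior derivative the sum of a form of type `(r, s + 1)`
and of a form of type `(r + 1, s)`, the operator `∂̄` picks the first summand. -/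
lemma delBar_formOf {m : ℕ} {α : Fin (m + 1) → CForm E M 1} {a b c : ModelAlgebra m} {k r s : ℕ}
    (hrs : r + s = k)
    (ha : ∀ x, HasWeight (V := E) (J.J x) (frame α x) ((r : ℤ) - s) a)
    (hb : ∀ x, HasWeight (V := E) (J.J x) (frame α x) ((r : ℤ) - (s + 1 : ℕ)) b)
    (hc : ∀ x, HasWeight (V := E) (J.J x) (frame α x) (((r + 1 : ℕ) : ℤ) - s) c)
    (h : ∀ x, HasExtDeriv (chartFrame α x) (extChartAt 𝓘(ℝ, E) x x) a (b + c)) :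
    delBar J (formOf α a k) = formOf α b (k + 1) := by
  funext x
  have h1 : ∀ pq ∈ Finset.HasAntidiagonal.antidiagonal k,
      typeProj (J.J x) pq.1 (pq.2 + 1)
        (extD (fun y => typeProj (J.J y) pq.1 pq.2 (formOf α a k y)) x) =
      if pq = (r, s) then formOf α b (k + 1) x else 0 := by
    rintro ⟨p, q⟩ hpq
    have hpq' : p + q = k := by simpa using hpq
    have h2 : (fun y => typeProj (J.J y) p q (formOf α a k y)) =
        if p = r then formOf α a k else fun _ => 0 := by
      funext y
      rw [typeProj_formOf hpq' hrs ha]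
      split_ifs <;> rfl
    dsimp only
    rw [h2]
    by_cases hpr : p = r
    · obtain rfl := hpr
      obtain rfl : q = s := by omega
      rw [if_pos rfl, if_pos rfl, extD_formOf α x (h x)]
      let j : E →L[ℝ] E := J.J x
      have h3 : typeProj j p (q + 1) (toModel x (formOf α (b + c) (k + 1) x)) =
          toModel x (formOf α b (k + 1) x) := by
        have e1 := typeProj_formOf (p := p) (q := q + 1) (k := k + 1) (by omega) (by omega) hb x
        have e2 := typeProj_formOf (p := p) (q := q + 1) (k := k + 1) (by omega) (by omega) hc x
        rw [if_pos rfl] at e1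
        rw [if_neg (by omega)] at e2
        rw [formOf_add]
        exact typeProj_add_eq_left j e1 e2
      exact h3
    · rw [if_neg hpr, if_neg (fun h => hpr (congrArg Prod.fst h)), extD_zero]
      exact typeProj_zero (V := E) (J.J x)
  rw [delBar, Finset.sum_congr rfl h1, Finset.sum_ite_eq', if_pos (by simpa using hrs)]

/-- A form of pure type with vanishing exterior derivative is annihilated by `∂`. -/
lemma del_formOf_eq_zero {m : ℕ} {α : Fin (m + 1) → CForm E M 1} {a : ModelAlgebra m} {k r s : ℕ}
    (hrs : r + s = k)
    (ha : ∀ x, HasWeight (V := E) (J.J x) (frame α x) ((r : ℤ) - s) a)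
    (h : ∀ x, HasExtDeriv (chartFrame α x) (extChartAt 𝓘(ℝ, E) x x) a 0) :
    del J (formOf α a k) = 0 := by
  funext x
  refine Finset.sum_eq_zero ?_
  rintro ⟨p, q⟩ hpq
  have hpq' : p + q = k := by simpa using hpq
  have h2 : (fun y => typeProj (J.J y) p q (formOf α a k y)) =
      if p = r then formOf α a k else fun _ => 0 := by
    funext y
    rw [typeProj_formOf hpq' hrs ha]
    split_ifs <;> rfl
  have h3 : extD (fun y => typeProj (J.J y) p q (formOf α a k y)) x = 0 := by
    rw [h2]
    split_ifs
    · rw [extD_formOf α x (h x), formOf_zero]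
      rfl
    · exact extD_zero x
  dsimp only
  rw [h3]
  exact typeProj_zero (V := E) (J.J x)

/-- A Hermitian metric which is diagonal in a coframe satisfying the structure equations is
astheno-Kähler as soon as the coefficients satisfy the quadratic condition. In dimension `m + 1`
with `m = k + 2`, the relevant power of the fundamental form is `F ^ (k + 1)`; its exterior
derivative has the components `delBarElt` and `delElt`, and the one of `delBarElt` is a multiple of the form of
`baseForm_pow_mul_eq_zero`. -/
theorem isAsthenoKahler_of_hasDiagonalForm {m : ℕ} (hm : 1 ≤ m) {A B : Fin m → Fin m → ℂ}
    {α : Fin (m + 1) → CForm E M 1} (hα : IsTypeOneZero J α) (hs : IsStructuredCoframe A B α)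
    (hq : QuadraticCondition A B) (hg : HasDiagonalForm g α) : g.IsAsthenoKahler (m + 1) := by
  rw [HermitianMetric.IsAsthenoKahler, wedgePow_fundamentalForm hg hα]
  obtain rfl | ⟨k, rfl⟩ : m = 1 ∨ ∃ k, m = k + 2 := by
    rcases m with _ | _ | k
    · omega
    · exact Or.inl rfl
    · exact Or.inr ⟨k, rfl⟩
  · -- In complex dimension two the form in question is the constant function `1`.
    have h1 : delBar J (formOf α (1 : ModelAlgebra 1) 0) = formOf α 0 1 :=
      delBar_formOf (r := 0) (s := 0) (c := 0) rfl (fun _ => HasWeight.one)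
        (fun _ => HasWeight.zero) (fun _ => HasWeight.zero)
        (fun _ => by simpa using HasExtDeriv.one)
    change del J (delBar J (formOf α (kahlerElt ^ 0) 0)) = 0
    rw [pow_zero, h1]
    exact del_formOf_eq_zero (r := 0) (s := 1) rfl (fun _ => HasWeight.zero)
      (fun _ => HasExtDeriv.zero)
  · have h1 : delBar J (formOf α (kahlerElt ^ (k + 1)) (2 * (k + 1))) =
        formOf α (delBarElt A B k) (2 * (k + 1) + 1) :=
      delBar_formOf (r := k + 1) (s := k + 1) (by ring)
        (fun x => by simpa using (hα.isTypedFrame x).kahlerElt_pow (k + 1))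
        (fun x => by simpa using (hα.isTypedFrame x).delBarElt A B k)
        (fun x => by simpa using (hα.isTypedFrame x).delElt A B k)
        (fun x => (hs.structureEquationsAt x).kahlerElt_pow k)
    change del J (delBar J (formOf α (kahlerElt ^ (k + 1)) (2 * (k + 1)))) = 0
    rw [h1]
    refine del_formOf_eq_zero (r := k + 1) (s := k + 2) (by ring)
      (fun x => ?_) (fun x => ?_)
    · have h2 := (hα.isTypedFrame x).delBarElt A B k
      have h3 : (((k + 1 : ℕ) : ℤ) - (k + 2 : ℕ)) = -1 := by push_cast; ring
      rw [h3]
      exact h2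
    · have h2 := (hs.structureEquationsAt x).delBarElt k
      rw [baseForm_pow_mul_eq_zero hq, smul_zero] at h2
      exact h2

end Manifold

/-! ### The Hermitian metric of a coframe -/

section DiagBilin

variable {E : Type*} [NormedAddCommGroup E] [NormedSpace ℝ E] {n : ℕ}

/-- The real bilinear form `(v, w) ↦ Re ∑ conj (f_i(v)) f_i(w)` attached to functionals `f_i`. -/
def diagBilin (f : Fin n → E →L[ℝ] ℂ) : E →L[ℝ] E →L[ℝ] ℝ :=
  ∑ i, ((ContinuousLinearMap.compL ℝ E ℂ ℝ).flip (f i)) ∘L ((innerSL ℝ : ℂ →L[ℝ] ℂ →L[ℝ] ℝ) ∘L f i)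

lemma diagBilin_apply (f : Fin n → E →L[ℝ] ℂ) (v w : E) :
    diagBilin f v w = ∑ i, (inner ℝ (f i v) (f i w) : ℝ) := by
  simp only [diagBilin, _root_.sum_apply]
  rfl

lemma coe_diagBilin_apply (f : Fin n → E →L[ℝ] ℂ) (v w : E) :
    ((diagBilin f v w : ℝ) : ℂ) =
      (1 / 2) * ∑ i, (f i v * conj (f i w) + conj (f i v) * f i w) := by
  rw [diagBilin_apply, Finset.mul_sum, Complex.ofReal_sum]
  refine Finset.sum_congr rfl fun i _ => ?_
  rw [Complex.inner, Complex.re_eq_add_conj]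
  simp only [map_mul, Complex.conj_conj]
  ring

set_option synthInstance.maxHeartbeats 100000 in
lemma contDiff_diagBilin :
    ContDiff ℝ ∞ (diagBilin : (Fin n → E →L[ℝ] ℂ) → E →L[ℝ] E →L[ℝ] ℝ) := by
  unfold diagBilin
  refine ContDiff.sum fun i _ => ?_
  refine ContDiff.clm_comp ?_ ?_
  · have h : ContDiff ℝ ∞ fun f : E →L[ℝ] ℂ => (ContinuousLinearMap.compL ℝ E ℂ ℝ).flip f := by
      fun_prop
    exact h.comp (contDiff_apply ℝ _ i)
  · exact contDiff_const.clm_comp (contDiff_apply ℝ _ i)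

lemma diagBilin_self_pos {f : Fin n → E →L[ℝ] ℂ} {v : E}
    (h : (∀ i, f i v = 0) → v = 0) (hv : v ≠ 0) : 0 < diagBilin f v v := by
  rw [diagBilin_apply]
  obtain ⟨i, hi⟩ := not_forall.mp (fun h' => hv (h h'))
  refine Finset.sum_pos' (fun j _ => real_inner_self_nonneg) ⟨i, Finset.mem_univ _, ?_⟩
  exact real_inner_self_pos.mpr hi

/-- The joint evaluation at the `f i` is injective, hence bounded below in finite dimension. -/
lemma isVonNBounded_diagBilin [FiniteDimensional ℝ E] {f : Fin n → E →L[ℝ] ℂ}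
    (h : ∀ v, (∀ i, f i v = 0) → v = 0) :
    Bornology.IsVonNBounded ℝ {v : E | diagBilin f v v < 1} := by
  obtain ⟨K, -, hK⟩ := LinearMap.exists_antilipschitzWith
    (LinearMap.pi fun i => (f i : E →ₗ[ℝ] ℂ)) (LinearMap.ker_eq_bot'.mpr fun v hv =>
      h v fun i => congrFun hv i)
  rw [NormedSpace.isVonNBounded_iff' ℝ]
  refine ⟨K, fun v hv => ?_⟩
  have h1 := hK.le_mul_dist v 0
  rw [dist_zero_right, map_zero, dist_zero_right] at h1
  refine h1.trans (mul_le_of_le_one_right K.2 ?_)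
  refine (pi_norm_le_iff_of_nonneg zero_le_one).mpr fun i => ?_
  have h2 : ‖f i v‖ ^ 2 ≤ diagBilin f v v := by
    rw [diagBilin_apply]
    refine le_trans (le_of_eq ?_) (Finset.single_le_sum
      (f := fun i => (inner ℝ (f i v) (f i v) : ℝ)) (fun j _ => real_inner_self_nonneg)
      (Finset.mem_univ i))
    exact (real_inner_self_eq_norm_sq _).symm
  have h3 : ‖f i v‖ ^ 2 ≤ 1 := h2.trans (le_of_lt hv)
  exact (sq_le_one_iff₀ (norm_nonneg _)).mp h3

end DiagBilin

section Metric

variable {E : Type*} [NormedAddCommGroup E] [NormedSpace ℝ E]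
  {M : Type*} [TopologicalSpace M] [ChartedSpace E M] [IsManifold 𝓘(ℝ, E) 1 M] {n : ℕ}

/-- The coframe `α` is smooth in the preferred charts. -/
def IsSmoothCoframe (α : Fin n → CForm E M 1) : Prop :=
  ∀ (i : Fin n) (x : M), ContDiffAt ℝ ∞ (chartForm (α i) x) (extChartAt 𝓘(ℝ, E) x x)

/-- No nonzero tangent vector is annihilated by all the forms `α i`. -/
def IsSeparatingCoframe (α : Fin n → CForm E M 1) : Prop :=
  ∀ (x : M) (v : E), (∀ i, formAt (α i) x v = 0) → v = 0

/-- The derivative of the inverse chart is the inverse of the trivialization of the tangent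
bundle. -/
lemma symm_trivializationAt_tangent {x₀ x : M} (hx : x ∈ (chartAt E x₀).source) (v : E) :
    (trivializationAt E (TangentSpace 𝓘(ℝ, E)) x₀).symm x v =
      chartSymmDeriv x₀ (extChartAt 𝓘(ℝ, E) x₀ x) v := by
  have h := TangentBundle.symmL_trivializationAt (I := 𝓘(ℝ, E)) hx
  rw [ModelWithCorners.range_eq_univ, mfderivWithin_univ] at h
  rw [← Trivialization.symmL_apply (R := ℝ) _ (by simpa using hx)]
  exact congrArg (fun T : E →L[ℝ] E => T v) h

/-- The bilinear form `(v, w) ↦ Re ∑ conj (α_i(v)) α_i(w)` on the tangent space at `x`. -/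
def diagBilinAt (α : Fin n → CForm E M 1) (x : M) :
    TangentSpace 𝓘(ℝ, E) x →L[ℝ] TangentSpace 𝓘(ℝ, E) x →L[ℝ] ℝ :=
  diagBilin (E := E) fun i => formAt (α i) x

/-- The field of bilinear forms attached to a smooth coframe is smooth. -/
lemma contMDiff_diagBilin {α : Fin n → CForm E M 1} (hs : IsSmoothCoframe α) :
    ContMDiff 𝓘(ℝ, E) (𝓘(ℝ, E).prod 𝓘(ℝ, E →L[ℝ] E →L[ℝ] ℝ)) ∞
      (fun x : M => TotalSpace.mk' (E →L[ℝ] E →L[ℝ] ℝ)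
        (E := fun x : M => TangentSpace 𝓘(ℝ, E) x →L[ℝ] TangentSpace 𝓘(ℝ, E) x →L[ℝ] ℝ) x
        (diagBilinAt α x)) := by
  intro x₀
  rw [contMDiffAt_hom_bundle]
  refine ⟨contMDiffAt_id, ?_⟩
  have h1 : ContMDiffAt 𝓘(ℝ, E) 𝓘(ℝ, E →L[ℝ] E →L[ℝ] ℝ) ∞
      (fun x => diagBilin fun i => chartForm (α i) x₀ (extChartAt 𝓘(ℝ, E) x₀ x)) x₀ := by
    have h2 : ContDiffAt ℝ ∞ (fun y => diagBilin fun i => chartForm (α i) x₀ y)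
        (extChartAt 𝓘(ℝ, E) x₀ x₀) :=
      contDiff_diagBilin.contDiffAt.comp _ (contDiffAt_pi.mpr fun i => hs i x₀)
    exact h2.contMDiffAt.comp x₀ contMDiffAt_extChartAt
  refine h1.congr_of_eventuallyEq ?_
  filter_upwards [(chartAt E x₀).open_source.mem_nhds (mem_chart_source E x₀)] with x hx
  ext v w
  rw [inCoordinates_apply_eq₂ (by simpa using hx) (by simpa using hx) (by simp)]
  rw [symm_trivializationAt_tangent hx, symm_trivializationAt_tangent hx]
  have h3 : ∀ r : ℝ, (trivializationAt ℝ (fun _ : M => ℝ) x₀).linearMapAt ℝ x r = r := by simp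
  refine (h3 _).trans ((diagBilin_apply (E := E) _ _ _).trans ?_)
  rw [diagBilin_apply]
  simp only [chartForm, (extChartAt 𝓘(ℝ, E) x₀).left_inv (by simpa using hx)]
  rfl

/-- A smooth separating coframe of type `(1, 0)` is unitary for a Hermitian metric. -/
lemma exists_hermitianMetric_hasDiagonalForm [FiniteDimensional ℝ E]
    {J : AlmostComplexStructure E M} {α : Fin n → CForm E M 1} (hα : IsTypeOneZero J α)
    (hs : IsSmoothCoframe α) (hsep : IsSeparatingCoframe α) :
    ∃ g : HermitianMetric J, HasDiagonalForm g α := by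
  have hJ : ∀ (i : Fin n) (x : M) (v w : TangentSpace 𝓘(ℝ, E) x),
      (inner ℝ (α i x ![J.J x v]) (α i x ![J.J x w]) : ℝ) = inner ℝ (α i x ![v]) (α i x ![w]) := by
    intro i x v w
    rw [hα i x v, hα i x w]
    simp only [Complex.inner, map_mul, Complex.conj_I]
    congr 1
    linear_combination (-(conj (α i x ![v]) * α i x ![w])) * Complex.I_mul_I
  refine ⟨{
    inner := diagBilinAt α
    symm := fun x v w => ?_
    pos := fun x v hv => diagBilin_self_pos (E := E) (hsep x v) hv
    isVonNBounded := fun x => isVonNBounded_diagBilin (E := E) (hsep x)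
    contMDiff := contMDiff_diagBilin hs
    inner_J := fun x v w => ?_ }, fun x v w => ?_⟩
  · refine (diagBilin_apply (E := E) _ v w).trans ?_
    refine Eq.trans ?_ (diagBilin_apply (E := E) _ w v).symm
    exact Finset.sum_congr rfl fun i _ => real_inner_comm _ _
  · refine (diagBilin_apply (E := E) _ (J.J x v) (J.J x w)).trans ?_
    refine Eq.trans ?_ (diagBilin_apply (E := E) _ v w).symm
    refine Finset.sum_congr rfl fun i _ => ?_
    refine (congrArg₂ _ (formAt_apply _ _ _) (formAt_apply _ _ _)).trans ((hJ i x v w).trans ?_)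
    exact (congrArg₂ _ (formAt_apply _ _ _) (formAt_apply _ _ _)).symm
  · refine (coe_diagBilin_apply (E := E) _ v w).trans ?_
    have h : ∀ (i : Fin n) (v : TangentSpace 𝓘(ℝ, E) x), formAt (α i) x v = α i x ![v] :=
      fun i v => formAt_apply _ _ _
    exact congrArg _ (Finset.sum_congr rfl fun i _ => by rw [h, h])

end Metric

/-! ### Left-invariant coframes -/

section Invariant

variable {E : Type*} [NormedAddCommGroup E] [NormedSpace ℝ E]
  {G : Type*} [Group G] [TopologicalSpace G] [ChartedSpace E G]

/-- The derivative of the left translation by `a` at the point `x`. -/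
def translationDeriv (a x : G) : E →L[ℝ] E :=
  mfderiv 𝓘(ℝ, E) 𝓘(ℝ, E) (fun y : G => a * y) x

lemma IsLeftInvariantForm.formAt_comp {α : CForm E G 1} (h : IsLeftInvariantForm α) (a x : G) :
    formAt α (a * x) ∘L translationDeriv a x = formAt α x := by
  ext v
  have h1 := congrArg (fun η : E [⋀^Fin 1]→L[ℝ] ℂ => η ![v]) (h a x)
  rw [ContinuousLinearMap.comp_apply, formAt_apply, formAt_apply]
  refine Eq.trans ?_ h1
  change toModel (a * x) (α (a * x)) _ = toModel (a * x) (α (a * x)) (translationDeriv a x ∘ ![v])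
  congr 1
  ext i
  fin_cases i
  rfl

lemma translationDeriv_one (x : G) : translationDeriv (1 : G) x = ContinuousLinearMap.id ℝ E := by
  have h : (fun y : G => 1 * y) = id := by
    funext y
    simp
  rw [translationDeriv, h]
  exact mfderiv_id

variable [LieGroup 𝓘(ℝ, E) ∞ G]

lemma mdifferentiableAt_translation (a x : G) :
    MDifferentiableAt 𝓘(ℝ, E) 𝓘(ℝ, E) (fun y : G => a * y) x :=
  (contMDiff_mul_left (I := 𝓘(ℝ, E)) (n := ∞)).mdifferentiableAt (by simp)

lemma translationDeriv_comp (a b x : G) :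
    translationDeriv (E := E) a (b * x) ∘L translationDeriv b x = translationDeriv (a * b) x := by
  have h := mfderiv_comp x (mdifferentiableAt_translation (E := E) a (b * x))
    (mdifferentiableAt_translation (E := E) b x)
  have h2 : ((fun y : G => a * y) ∘ fun y : G => b * y) = fun y => a * b * y := by
    funext y
    simp [mul_assoc]
  rw [h2] at h
  exact h.symm

lemma translationDeriv_injective (a x : G) :
    Function.Injective (translationDeriv (E := E) a x) := by
  have h := translationDeriv_comp (E := E) a⁻¹ a x
  rw [inv_mul_cancel, translationDeriv_one] at h
  exact Function.LeftInverse.injective (g := translationDeriv (E := E) a⁻¹ (a * x))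
    fun v => congrArg (fun T : E →L[ℝ] E => T v) h

/-- In the chart at `x`, a left-invariant form is its value at `x` composed with the derivative in
the second variable, on the diagonal, of `(y, y') ↦ x y⁻¹ y'`. -/
lemma IsLeftInvariantForm.contDiffAt_chartForm {α : CForm E G 1} (h : IsLeftInvariantForm α)
    (x : G) : ContDiffAt ℝ ∞ (chartForm α x) (extChartAt 𝓘(ℝ, E) x x) := by
  set φ := extChartAt 𝓘(ℝ, E) x with hφ
  let F : E → E → E := fun y y' => φ (x * (φ.symm y)⁻¹ * φ.symm y')
  have hsymm : ∀ y ∈ φ.target, ContMDiffAt 𝓘(ℝ, E) 𝓘(ℝ, E) ∞ φ.symm y := fun y hy =>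
    (contMDiffOn_extChartAt_symm x).contMDiffAt ((isOpen_extChartAt_target x).mem_nhds hy)
  have hx : φ x ∈ φ.target := mem_extChartAt_target x
  have hxx : φ.symm (φ x) = x := extChartAt_to_inv x
  have hF : ContDiffAt ℝ ∞ (Function.uncurry F) (φ x, φ x) := by
    rw [← contMDiffAt_iff_contDiffAt]
    have h1 : ContMDiffAt 𝓘(ℝ, E × E) 𝓘(ℝ, E) ∞
        (fun p : E × E => x * (φ.symm p.1)⁻¹ * φ.symm p.2) (φ x, φ x) := by
      refine ContMDiffAt.mul (contMDiffAt_const.mul (ContMDiffAt.inv ?_)) ?_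
      · exact (hsymm _ hx).comp (φ x, φ x) contDiffAt_fst.contMDiffAt
      · exact (hsymm _ hx).comp (φ x, φ x) contDiffAt_snd.contMDiffAt
    refine ContMDiffAt.comp (φ x, φ x) ?_ h1
    dsimp only
    rw [hxx, inv_mul_cancel_right]
    exact contMDiffAt_extChartAt
  -- The derivative of a smooth family of maps at a smoothly varying point is smooth.
  have h2 : ContDiffAt ℝ ∞ (fun y => formAt α x ∘L fderiv ℝ (F y) y) (φ x) :=
    contDiffAt_const.clm_comp (hF.fderiv contDiffAt_id (by simp))
  refine h2.congr_of_eventuallyEq ?_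
  filter_upwards [(isOpen_extChartAt_target x).mem_nhds hx] with y hy
  have h3 : HasMFDerivAt 𝓘(ℝ, E) 𝓘(ℝ, E) φ.symm y
      (mfderiv 𝓘(ℝ, E) 𝓘(ℝ, E) φ.symm y) :=
    ((hsymm y hy).mdifferentiableAt (by simp)).hasMFDerivAt
  have h4 := (mdifferentiableAt_translation (E := E) (x * (φ.symm y)⁻¹) (φ.symm y)).hasMFDerivAt
  have hy1 : x * (φ.symm y)⁻¹ * φ.symm y = x := inv_mul_cancel_right _ _
  have h5 : HasMFDerivAt 𝓘(ℝ, E) 𝓘(ℝ, E) φ (x * (φ.symm y)⁻¹ * φ.symm y)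
      (ContinuousLinearMap.id ℝ E) := by
    rw [hy1]
    have := (mdifferentiableAt_extChartAt (I := 𝓘(ℝ, E)) (mem_chart_source E x)).hasMFDerivAt
    rw [mfderiv_extChartAt_self] at this
    exact this
  have h6 := (h5.comp _ h4).comp y h3
  have h7 : HasFDerivAt (F y) (translationDeriv (x * (φ.symm y)⁻¹) (φ.symm y) ∘L
      chartSymmDeriv x y) y := h6.hasFDerivAt
  rw [h7.fderiv, chartForm, ← h.formAt_comp (x * (φ.symm y)⁻¹) (φ.symm y), hy1]
  rfl

lemma IsInvariantCoframe.isTypeOneZero {J : AlmostComplexStructure E G} {n : ℕ}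
    {α : Fin n → CForm E G 1} (h : IsInvariantCoframe J α) : IsTypeOneZero J α :=
  h.type_one_zero

lemma IsInvariantCoframe.isSmoothCoframe {J : AlmostComplexStructure E G} {n : ℕ}
    {α : Fin n → CForm E G 1} (h : IsInvariantCoframe J α) : IsSmoothCoframe α :=
  fun i x => (h.leftInvariant i).contDiffAt_chartForm x

/-- At the identity, `n` linearly independent functionals of type `(1, 0)` on a space of real
dimension `2 n` separate the points: together they define a surjective, hence bijective, map onto
`ℂⁿ`. -/
lemma IsInvariantCoframe.isSeparatingCoframe [FiniteDimensional ℝ E]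
    {J : AlmostComplexStructure E G} {n : ℕ} (hE : finrank ℝ E = 2 * n)
    {α : Fin n → CForm E G 1} (h : IsInvariantCoframe J α) : IsSeparatingCoframe α := by
  let θ : E →ₗ[ℝ] (Fin n → ℂ) := LinearMap.pi fun i => (formAt (α i) 1 : E →ₗ[ℝ] ℂ)
  have hθ : ∀ v : E, θ (J.J 1 v) = Complex.I • θ v := by
    intro v
    funext i
    exact (formAt_apply (α i) (1 : G) (J.J 1 v)).trans ((h.type_one_zero i 1 v).trans
      (congrArg (Complex.I * ·) (formAt_apply (α i) (1 : G) v).symm))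
  have hsurj : Function.Surjective θ := by
    -- The range is stable under `i`; a functional vanishing on it is a relation of the forms.
    let S : Submodule ℂ (Fin n → ℂ) :=
      { carrier := Set.range θ
        add_mem' := by
          rintro _ _ ⟨v, rfl⟩ ⟨w, rfl⟩
          exact ⟨v + w, map_add _ _ _⟩
        zero_mem' := ⟨0, map_zero _⟩
        smul_mem' := by
          rintro c _ ⟨v, rfl⟩
          let w : E := J.J 1 v
          refine ⟨c.re • v + c.im • w, ?_⟩
          have hw : θ w = Complex.I • θ v := hθ v
          rw [map_add, map_smul, map_smul, hw]
          conv_rhs => rw [← Complex.re_add_im c]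
          funext i
          simp only [Pi.add_apply, Pi.smul_apply, smul_eq_mul, Complex.real_smul]
          ring }
    have hS : S = ⊤ := by
      by_contra hne
      obtain ⟨f, hf, hSf⟩ := S.exists_le_ker_of_lt_top (lt_top_iff_ne_top.mpr hne)
      have h1 : ∑ i, f (Pi.single i 1) • α i 1 = 0 := by
        have h2 : ∀ v : E, ∑ i, f (Pi.single i 1) * formAt (α i) 1 v = 0 := by
          intro v
          have h3 : f (θ v) = 0 := hSf ⟨v, rfl⟩
          rw [← h3, LinearMap.pi_apply_eq_sum_univ f (θ v)]
          refine Finset.sum_congr rfl fun i _ => ?_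
          have h4 : (Pi.single i 1 : Fin n → ℂ) = fun j => if i = j then 1 else 0 := by
            funext j
            simp [Pi.single_apply, eq_comm]
          rw [smul_eq_mul, mul_comm, h4]
          rfl
        have h4 : (∑ i, f (Pi.single i 1) • toModel 1 (α i 1)) = 0 := by
          ext v
          have h5 : v = ![v 0] := by
            funext i
            fin_cases i
            rfl
          rw [h5, ContinuousAlternatingMap.sum_apply]
          refine Eq.trans ?_ (h2 (v 0))
          refine Finset.sum_congr rfl fun i _ => ?_
          rw [ContinuousAlternatingMap.smul_apply, formAt_apply, smul_eq_mul]
        exact h4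
      have h5 := Fintype.linearIndependent_iff.mp h.linearIndependent _ h1
      refine hf (LinearMap.pi_ext' fun i => LinearMap.ext_ring ?_)
      exact h5 i
    intro z
    have hz : z ∈ S := hS ▸ Submodule.mem_top
    exact hz
  -- Injectivity at the identity is carried to `x` by the left translation by `x⁻¹`.
  have hfin : finrank ℝ E = finrank ℝ (Fin n → ℂ) := by
    rw [hE, Module.finrank_pi_fintype]
    simp [mul_comm]
  have hinj := (LinearMap.injective_iff_surjective_of_finrank_eq_finrank hfin).mpr hsurj
  intro x v hv
  have h0 : translationDeriv (E := E) x⁻¹ x v = 0 := by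
    refine hinj ?_
    rw [map_zero]
    funext i
    have h6 := (h.leftInvariant i).formAt_comp x⁻¹ x
    rw [inv_mul_cancel] at h6
    exact (congrArg (fun T : E →L[ℝ] ℂ => T v) h6).trans (hv i)
  exact translationDeriv_injective x⁻¹ x (h0.trans (map_zero _).symm)

lemma IsInvariantCoframe.isStructuredCoframe {J : AlmostComplexStructure E G} {m : ℕ}
    {α : Fin (m + 1) → CForm E G 1} {A B : Fin m → Fin m → ℂ} (h : IsInvariantCoframe J α)
    (hs : SatisfiesStructureEquations A B α) : IsStructuredCoframe A B α where
  differentiableAt i x := (h.isSmoothCoframe i x).differentiableAt (by simp)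
  closed := hs.closed
  last := hs.last

/-- A metric which is diagonal in a left-invariant coframe is left-invariant. -/
lemma HasDiagonalForm.isLeftInvariant {J : AlmostComplexStructure E G} {n : ℕ}
    {α : Fin n → CForm E G 1} (hα : ∀ i, IsLeftInvariantForm (α i)) {g : HermitianMetric J}
    (hg : HasDiagonalForm g α) : g.IsLeftInvariant := by
  intro a x v w
  have h1 : ∀ (i : Fin n) (u : TangentSpace 𝓘(ℝ, E) x),
      α i (a * x) ![mfderiv 𝓘(ℝ, E) 𝓘(ℝ, E) (fun y : G => a * y) x u] = α i x ![u] := by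
    intro i u
    have h2 := congrArg (fun T : E →L[ℝ] ℂ => T u) ((hα i).formAt_comp a x)
    exact (formAt_apply (α i) (a * x) (translationDeriv a x u)).symm.trans
      (h2.trans (formAt_apply (α i) x u))
  have h3 := (hg (a * x) (mfderiv 𝓘(ℝ, E) 𝓘(ℝ, E) (fun y : G => a * y) x v)
    (mfderiv 𝓘(ℝ, E) 𝓘(ℝ, E) (fun y : G => a * y) x w))
  simp only [h1] at h3
  exact_mod_cast h3.trans (hg x v w).symm

/-- A left-invariant coframe is smooth and separates tangent vectors, so that it is unitary for a
Hermitian metric, to which `isAsthenoKahler_of_hasDiagonalForm` applies. -/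
theorem exists_isAsthenoKahler_of_isInvariantCoframe [FiniteDimensional ℝ E]
    {J : AlmostComplexStructure E G} {m : ℕ} (hm : 1 ≤ m) (hE : finrank ℝ E = 2 * (m + 1))
    {α : Fin (m + 1) → CForm E G 1} {A B : Fin m → Fin m → ℂ} (h : IsInvariantCoframe J α)
    (hs : SatisfiesStructureEquations A B α) (hq : QuadraticCondition A B) :
    ∃ g : HermitianMetric J, g.IsLeftInvariant ∧ g.IsDiagonal α ∧ g.IsAsthenoKahler (m + 1) := by
  obtain ⟨g, hg⟩ := exists_hermitianMetric_hasDiagonalForm h.isTypeOneZero h.isSmoothCoframe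
    (h.isSeparatingCoframe hE)
  exact ⟨g, hg.isLeftInvariant h.leftInvariant, hg,
    isAsthenoKahler_of_hasDiagonalForm hm h.isTypeOneZero (h.isStructuredCoframe hs) hq hg⟩

end Invariant

/-! ### Two-step nilpotent groups on a vector space -/

/-- A complex structure `j` on a real normed space `E`, together with a bilinear map `b`, complex
linear in the second variable, with `b (b x y) z = 0` and `b x (b y z) = 0`. Then
`x * y = x + y + b(x, y)` is a two-step nilpotent group law on `E`, with holomorphic left
translations. -/
structure TwoStepData (E : Type*) [NormedAddCommGroup E] [NormedSpace ℝ E] where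
  j : E →L[ℝ] E
  j_sq (x : E) : j (j x) = -x
  b : E →L[ℝ] E →L[ℝ] E
  b_left (x y z : E) : b (b x y) z = 0
  b_right (x y z : E) : b x (b y z) = 0
  b_j (x y : E) : b x (j y) = j (b x y)

section Group

variable {E : Type*} [NormedAddCommGroup E] [NormedSpace ℝ E]

/-- The group `E` with the law `x * y = x + y + b(x, y)`. -/
def TwoStepGroup (_ : TwoStepData E) : Type _ := E

namespace TwoStepGroup

variable {D : TwoStepData E}

/-- A vector as an element of the group: the type is a copy of `E`, with the charts of `E`. -/
def mk (D : TwoStepData E) (x : E) : TwoStepGroup D := x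

/-- The vector underlying an element of the group. -/
def val (x : TwoStepGroup D) : E := x

instance : TopologicalSpace (TwoStepGroup D) := inferInstanceAs (TopologicalSpace E)

instance : T2Space (TwoStepGroup D) := inferInstanceAs (T2Space E)

instance [SecondCountableTopology E] : SecondCountableTopology (TwoStepGroup D) :=
  inferInstanceAs (SecondCountableTopology E)

instance : ContractibleSpace (TwoStepGroup D) := inferInstanceAs (ContractibleSpace E)

instance : ChartedSpace E (TwoStepGroup D) := chartedSpaceSelf E

instance : IsManifold 𝓘(ℝ, E) ∞ (TwoStepGroup D) := inferInstanceAs (IsManifold 𝓘(ℝ, E) ∞ E)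

instance : Mul (TwoStepGroup D) := ⟨fun x y => mk D (x.val + y.val + D.b x.val y.val)⟩

instance : One (TwoStepGroup D) := ⟨mk D 0⟩

instance : Inv (TwoStepGroup D) := ⟨fun x => mk D (-x.val + D.b x.val x.val)⟩

@[simp] lemma val_mk (x : E) : (mk D x).val = x := rfl

@[simp] lemma val_mul (x y : TwoStepGroup D) : (x * y).val = x.val + y.val + D.b x.val y.val := rfl

@[simp] lemma val_one : (1 : TwoStepGroup D).val = 0 := rfl

@[simp] lemma val_inv (x : TwoStepGroup D) : x⁻¹.val = -x.val + D.b x.val x.val := rfl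

lemma val_injective : Function.Injective (val : TwoStepGroup D → E) := fun _ _ h => h

instance : Group (TwoStepGroup D) :=
  Group.ofLeftAxioms
    (fun x y z => val_injective <| by
      simp only [val_mul, map_add, _root_.add_apply, D.b_left, D.b_right]
      abel)
    (fun x => val_injective <| by simp)
    (fun x => val_injective <| by
      simp only [val_mul, val_inv, val_one, map_add, map_neg, _root_.add_apply, _root_.neg_apply,
        D.b_left]
      abel)

lemma contMDiff_val : ContMDiff 𝓘(ℝ, E) 𝓘(ℝ, E) ∞ (val : TwoStepGroup D → E) :=
  contMDiff_id (M := E)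

lemma contMDiff_mk : ContMDiff 𝓘(ℝ, E) 𝓘(ℝ, E) ∞ (mk D) :=
  contMDiff_id (M := E)

instance : LieGroup 𝓘(ℝ, E) ∞ (TwoStepGroup D) where
  contMDiff_mul := by
    have h1 : ContMDiff (𝓘(ℝ, E).prod 𝓘(ℝ, E)) 𝓘(ℝ, E) ∞
        (fun p : TwoStepGroup D × TwoStepGroup D => p.1.val) := contMDiff_val.comp contMDiff_fst
    have h2 : ContMDiff (𝓘(ℝ, E).prod 𝓘(ℝ, E)) 𝓘(ℝ, E) ∞
        (fun p : TwoStepGroup D × TwoStepGroup D => p.2.val) := contMDiff_val.comp contMDiff_snd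
    exact contMDiff_mk.comp ((h1.add h2).add ((D.b.contMDiff.comp h1).clm_apply h2))
  contMDiff_inv :=
    contMDiff_mk.comp (contMDiff_val.neg.add ((D.b.contMDiff.comp contMDiff_val).clm_apply
      contMDiff_val))

/-- The commutator of `x` and `y` is the central element `b(x, y) - b(y, x)`. -/
instance : Group.IsNilpotent (TwoStepGroup D) := by
  refine ⟨2, ?_⟩
  rw [Subgroup.eq_top_iff']
  intro x
  rw [Subgroup.mem_upperCentralSeries_succ_iff]
  intro y
  rw [Subgroup.upperCentralSeries_one, Subgroup.mem_center_iff]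
  intro z
  change z * (x * y * x⁻¹ * y⁻¹) = x * y * x⁻¹ * y⁻¹ * z
  have h : (x * y * x⁻¹ * y⁻¹).val = D.b x.val y.val - D.b y.val x.val := by
    simp only [val_mul, val_inv, map_add, map_neg, _root_.add_apply,
      _root_.neg_apply, D.b_left, D.b_right, map_zero, _root_.zero_apply]
    abel
  refine val_injective ?_
  rw [val_mul z, val_mul _ z, h]
  simp only [map_sub, _root_.sub_apply, D.b_left, D.b_right]
  abel

lemma hasMFDerivAt_translation (a x : TwoStepGroup D) :
    HasMFDerivAt 𝓘(ℝ, E) 𝓘(ℝ, E) (fun y : TwoStepGroup D => a * y) x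
      (ContinuousLinearMap.id ℝ E + D.b a.val) := by
  have h : HasFDerivAt (fun y : E => a.val + y + D.b a.val y)
      (ContinuousLinearMap.id ℝ E + D.b a.val) x.val :=
    ((hasFDerivAt_id x.val).const_add a.val).add (D.b a.val).hasFDerivAt
  exact h.hasMFDerivAt

lemma mfderiv_translation (a x : TwoStepGroup D) :
    mfderiv 𝓘(ℝ, E) 𝓘(ℝ, E) (fun y : TwoStepGroup D => a * y) x =
      (ContinuousLinearMap.id ℝ E + D.b a.val) :=
  (hasMFDerivAt_translation a x).mfderiv

/-- The vector underlying an element of the Lie algebra. -/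
def lieVal (X : GroupLieAlgebra 𝓘(ℝ, E) (TwoStepGroup D)) : E := X

/-- The left-invariant vector field with the value `Z` at the identity is `x ↦ Z + b(x, Z)`, so that
the bracket is the antisymmetrization of `b`. -/
lemma lieVal_bracket (X Y : GroupLieAlgebra 𝓘(ℝ, E) (TwoStepGroup D)) :
    lieVal ⁅X, Y⁆ = D.b (lieVal X) (lieVal Y) - D.b (lieVal Y) (lieVal X) := by
  let V : E → E → E := fun Z x => Z + D.b x Z
  have h1 : ∀ Z : GroupLieAlgebra 𝓘(ℝ, E) (TwoStepGroup D), mulInvariantVectorField Z =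
      (fun x => V (lieVal Z) x.val : ∀ x : TwoStepGroup D, TangentSpace 𝓘(ℝ, E) x) := fun Z =>
    funext fun x => congrArg (fun T : E →L[ℝ] E => T Z) (mfderiv_translation x 1)
  have h2 : ∀ Z x : E, fderiv ℝ (V Z) x = D.b.flip Z := fun Z x =>
    ((D.b.flip Z).hasFDerivAt.const_add Z).fderiv
  have h3 : VectorField.mlieBracket 𝓘(ℝ, E) (V (lieVal X)) (V (lieVal Y)) =
      VectorField.lieBracket ℝ (V (lieVal X)) (V (lieVal Y)) :=
    VectorField.mlieBracketWithin_univ.symm.trans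
      (VectorField.mlieBracketWithin_eq_lieBracketWithin.trans VectorField.lieBracketWithin_univ)
  have h4 : lieVal ⁅X, Y⁆ = VectorField.lieBracket ℝ (V (lieVal X)) (V (lieVal Y)) 0 := by
    rw [GroupLieAlgebra.bracket_def, h1, h1]
    exact congrFun h3 0
  rw [h4, VectorField.lieBracket_eq]
  dsimp only
  rw [h2, h2]
  simp [V]

end TwoStepGroup

end Group

/-! ### Complex structures and forms on two-step nilpotent groups -/

section ConstantStructure

variable {E : Type*} [NormedAddCommGroup E] [NormedSpace ℝ E]
  {M : Type*} [TopologicalSpace M] [ChartedSpace E M]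

/-- The one-form with values `f x` at `x`. -/
def oneFormOf (f : M → E →L[ℝ] ℂ) : CForm E M 1 := fun x =>
  ofModel x (oneWedge (f x) (ContinuousAlternatingMap.constOfIsEmpty ℝ E (Fin 0) 1))

lemma formAt_oneFormOf (f : M → E →L[ℝ] ℂ) (x : M) : formAt (oneFormOf f) x = f x := by
  ext v
  rw [formAt_apply, oneFormOf, toModel_ofModel]
  simp [oneWedge_apply]

variable [IsManifold 𝓘(ℝ, E) 1 M]

/-- The almost complex structure given in the preferred charts by a constant endomorphism `j` which
commutes with the derivatives of the changes of charts. -/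
def constAlmostComplexStructure (j : E →L[ℝ] E) (hj : ∀ v, j (j v) = -v)
    (h : ∀ x₀ x : M, x ∈ (chartAt E x₀).source → ∀ v : E,
      tangentCoordChange 𝓘(ℝ, E) x x₀ x (j v) = j (tangentCoordChange 𝓘(ℝ, E) x x₀ x v)) :
    AlmostComplexStructure E M where
  J _ := j
  sq _ v := hj v
  contMDiff := by
    intro x₀
    rw [contMDiffAt_hom_bundle]
    refine ⟨contMDiffAt_id, ?_⟩
    refine (contMDiffAt_const (c := j)).congr_of_eventuallyEq ?_
    filter_upwards [(chartAt E x₀).open_source.mem_nhds (mem_chart_source E x₀)] with x hx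
    refine ((tangentBundleCore 𝓘(ℝ, E) M).inCoordinates_eq (tangentBundleCore 𝓘(ℝ, E) M)
      j hx hx).trans ?_
    ext v
    refine (h x₀ x hx _).trans (congrArg j ?_)
    refine (tangentCoordChange_comp (I := 𝓘(ℝ, E)) ⟨⟨?_, ?_⟩, ?_⟩).trans
      (tangentCoordChange_self (I := 𝓘(ℝ, E)) ?_)
    all_goals simp [hx]

lemma chartForm_self (α : CForm E M 1) (x : M) :
    chartForm α x (extChartAt 𝓘(ℝ, E) x x) = formAt α x := by
  rw [chartForm, chartSymmDeriv_self, extChartAt_to_inv]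
  rfl

end ConstantStructure

section TwoStep

variable {E : Type*} [NormedAddCommGroup E] [NormedSpace ℝ E] {D : TwoStepData E}

/-- The functional `θ`, moved from the identity to `x` by left translation: the inverse of
`1 + b(x, ·)` is `1 - b(x, ·)`. -/
def movedForm (D : TwoStepData E) (θ : E →L[ℝ] ℂ) (x : E) : E →L[ℝ] ℂ :=
  θ ∘L (ContinuousLinearMap.id ℝ E - D.b x)

lemma movedForm_apply (θ : E →L[ℝ] ℂ) (x v : E) : movedForm D θ x v = θ v - θ (D.b x v) := by
  simp [movedForm]

lemma contDiff_movedForm (θ : E →L[ℝ] ℂ) : ContDiff ℝ ∞ (movedForm D θ) :=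
  contDiff_const.clm_comp (contDiff_const.sub D.b.contDiff)

lemma fderiv_movedForm (θ : E →L[ℝ] ℂ) (x u v : E) :
    fderiv ℝ (movedForm D θ) x u v = -θ (D.b u v) := by
  have h : movedForm D θ = fun x => θ - ContinuousLinearMap.compL ℝ E E ℂ θ (D.b x) := by
    funext x
    ext v
    simp [movedForm_apply]
  have h2 : HasFDerivAt (movedForm D θ) (-(ContinuousLinearMap.compL ℝ E E ℂ θ ∘L D.b)) x := by
    rw [h]
    exact ((ContinuousLinearMap.compL ℝ E E ℂ θ ∘L D.b).hasFDerivAt).const_sub θ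
  rw [h2.fderiv]
  simp

variable {n : ℕ} {θ : Fin n → E →L[ℝ] ℂ}
  {M : Type*} [TopologicalSpace M] [ChartedSpace E M]

/-- In every preferred chart of `M`, the forms `α i` are the left-invariant forms of the two-step
group with the values `θ i` at the identity. -/
def IsModelledOn (D : TwoStepData E) (θ : Fin n → E →L[ℝ] ℂ) (α : Fin n → CForm E M 1) : Prop :=
  ∀ (i : Fin n) (x : M), chartForm (α i) x = movedForm D (θ i)

variable {α : Fin n → CForm E M 1}

lemma IsModelledOn.isSmoothCoframe (h : IsModelledOn D θ α) : IsSmoothCoframe α := by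
  intro i x
  rw [h]
  exact (contDiff_movedForm (θ i)).contDiffAt

variable [IsManifold 𝓘(ℝ, E) 1 M]

lemma IsModelledOn.formAt_eq (h : IsModelledOn D θ α) (i : Fin n) (x : M) :
    formAt (α i) x = movedForm D (θ i) (extChartAt 𝓘(ℝ, E) x x) := by
  rw [← h, chartForm_self]

lemma IsModelledOn.isSeparatingCoframe (h : IsModelledOn D θ α)
    (hθ : ∀ v, (∀ i, θ i v = 0) → v = 0) : IsSeparatingCoframe α := by
  intro x v hv
  have h1 : v - D.b (extChartAt 𝓘(ℝ, E) x x) v = 0 := by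
    refine hθ _ fun i => ?_
    rw [map_sub, ← movedForm_apply, ← h.formAt_eq, hv]
  have h2 := congrArg (D.b (extChartAt 𝓘(ℝ, E) x x)) (sub_eq_zero.mp h1)
  rw [D.b_right] at h2
  rwa [h2, sub_zero] at h1

lemma IsModelledOn.isTypeOneZero (h : IsModelledOn D θ α)
    (hθ : ∀ i v, θ i (D.j v) = Complex.I * θ i v) {J : AlmostComplexStructure E M}
    (hJ : ∀ (x : M) (v : E), (J.J x v : E) = D.j v) : IsTypeOneZero J α := by
  intro i x v
  have h1 : ∀ w : E, toModel x (α i x) ![D.j w] = Complex.I * toModel x (α i x) ![w] := by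
    intro w
    rw [← formAt_apply, ← formAt_apply, h.formAt_eq, movedForm_apply, movedForm_apply, D.b_j, hθ,
      hθ, mul_sub]
  exact (congrArg (fun w : E => toModel x (α i x) ![w]) (hJ x v)).trans (h1 v)

lemma IsModelledOn.extD_apply (h : IsModelledOn D θ α) (i : Fin n) (x : M) (u v : E) :
    toModel x (extD (α i) x) ![u, v] = θ i (D.b v u) - θ i (D.b u v) := by
  rw [extD_one_apply _ _ ((h.isSmoothCoframe i x).differentiableAt (by simp)), h,
    fderiv_movedForm, fderiv_movedForm]
  ring

end TwoStep

namespace TwoStepGroup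

variable {E : Type*} [NormedAddCommGroup E] [NormedSpace ℝ E] {D : TwoStepData E}

/-- The left-invariant complex structure of the two-step group, constant on the vector space. -/
def complexStructure (D : TwoStepData E) : AlmostComplexStructure E (TwoStepGroup D) :=
  constAlmostComplexStructure D.j D.j_sq fun x₀ x _ v => by
    have h : tangentCoordChange (M := E) 𝓘(ℝ, E) x x₀ x = ContinuousLinearMap.id ℝ E :=
      tangentBundleCore_coordChange_model_space x x₀ x
    have h2 : ∀ v : E, tangentCoordChange 𝓘(ℝ, E) x x₀ x v = v :=
      fun v => congrArg (fun T : E →L[ℝ] E => T v) h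
    rw [h2, h2]

lemma translationDeriv_eq (a x : TwoStepGroup D) :
    translationDeriv a x = ContinuousLinearMap.id ℝ E + D.b a.val := mfderiv_translation a x

lemma complexStructure_isLeftInvariant : (complexStructure D).IsLeftInvariant := by
  intro a x v
  have h : ∀ v : E, translationDeriv a x (D.j v) = D.j (translationDeriv a x v) := by
    intro v
    rw [translationDeriv_eq]
    simp [D.b_j]
  exact h v

/-- Complex linearity of `b` in the second variable makes the Nijenhuis tensor vanish. -/
lemma complexStructure_isIntegrable : (complexStructure D).IsIntegrable := by
  intro X Y
  have hJ : ∀ Z, lieVal ((complexStructure D).J 1 Z) = D.j (lieVal Z) := fun _ => rfl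
  have hadd : ∀ Z W : GroupLieAlgebra 𝓘(ℝ, E) (TwoStepGroup D),
    lieVal (Z + W) = lieVal Z + lieVal W := fun _ _ => rfl
  have h : lieVal ⁅(complexStructure D).J 1 X, (complexStructure D).J 1 Y⁆ =
      lieVal (⁅X, Y⁆ + (complexStructure D).J 1 ⁅(complexStructure D).J 1 X, Y⁆ +
        (complexStructure D).J 1 ⁅X, (complexStructure D).J 1 Y⁆) := by
    simp only [hadd, hJ, lieVal_bracket, D.b_j, map_sub, D.j_sq]
    abel
  exact h

/-- The brackets and their images under `j` are central: the series reaches the whole algebra in two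
steps. -/
lemma complexStructure_isNilpotentComplexStructure :
    (complexStructure D).IsNilpotentComplexStructure where
  leftInvariant := complexStructure_isLeftInvariant
  integrable := complexStructure_isIntegrable
  nilpotent := by
    refine ⟨2, two_pos, Set.eq_univ_of_forall fun X Y => ?_⟩
    have h : ∀ X Y Z : GroupLieAlgebra 𝓘(ℝ, E) (TwoStepGroup D), lieVal ⁅⁅X, Y⁆, Z⁆ = 0 ∧
        lieVal ⁅(complexStructure D).J 1 ⁅X, Y⁆, Z⁆ = 0 := by
      intro X Y Z
      have hJ : ∀ Z, lieVal ((complexStructure D).J 1 Z) = D.j (lieVal Z) := fun _ => rfl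
      refine ⟨?_, ?_⟩
      · simp [lieVal_bracket, D.b_left, D.b_right]
      · rw [lieVal_bracket, hJ, lieVal_bracket, map_sub, ← D.b_j, ← D.b_j]
        simp [D.b_left, D.b_right]
    exact ⟨fun Z => h _ _ _, fun Z => h _ _ _⟩

/-- The left-invariant forms with prescribed values at the identity. -/
def coframe {n : ℕ} (D : TwoStepData E) (θ : Fin n → E →L[ℝ] ℂ) (i : Fin n) :
    CForm E (TwoStepGroup D) 1 :=
  oneFormOf fun x => movedForm D (θ i) x.val

lemma formAt_coframe {n : ℕ} (θ : Fin n → E →L[ℝ] ℂ) (i : Fin n) (x : TwoStepGroup D) :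
    formAt (coframe D θ i) x = movedForm D (θ i) x.val := formAt_oneFormOf _ x

lemma coframe_isModelledOn {n : ℕ} (θ : Fin n → E →L[ℝ] ℂ) :
    IsModelledOn D θ (coframe D θ) := by
  intro i x
  funext y
  have h : chartSymmDeriv (M := E) x.val y = ContinuousLinearMap.id ℝ E := by
    rw [chartSymmDeriv, extChartAt_model_space_eq_id]
    exact mfderiv_id
  have h2 : chartForm (coframe D θ i) x y =
    formAt (coframe D θ i) (mk D y) ∘L chartSymmDeriv (M := E) x.val y := rfl
  rw [h2, h, formAt_coframe]
  rfl

/-- The converse of `IsLeftInvariantForm.formAt_comp`. -/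
lemma isLeftInvariantForm_of_formAt_comp {α : CForm E (TwoStepGroup D) 1}
    (h : ∀ a x, formAt α (a * x) ∘L translationDeriv a x = formAt α x) :
    IsLeftInvariantForm α := by
  intro a x
  have h1 : ∀ v : Fin 1 → E, toModel (a * x) (α (a * x)) (translationDeriv a x ∘ v) =
      toModel x (α x) v := by
    intro v
    have h2 := congrArg (fun T : E →L[ℝ] ℂ => T (v 0)) (h a x)
    rw [ContinuousLinearMap.comp_apply, formAt_apply, formAt_apply] at h2
    convert h2 using 2
    · funext i
      fin_cases i
      rfl
    · funext i
      fin_cases i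
      rfl
  exact ContinuousAlternatingMap.ext h1

lemma coframe_isInvariantCoframe {n : ℕ} {θ : Fin n → E →L[ℝ] ℂ}
    (hθ : ∀ i v, θ i (D.j v) = Complex.I * θ i v) (hli : LinearIndependent ℂ θ) :
    IsInvariantCoframe (complexStructure D) (coframe D θ) where
  leftInvariant i := isLeftInvariantForm_of_formAt_comp fun a x => by
    ext v
    rw [ContinuousLinearMap.comp_apply, formAt_coframe, formAt_coframe, translationDeriv_eq]
    simp only [movedForm_apply, val_mul, map_add, _root_.add_apply, ContinuousLinearMap.id_apply,
      D.b_left, D.b_right, map_zero]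
    ring
  type_one_zero := (coframe_isModelledOn θ).isTypeOneZero hθ fun _ _ => rfl
  linearIndependent := by
    rw [Fintype.linearIndependent_iff] at hli ⊢
    intro c hc
    refine hli c ?_
    ext v
    have h1 : (∑ i, c i • toModel (1 : TwoStepGroup D) (coframe D θ i 1)) ![v] = 0 :=
      congrArg (fun η : E [⋀^Fin 1]→L[ℝ] ℂ => η ![v]) hc
    rw [ContinuousAlternatingMap.sum_apply] at h1
    rw [_root_.sum_apply]
    refine Eq.trans (Finset.sum_congr rfl fun i _ => ?_) h1
    rw [ContinuousAlternatingMap.smul_apply, ← formAt_apply, formAt_coframe, val_one,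
      _root_.smul_apply, movedForm_apply]
    simp

end TwoStepGroup

/-! ### Quotients by discrete subgroups -/

namespace TwoStepGroup

variable {E : Type*} [NormedAddCommGroup E] [NormedSpace ℝ E] {D : TwoStepData E}

/-- The subgroup `Γ` acts by left translations with displacement at least `1`, apart from the
identity. -/
class IsSeparated (Γ : Subgroup (TwoStepGroup D)) : Prop where
  eq_one : ∀ γ ∈ Γ, ∀ x : TwoStepGroup D, ‖(γ * x).val - x.val‖ < 1 → γ = 1

lemma continuous_val : Continuous (val : TwoStepGroup D → E) := continuous_id

instance : IsTopologicalGroup (TwoStepGroup D) := topologicalGroup_of_lieGroup 𝓘(ℝ, E) ∞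

variable (Γ : Subgroup (TwoStepGroup D))

lemma leftQuotientMk_eq_iff {x y : TwoStepGroup D} :
    leftQuotientMk Γ x = leftQuotientMk Γ y ↔ ∃ γ ∈ Γ, γ * y = x := by
  rw [leftQuotientMk, leftQuotientMk, Quotient.eq, MulAction.orbitRel_apply,
    MulAction.mem_orbit_iff]
  simp [Subgroup.smul_def]

lemma leftQuotientMk_mul {γ : TwoStepGroup D} (hγ : γ ∈ Γ) (x : TwoStepGroup D) :
    leftQuotientMk Γ (γ * x) = leftQuotientMk Γ x :=
  (leftQuotientMk_eq_iff Γ).mpr ⟨γ, hγ, rfl⟩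

lemma isOpenQuotientMap_leftQuotientMk : IsOpenQuotientMap (leftQuotientMk Γ) :=
  MulAction.isOpenQuotientMap_quotientMk

/-- The projection to `Γ \ G`, as a map defined on the vector space underlying `G`. -/
def proj (y : E) : LeftQuotient Γ := leftQuotientMk Γ (mk D y)

lemma isOpenMap_proj : IsOpenMap (proj Γ) := (isOpenQuotientMap_leftQuotientMk Γ).isOpenMap

lemma continuous_proj : Continuous (proj Γ) := (isOpenQuotientMap_leftQuotientMk Γ).continuous

/-- A chosen point of `G` above a given point of `Γ \ G`, the centre of its preferred chart. -/
def lift (q : LeftQuotient Γ) : E := (Quotient.out q : TwoStepGroup D).val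

lemma proj_lift (q : LeftQuotient Γ) : proj Γ (lift Γ q) = q := Quotient.out_eq q

/-- A closed ball meeting every orbit is compact and maps onto the quotient. -/
lemma compactSpace_leftQuotient [FiniteDimensional ℝ E] {R : ℝ}
    (h : ∀ x : TwoStepGroup D, ∃ γ ∈ Γ, ‖(γ * x).val‖ ≤ R) : CompactSpace (LeftQuotient Γ) := by
  have : ProperSpace E := FiniteDimensional.proper_real E
  refine ⟨?_⟩
  have h1 : (Set.univ : Set (LeftQuotient Γ)) = proj Γ '' Metric.closedBall 0 R := by
    refine (Set.eq_univ_of_forall fun q => ?_).symm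
    obtain ⟨x, rfl⟩ := Quotient.exists_rep q
    obtain ⟨γ, hγ, h2⟩ := h x
    exact ⟨(γ * x).val, by simpa using h2, leftQuotientMk_mul Γ hγ x⟩
  rw [h1]
  exact (isCompact_closedBall 0 R).image (continuous_proj Γ)

variable [hΓ : IsSeparated Γ]

lemma injOn_proj (x : E) : Set.InjOn (proj Γ) (Metric.ball x (1 / 2)) := by
  intro y hy z hz hyz
  obtain ⟨γ, hγ, h⟩ := (leftQuotientMk_eq_iff Γ).mp hyz
  have h1 : ‖(γ * mk D z).val - (mk D z).val‖ < 1 := by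
    rw [h]
    have h2 : dist y z < 1 / 2 + 1 / 2 := (dist_triangle_right y z x).trans_lt (add_lt_add hy hz)
    rw [dist_eq_norm] at h2
    norm_num at h2
    exact h2
  rw [hΓ.eq_one γ hγ _ h1, one_mul] at h
  exact h.symm

/-- The chart of `Γ \ G` inverse to the restriction of the projection to the ball of radius `1 / 2`
around `x`. -/
def quotientChart (x : E) : OpenPartialHomeomorph (LeftQuotient Γ) E :=
  (OpenPartialHomeomorph.ofContinuousOpen ((injOn_proj Γ x).toPartialEquiv (proj Γ) _)
    (continuous_proj Γ).continuousOn (isOpenMap_proj Γ) Metric.isOpen_ball).symm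

lemma quotientChart_proj_self {x y : E} (hy : y ∈ Metric.ball x (1 / 2)) :
    quotientChart Γ x (proj Γ y) = y :=
  (quotientChart Γ x).right_inv hy

/-- Read on the vector space underlying `G`, the charts of `Γ \ G` are locally left translations
by elements of `Γ`. -/
lemma exists_quotientChart_proj_eventuallyEq {x y : E} (h : proj Γ y ∈ (quotientChart Γ x).source) :
    ∃ γ ∈ Γ, (fun y' => quotientChart Γ x (proj Γ y')) =ᶠ[𝓝 y] fun y' => (γ * mk D y').val := by
  obtain ⟨z, hz, hzy⟩ := h
  obtain ⟨γ, hγ, h1⟩ := (leftQuotientMk_eq_iff Γ).mp hzy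
  refine ⟨γ, hγ, ?_⟩
  have hc : Continuous fun y' : E => (γ * mk D y').val :=
    continuous_const.mul (continuous_id (X := TwoStepGroup D))
  have h2 : (γ * mk D y).val ∈ Metric.ball x (1 / 2) := by
    rw [h1]
    exact hz
  filter_upwards [hc.continuousAt.preimage_mem_nhds (Metric.isOpen_ball.mem_nhds h2)] with y' hy'
  have h3 : proj Γ y' = proj Γ (γ * mk D y').val := (leftQuotientMk_mul Γ hγ (mk D y')).symm
  rw [h3, quotientChart_proj_self Γ hy']

instance : ChartedSpace E (LeftQuotient Γ) where
  atlas := Set.range (quotientChart Γ)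
  chartAt q := quotientChart Γ (lift Γ q)
  mem_chart_source q := ⟨lift Γ q, Metric.mem_ball_self (by norm_num), proj_lift Γ q⟩
  chart_mem_atlas q := ⟨_, rfl⟩

lemma hasFDerivAt_translation (a : TwoStepGroup D) (y : E) :
    HasFDerivAt (fun y' : E => (a * mk D y').val) (ContinuousLinearMap.id ℝ E + D.b a.val) y :=
  ((hasFDerivAt_id y).const_add a.val).add (D.b a.val).hasFDerivAt

lemma contDiff_translation (a : TwoStepGroup D) : ContDiff ℝ ∞ fun y : E => (a * mk D y).val :=
  (contDiff_const.add contDiff_id).add (D.b a.val).contDiff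

instance : IsManifold 𝓘(ℝ, E) ∞ (LeftQuotient Γ) := by
  refine isManifold_of_contDiffOn _ _ _ ?_
  rintro _ _ ⟨x, rfl⟩ ⟨x', rfl⟩ y hy
  have hy' : proj Γ y ∈ (quotientChart Γ x').source := by
    have := hy.1
    simp only [modelWithCornersSelf_coe_symm, Set.preimage_id, OpenPartialHomeomorph.trans_source,
      Set.mem_inter_iff, Set.mem_preimage] at this
    exact this.2
  obtain ⟨γ, -, h⟩ := exists_quotientChart_proj_eventuallyEq Γ hy'
  exact ((contDiff_translation γ).contDiffAt.congr_of_eventuallyEq h).contDiffWithinAt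

lemma extChartAt_quotient_symm (q : LeftQuotient Γ) (y : E) :
    (extChartAt 𝓘(ℝ, E) q).symm y = proj Γ y := rfl

lemma extChartAt_quotient_self (q : LeftQuotient Γ) : extChartAt 𝓘(ℝ, E) q q = lift Γ q := by
  have h := quotientChart_proj_self Γ (x := lift Γ q) (Metric.mem_ball_self (by norm_num))
  rw [proj_lift] at h
  exact h

/-- At the point `y`, the projection is in the preferred charts the left translation by an element
of `Γ`. -/
lemma exists_hasMFDerivAt_proj (y : E) : ∃ γ ∈ Γ, lift Γ (proj Γ y) = (γ * mk D y).val ∧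
    HasMFDerivAt 𝓘(ℝ, E) 𝓘(ℝ, E) (proj Γ) y (ContinuousLinearMap.id ℝ E + D.b γ.val) := by
  obtain ⟨γ, hγ, h⟩ := exists_quotientChart_proj_eventuallyEq Γ
    (mem_chart_source E (proj Γ y))
  refine ⟨γ, hγ, ?_, (continuous_proj Γ).continuousAt, ?_⟩
  · rw [← h.eq_of_nhds]
    exact (extChartAt_quotient_self Γ (proj Γ y)).symm
  · have h1 : HasFDerivAt (fun y' => quotientChart Γ (lift Γ (proj Γ y)) (proj Γ y'))
        (ContinuousLinearMap.id ℝ E + D.b γ.val) y :=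
      (hasFDerivAt_translation γ y).congr_of_eventuallyEq h
    exact h1.hasFDerivWithinAt

lemma exists_hasMFDerivAt_leftQuotientMk (x : TwoStepGroup D) :
    ∃ γ ∈ Γ, lift Γ (leftQuotientMk Γ x) = (γ * x).val ∧
      mfderiv 𝓘(ℝ, E) 𝓘(ℝ, E) (leftQuotientMk Γ) x =
        (ContinuousLinearMap.id ℝ E + D.b γ.val) := by
  obtain ⟨γ, hγ, h1, h2⟩ := exists_hasMFDerivAt_proj Γ x.val
  exact ⟨γ, hγ, h1, HasMFDerivAt.mfderiv (I := 𝓘(ℝ, E)) (I' := 𝓘(ℝ, E))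
    (M := TwoStepGroup D) h2⟩

/-- The complex structure of `Γ \ G` induced by the one of `G`. -/
def quotientComplexStructure : AlmostComplexStructure E (LeftQuotient Γ) :=
  constAlmostComplexStructure D.j D.j_sq fun q₀ q hq v => by
    have hq' : proj Γ (lift Γ q) ∈ (quotientChart Γ (lift Γ q₀)).source := by
      rw [proj_lift]
      exact hq
    obtain ⟨γ, -, h⟩ := exists_quotientChart_proj_eventuallyEq Γ hq'
    have h1 := (hasFDerivAt_translation γ (lift Γ q)).congr_of_eventuallyEq h
    have h2 : tangentCoordChange 𝓘(ℝ, E) q q₀ q = ContinuousLinearMap.id ℝ E + D.b γ.val := by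
      rw [tangentCoordChange_def, extChartAt_quotient_self, ModelWithCorners.range_eq_univ,
        fderivWithin_univ]
      exact h1.fderiv
    rw [h2]
    simp [D.b_j]

lemma quotientComplexStructure_isInducedBy :
    (quotientComplexStructure Γ).IsInducedBy (complexStructure D) := by
  intro x v
  obtain ⟨γ, -, -, h⟩ := exists_hasMFDerivAt_leftQuotientMk Γ x
  have h1 : ∀ v : E, (ContinuousLinearMap.id ℝ E + D.b γ.val) (D.j v) =
      D.j ((ContinuousLinearMap.id ℝ E + D.b γ.val) v) := by
    intro v
    simp [D.b_j]
  rw [h]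
  exact h1 v

/-- The forms on `Γ \ G` induced by the left-invariant forms with values `θ i` at the identity. -/
def quotientCoframe {n : ℕ} (θ : Fin n → E →L[ℝ] ℂ) (i : Fin n) : CForm E (LeftQuotient Γ) 1 :=
  oneFormOf fun q => movedForm D (θ i) (lift Γ q)

/-- Left-invariance of `movedForm`. -/
lemma movedForm_mul_comp (θ : E →L[ℝ] ℂ) (a x : TwoStepGroup D) :
    movedForm D θ (a * x).val ∘L (ContinuousLinearMap.id ℝ E + D.b a.val) =
      movedForm D θ x.val := by
  ext v
  simp only [ContinuousLinearMap.comp_apply, movedForm_apply, val_mul, map_add, _root_.add_apply,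
    ContinuousLinearMap.id_apply, D.b_left, D.b_right, map_zero]
  ring

/-- The forms are left-invariant, so that their expression does not change under the transitions. -/
lemma quotientCoframe_isModelledOn {n : ℕ} (θ : Fin n → E →L[ℝ] ℂ) :
    IsModelledOn D θ (quotientCoframe Γ θ) := by
  intro i q
  funext y
  obtain ⟨γ, -, h1, h2⟩ := exists_hasMFDerivAt_proj Γ y
  have h3 : chartSymmDeriv q y = ContinuousLinearMap.id ℝ E + D.b γ.val := h2.mfderiv
  have h4 : formAt (quotientCoframe Γ θ i) (proj Γ y) = movedForm D (θ i) (γ * mk D y).val := by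
    rw [quotientCoframe, formAt_oneFormOf, h1]
  rw [chartForm, h3, extChartAt_quotient_symm, h4, movedForm_mul_comp]
  rfl

lemma quotientMetric_isInducedBy {n : ℕ} {θ : Fin n → E →L[ℝ] ℂ}
    {g : HermitianMetric (complexStructure D)} {g' : HermitianMetric (quotientComplexStructure Γ)}
    (hg : HasDiagonalForm g (coframe D θ)) (hg' : HasDiagonalForm g' (quotientCoframe Γ θ)) :
    g'.IsInducedBy g := by
  intro x v w
  obtain ⟨γ, -, h1, h2⟩ := exists_hasMFDerivAt_leftQuotientMk Γ x
  have h3 : ∀ (i : Fin n) (u : TangentSpace 𝓘(ℝ, E) x),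
      quotientCoframe Γ θ i (leftQuotientMk Γ x)
        ![mfderiv 𝓘(ℝ, E) 𝓘(ℝ, E) (leftQuotientMk Γ) x u] = coframe D θ i x ![u] := by
    intro i u
    rw [h2]
    have h4 : formAt (quotientCoframe Γ θ i) (leftQuotientMk Γ x) ∘L
        (ContinuousLinearMap.id ℝ E + D.b γ.val) = formAt (coframe D θ i) x := by
      rw [quotientCoframe, formAt_oneFormOf, h1, movedForm_mul_comp, formAt_coframe]
    have h5 := congrArg (fun T : E →L[ℝ] ℂ => T u) h4
    exact (formAt_apply _ _ _).symm.trans (h5.trans (formAt_apply _ _ _))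
  have h6 := hg' (leftQuotientMk Γ x) (mfderiv 𝓘(ℝ, E) 𝓘(ℝ, E) (leftQuotientMk Γ) x v)
    (mfderiv 𝓘(ℝ, E) 𝓘(ℝ, E) (leftQuotientMk Γ) x w)
  simp only [h3] at h6
  exact_mod_cast h6.trans (hg x v w).symm

lemma isLocalDiffeomorph_leftQuotientMk :
    IsLocalDiffeomorph 𝓘(ℝ, E) 𝓘(ℝ, E) ∞ (leftQuotientMk Γ) := by
  intro x
  have he : quotientChart Γ x.val ∈ IsManifold.maximalAtlas 𝓘(ℝ, E) ∞ (LeftQuotient Γ) :=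
    IsManifold.subset_maximalAtlas ⟨_, rfl⟩
  refine ⟨{
    toPartialEquiv := (quotientChart Γ x.val).symm.toPartialEquiv
    open_source := (quotientChart Γ x.val).open_target
    open_target := (quotientChart Γ x.val).open_source
    contMDiffOn_toFun := contMDiffOn_symm_of_mem_maximalAtlas he
    contMDiffOn_invFun := contMDiffOn_of_mem_maximalAtlas he },
    Metric.mem_ball_self (x := x.val) (by norm_num), fun y _ => rfl⟩

lemma discreteTopology_of_isSeparated : DiscreteTopology Γ := by
  refine discreteTopology_of_isOpen_singleton_one ?_
  have h : ({1} : Set Γ) = (fun γ : Γ => (γ : TwoStepGroup D).val) ⁻¹' Metric.ball (0 : E) 1 := by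
    ext γ
    simp only [Set.mem_singleton_iff, Set.mem_preimage, mem_ball_zero_iff]
    constructor
    · rintro rfl
      simp
    · intro hγ
      refine Subtype.ext (hΓ.eq_one γ γ.2 1 ?_)
      simpa using hγ
  rw [h]
  exact Metric.isOpen_ball.preimage (continuous_val.comp continuous_subtype_val)

/-- The orbit relation `x y⁻¹ ∈ Γ` is closed since `Γ` is discrete. -/
lemma t2Space_leftQuotient : T2Space (LeftQuotient Γ) := by
  rw [t2Space_iff_of_isOpenQuotientMap (isOpenQuotientMap_leftQuotientMk Γ)]
  have := discreteTopology_of_isSeparated Γ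
  have h : {q : TwoStepGroup D × TwoStepGroup D | leftQuotientMk Γ q.1 = leftQuotientMk Γ q.2} =
      (fun q => q.1 * q.2⁻¹) ⁻¹' (Γ : Set (TwoStepGroup D)) := by
    ext ⟨x, y⟩
    simp only [Set.mem_ofPred_eq, Set.mem_preimage, SetLike.mem_coe, leftQuotientMk_eq_iff]
    constructor
    · rintro ⟨γ, hγ, rfl⟩
      simpa using hγ
    · intro h
      exact ⟨_, h, by simp⟩
  rw [h]
  exact Subgroup.isClosed_of_discrete.preimage (by fun_prop)

end TwoStepGroup

/-! ### The nilmanifolds attached to diagonal matrices of Gaussian integers -/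

section Gaussian

/-- The ring of Gaussian integers, inside `ℂ`. -/
def gaussianSubring : Subring ℂ := GaussianInt.toComplex.range

lemma mem_gaussianSubring {z : ℂ} : z ∈ gaussianSubring ↔ ∃ a b : ℤ, (⟨a, b⟩ : ℂ) = z := by
  constructor
  · rintro ⟨x, rfl⟩
    exact ⟨x.re, x.im, (GaussianInt.toComplex_def₂ x).symm⟩
  · rintro ⟨a, b, rfl⟩
    exact ⟨⟨a, b⟩, GaussianInt.toComplex_def₂ _⟩

lemma I_mem_gaussianSubring : Complex.I ∈ gaussianSubring :=
  mem_gaussianSubring.mpr ⟨0, 1, by simp [Complex.ext_iff]⟩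

lemma conj_mem_gaussianSubring {z : ℂ} (hz : z ∈ gaussianSubring) :
    conj z ∈ gaussianSubring := by
  obtain ⟨a, b, rfl⟩ := mem_gaussianSubring.mp hz
  exact mem_gaussianSubring.mpr ⟨a, -b, by simp [Complex.ext_iff]⟩

lemma eq_zero_of_mem_gaussianSubring {z : ℂ} (hz : z ∈ gaussianSubring) (h : ‖z‖ < 1) : z = 0 := by
  obtain ⟨a, b, rfl⟩ := mem_gaussianSubring.mp hz
  have ha : |(a : ℝ)| < 1 := (Complex.abs_re_le_norm ⟨a, b⟩).trans_lt h
  have hb : |(b : ℝ)| < 1 := (Complex.abs_im_le_norm ⟨a, b⟩).trans_lt h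
  have ha' : a = 0 := Int.abs_lt_one_iff.mp (by exact_mod_cast ha)
  have hb' : b = 0 := Int.abs_lt_one_iff.mp (by exact_mod_cast hb)
  simp [ha', hb', Complex.ext_iff]

lemma exists_mem_gaussianSubring_norm_sub_le (z : ℂ) : ∃ w ∈ gaussianSubring, ‖z - w‖ ≤ 1 := by
  refine ⟨⟨round z.re, round z.im⟩, mem_gaussianSubring.mpr ⟨_, _, rfl⟩, ?_⟩
  refine (Complex.norm_le_abs_re_add_abs_im _).trans ?_
  have h1 := abs_sub_round z.re
  have h2 := abs_sub_round z.im
  simp only [Complex.sub_re, Complex.sub_im]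
  linarith

end Gaussian

section Diagonal

variable {m : ℕ}

/-- The sesquilinear form `(u, v) ↦ ∑ d_k v_k conj(u_k)` in the first `m` coordinates. -/
def diagSesq (d : Fin m → ℂ) : (Fin (m + 1) → ℂ) →L[ℝ] (Fin (m + 1) → ℂ) →L[ℝ] ℂ :=
  ∑ k, tensorOne ((Complex.conjCLE : ℂ →L[ℝ] ℂ) ∘L ContinuousLinearMap.proj k.castSucc)
    (d k • ContinuousLinearMap.proj k.castSucc)

lemma diagSesq_apply (d : Fin m → ℂ) (u v : Fin (m + 1) → ℂ) :
    diagSesq d u v = ∑ k, d k * (v k.castSucc * conj (u k.castSucc)) := by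
  simp only [diagSesq, _root_.sum_apply, tensorOne_apply]
  refine Finset.sum_congr rfl fun k _ => ?_
  change conj (u k.castSucc) * (d k * v k.castSucc) = _
  ring

lemma diagSesq_left_eq_zero (d : Fin m → ℂ) {u : Fin (m + 1) → ℂ}
    (hu : ∀ k : Fin m, u k.castSucc = 0) (v : Fin (m + 1) → ℂ) : diagSesq d u v = 0 := by
  simp [diagSesq_apply, hu]

lemma diagSesq_right_eq_zero (d : Fin m → ℂ) (u : Fin (m + 1) → ℂ) {v : Fin (m + 1) → ℂ}
    (hv : ∀ k : Fin m, v k.castSucc = 0) : diagSesq d u v = 0 := by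
  simp [diagSesq_apply, hv]

lemma single_last_castSucc (c : ℂ) (k : Fin m) :
    (Pi.single (Fin.last m) c : Fin (m + 1) → ℂ) k.castSucc = 0 := by
  rw [Pi.single_apply, if_neg (Fin.castSucc_lt_last k).ne]

/-- The group law `(z, w) (z', w') = (z + z', w + w' + ∑ d_k conj(z_k) z'_k)` on `ℂ ^ m × ℂ`, with
the standard complex structure. -/
def diagData (d : Fin m → ℂ) : TwoStepData (Fin (m + 1) → ℂ) where
  j := Complex.I • ContinuousLinearMap.id ℝ _
  j_sq x := by
    simp [smul_smul]
  b := ContinuousLinearMap.compL ℝ _ ℂ _ (ContinuousLinearMap.single ℝ (fun _ => ℂ) (Fin.last m)) ∘L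
    diagSesq d
  b_left x y z := by
    refine (congrArg (Pi.single (Fin.last m)) (diagSesq_left_eq_zero d ?_ z)).trans
      (Pi.single_zero _)
    exact single_last_castSucc _
  b_right x y z := by
    refine (congrArg (Pi.single (Fin.last m)) (diagSesq_right_eq_zero d x ?_)).trans
      (Pi.single_zero _)
    exact single_last_castSucc _
  b_j x y := by
    change (Pi.single (Fin.last m) (diagSesq d x (Complex.I • y)) : Fin (m + 1) → ℂ) =
      Complex.I • Pi.single (Fin.last m) (diagSesq d x y)
    rw [← Pi.single_smul, diagSesq_apply, diagSesq_apply, Finset.smul_sum]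
    congr 1
    refine Finset.sum_congr rfl fun k _ => ?_
    simp only [Pi.smul_apply, smul_eq_mul]
    ring

lemma diagData_b_apply (d : Fin m → ℂ) (u v : Fin (m + 1) → ℂ) :
    (diagData d).b u v = Pi.single (Fin.last m) (diagSesq d u v) := rfl

lemma diagData_b_castSucc (d : Fin m → ℂ) (u v : Fin (m + 1) → ℂ) (k : Fin m) :
    (diagData d).b u v k.castSucc = 0 := single_last_castSucc _ k

lemma diagData_b_last (d : Fin m → ℂ) (u v : Fin (m + 1) → ℂ) :
    (diagData d).b u v (Fin.last m) = diagSesq d u v := Pi.single_eq_same _ _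

/-- The coordinate functionals. -/
def coordForm (i : Fin (m + 1)) : (Fin (m + 1) → ℂ) →L[ℝ] ℂ := ContinuousLinearMap.proj i

@[simp] lemma coordForm_apply (i : Fin (m + 1)) (v : Fin (m + 1) → ℂ) : coordForm i v = v i := rfl

lemma linearIndependent_coordForm : LinearIndependent ℂ (coordForm (m := m)) := by
  rw [Fintype.linearIndependent_iff]
  intro c hc i
  have h := congrArg (fun f : (Fin (m + 1) → ℂ) →L[ℝ] ℂ => f (Pi.single i 1)) hc
  simpa [Pi.single_apply] using h

lemma coordForm_j (d : Fin m → ℂ) (i : Fin (m + 1)) (v : Fin (m + 1) → ℂ) :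
    coordForm i ((diagData d).j v) = Complex.I * coordForm i v := rfl

/-- The forms modelled on the coordinate functionals are the left-invariant forms `dz_k` and
`dw - ∑ d_k conj(z_k) dz_k`; they satisfy the structure equations with `A = 0` and the diagonal
matrix `B` with entries `d`. -/
lemma IsModelledOn.isStructuredCoframe {M : Type*} [TopologicalSpace M]
    [ChartedSpace (Fin (m + 1) → ℂ) M] [IsManifold 𝓘(ℝ, Fin (m + 1) → ℂ) 1 M] {d : Fin m → ℂ}
    {α : Fin (m + 1) → CForm (Fin (m + 1) → ℂ) M 1} (h : IsModelledOn (diagData d) coordForm α) :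
    IsStructuredCoframe 0 (Matrix.diagonal d) α where
  differentiableAt i x := (h.isSmoothCoframe i x).differentiableAt (by simp)
  closed i := by
    funext x
    apply toModel_injective
    ext v
    have hv : v = ![v 0, v 1] := by
      funext i
      fin_cases i <;> rfl
    rw [hv, h.extD_apply, coordForm_apply, coordForm_apply, diagData_b_castSucc,
      diagData_b_castSucc, sub_zero]
    rfl
  last x := by
    ext v
    have hv : v = ![v 0, v 1] := by
      funext i
      fin_cases i <;> rfl
    have h1 : ∀ (k : Fin m) (u : Fin (m + 1) → ℂ),
        toModel x (α k.castSucc x) ![u] = u k.castSucc := by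
      intro k u
      rw [← formAt_apply, h.formAt_eq, movedForm_apply, coordForm_apply, coordForm_apply,
        diagData_b_castSucc, sub_zero]
    have h2 : ∀ (k : Fin m) (u : Fin (m + 1) → ℂ),
        conjForm (toModel x (α k.castSucc x)) ![u] = conj (u k.castSucc) :=
      fun k u => congrArg conj (h1 k u)
    rw [hv, h.extD_apply, coordForm_apply, coordForm_apply, diagData_b_last, diagData_b_last,
      ContinuousAlternatingMap.add_apply]
    simp only [ContinuousAlternatingMap.sum_apply, ContinuousAlternatingMap.smul_apply,
      wedge_apply_pair, h1, h2, smul_eq_mul, Matrix.diagonal_apply, ite_mul, zero_mul,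
      Finset.sum_ite_eq, Finset.mem_univ, if_true, Pi.zero_apply, Finset.sum_const_zero, zero_add,
      diagSesq_apply, ← Finset.sum_sub_distrib]
    refine Finset.sum_congr rfl fun k _ => ?_
    ring

namespace TwoStepGroup

/-- The elements with Gaussian integer coordinates. -/
def gaussianLattice (d : Fin m → ℂ) (hd : ∀ k, d k ∈ gaussianSubring) :
    Subgroup (TwoStepGroup (diagData d)) :=
  have hb : ∀ x y : Fin (m + 1) → ℂ, (∀ i, x i ∈ gaussianSubring) → (∀ i, y i ∈ gaussianSubring) →
      ∀ i, (diagData d).b x y i ∈ gaussianSubring := by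
    intro x y hx hy i
    refine Fin.lastCases ?_ (fun k => ?_) i
    · rw [diagData_b_last, diagSesq_apply]
      exact sum_mem fun k _ => mul_mem (hd k) (mul_mem (hy _) (conj_mem_gaussianSubring (hx _)))
    · rw [diagData_b_castSucc]
      exact zero_mem _
  { carrier := {x | ∀ i, x.val i ∈ gaussianSubring}
    mul_mem' := fun {x y} hx hy i => add_mem (add_mem (hx i) (hy i)) (hb _ _ hx hy i)
    one_mem' := fun i => zero_mem _
    inv_mem' := fun {x} hx i => add_mem (neg_mem (hx i)) (hb _ _ hx hx i) }

variable {d : Fin m → ℂ} {hd : ∀ k, d k ∈ gaussianSubring}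

/-- The displacement in each of the first `m` coordinates is a Gaussian integer; if these vanish,
then so does the one in the last coordinate. -/
instance : IsSeparated (gaussianLattice d hd) where
  eq_one γ hγ x h := by
    have h1 : ∀ i, ‖γ.val i + (diagData d).b γ.val x.val i‖ < 1 := by
      intro i
      refine lt_of_le_of_lt ?_ ((norm_le_pi_norm _ i).trans_lt h)
      refine le_of_eq (congrArg norm ?_)
      simp only [val_mul, Pi.sub_apply, Pi.add_apply]
      ring
    have h2 : ∀ k : Fin m, γ.val k.castSucc = 0 := by
      intro k
      have h3 := h1 k.castSucc
      rw [diagData_b_castSucc, add_zero] at h3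
      exact eq_zero_of_mem_gaussianSubring (hγ _) h3
    refine val_injective (funext fun i => Fin.lastCases ?_ h2 i)
    have h3 := h1 (Fin.last m)
    rw [diagData_b_last, diagSesq_left_eq_zero d h2, add_zero] at h3
    exact eq_zero_of_mem_gaussianSubring (hγ _) h3

/-- The lattice moves each point into the unit polydisc: reduce first all the coordinates, then the
last one, which is perturbed by the first step. -/
lemma exists_gaussianLattice_norm_le (x : TwoStepGroup (diagData d)) :
    ∃ γ ∈ gaussianLattice d hd, ‖(γ * x).val‖ ≤ 1 := by
  choose r hr hr' using exists_mem_gaussianSubring_norm_sub_le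
  let γ₁ : TwoStepGroup (diagData d) := mk _ fun i => -r (x.val i)
  let c : ℂ := -r ((γ₁ * x).val (Fin.last m))
  let γ₂ : TwoStepGroup (diagData d) := mk _ (Pi.single (Fin.last m) c)
  have h₃ : γ₂.val = Pi.single (Fin.last m) c := rfl
  have h₁ : γ₁ ∈ gaussianLattice d hd := fun i => neg_mem (hr _)
  have h₂ : γ₂ ∈ gaussianLattice d hd := by
    intro i
    refine Fin.lastCases ?_ (fun k => ?_) i
    · rw [h₃, Pi.single_eq_same]
      exact neg_mem (hr _)
    · rw [h₃, single_last_castSucc]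
      exact zero_mem _
  refine ⟨γ₂ * γ₁, mul_mem h₂ h₁, ?_⟩
  rw [mul_assoc]
  have h3 : (γ₂ * (γ₁ * x)).val = Pi.single (Fin.last m) c + (γ₁ * x).val := by
    rw [val_mul γ₂, diagData_b_apply, h₃, diagSesq_left_eq_zero d (single_last_castSucc c),
      Pi.single_zero, add_zero]
  rw [h3]
  refine (pi_norm_le_iff_of_nonneg zero_le_one).mpr fun i => ?_
  refine Fin.lastCases ?_ (fun k => ?_) i
  · rw [Pi.add_apply, Pi.single_eq_same, neg_add_eq_sub]
    exact hr' _
  · rw [Pi.add_apply, single_last_castSucc, zero_add, val_mul, Pi.add_apply, diagData_b_castSucc,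
      add_zero, Pi.add_apply]
    change ‖-r (x.val k.castSucc) + x.val k.castSucc‖ ≤ 1
    rw [neg_add_eq_sub]
    exact hr' _

lemma isCocompactLattice_gaussianLattice : IsCocompactLattice (gaussianLattice d hd) where
  discrete := discreteTopology_of_isSeparated _
  compact := compactSpace_leftQuotient _ exists_gaussianLattice_norm_le

/-- The elements `e_k` and `i e_k` do not commute. -/
lemma exists_mul_ne_mul {k : Fin m} (hk : d k ≠ 0) :
    ∃ a b : TwoStepGroup (diagData d), a * b ≠ b * a := by
  refine ⟨mk _ (Pi.single k.castSucc 1), mk _ (Pi.single k.castSucc Complex.I), fun h => hk ?_⟩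
  have h1 := congrFun (congrArg val h) (Fin.last m)
  simp only [val_mul, val_mk, Pi.add_apply, diagData_b_last, diagSesq_apply] at h1
  have h2 : ∀ a b : ℂ, ∑ l : Fin m, d l * ((Pi.single k.castSucc a : Fin (m + 1) → ℂ) l.castSucc *
      conj ((Pi.single k.castSucc b : Fin (m + 1) → ℂ) l.castSucc)) = d k * (a * conj b) := by
    intro a b
    rw [Finset.sum_eq_single k]
    · simp
    · intro l _ hl
      rw [Pi.single_eq_of_ne (fun h => hl (Fin.castSucc_injective m h)), zero_mul, mul_zero]
    · simp
  rw [h2, h2] at h1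
  simp only [map_one, Complex.conj_I, mul_one, one_mul] at h1
  have h3 : d k * Complex.I = d k * -Complex.I := by linear_combination h1
  have h4 : d k * (2 * Complex.I) = 0 := by linear_combination h3
  simpa using h4

end TwoStepGroup

/-- With `A = 0` and `B` diagonal only the last sum of the quadratic condition survives. -/
lemma quadraticCondition_diagonal {d : Fin m → ℂ}
    (hd : ∀ i j : Fin m, i < j → (d i * conj (d j)).re = 0) :
    QuadraticCondition 0 (Matrix.diagonal d) := by
  have h1 : ∑ i, ∑ j ∈ Finset.univ.erase i, ‖Matrix.diagonal d i j‖ ^ 2 = 0 := by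
    refine Finset.sum_eq_zero fun i _ => Finset.sum_eq_zero fun j hj => ?_
    rw [Matrix.diagonal_apply_ne _ (Finset.ne_of_mem_erase hj).symm]
    simp
  have h2 : (∑ i, ∑ j ∈ Finset.Ioi i,
      Matrix.diagonal d i i * conj (Matrix.diagonal d j j)).re = 0 := by
    rw [Complex.re_sum]
    refine Finset.sum_eq_zero fun i _ => ?_
    rw [Complex.re_sum]
    refine Finset.sum_eq_zero fun j hj => ?_
    rw [Matrix.diagonal_apply_eq, Matrix.diagonal_apply_eq]
    exact hd i j (Finset.mem_Ioi.mp hj)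
  unfold QuadraticCondition
  rw [h1, h2]
  simp

end Diagonal

section Existence

variable {m : ℕ}

/-- The entries `1, i, 0, …, 0`, for which `Re (d_j conj(d_k)) = 0` for all `j < k`. -/
def nilmanifoldEntries (k : Fin m) : ℂ :=
  if k.val = 0 then 1 else if k.val = 1 then Complex.I else 0

lemma nilmanifoldEntries_mem (k : Fin m) : nilmanifoldEntries k ∈ gaussianSubring := by
  unfold nilmanifoldEntries
  split_ifs
  exacts [one_mem _, I_mem_gaussianSubring, zero_mem _]

/-- The only product of two entries which does not vanish is `1 * conj i`, which is imaginary. -/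
lemma nilmanifoldEntries_mul_conj_re (i j : Fin m) (hij : i < j) :
    (nilmanifoldEntries i * conj (nilmanifoldEntries j)).re = 0 := by
  have hij' : i.val < j.val := hij
  unfold nilmanifoldEntries
  rw [if_neg (by omega : ¬ j.val = 0)]
  split_ifs with h1 h2 h2
  · simp
  · simp
  · omega
  · simp
  · omega
  · simp

end Existence

end AsthenoKahler

end

theorem mainTheorem8 :
    -- `n = m + 1` is the complex dimension of the Lie group `G`
    (∀ (m : ℕ), 1 ≤ m →
      ∀ (E : Type*) [NormedAddCommGroup E] [NormedSpace ℝ E] [FiniteDimensional ℝ E],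
      Module.finrank ℝ E = 2 * (m + 1) →
      ∀ (G : Type*) [Group G] [TopologicalSpace G] [T2Space G] [SecondCountableTopology G]
        [ChartedSpace E G] [LieGroup 𝓘(ℝ, E) ∞ G] [SimplyConnectedSpace G] [Group.IsNilpotent G]
        (J : AlmostComplexStructure E G) (α : Fin (m + 1) → CForm E G 1)
        (A B : Fin m → Fin m → ℂ),
      J.IsNilpotentComplexStructure → IsInvariantCoframe J α →
      SatisfiesStructureEquations A B α → QuadraticCondition A B →
      ∃ g : HermitianMetric J, g.IsLeftInvariant ∧ g.IsDiagonal α ∧ g.IsAsthenoKahler (m + 1)) ∧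
    -- compact nilmanifolds `Γ \ G` of complex dimension `m + 1 ≥ 3`
    (∀ (m : ℕ), 2 ≤ m →
      ∃ (G : Type) (_ : Group G) (_ : TopologicalSpace G) (_ : T2Space G)
        (_ : SecondCountableTopology G) (_ : ChartedSpace (Fin (m + 1) → ℂ) G)
        (_ : LieGroup 𝓘(ℝ, Fin (m + 1) → ℂ) ∞ G) (_ : SimplyConnectedSpace G)
        (_ : Group.IsNilpotent G)
        (J : AlmostComplexStructure (Fin (m + 1) → ℂ) G)
        (α : Fin (m + 1) → CForm (Fin (m + 1) → ℂ) G 1) (A B : Fin m → Fin m → ℂ)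
        (g : HermitianMetric J)
        (Γ : Subgroup G) (_ : T2Space (LeftQuotient Γ))
        (_ : ChartedSpace (Fin (m + 1) → ℂ) (LeftQuotient Γ))
        (_ : IsManifold 𝓘(ℝ, Fin (m + 1) → ℂ) ∞ (LeftQuotient Γ))
        (J' : AlmostComplexStructure (Fin (m + 1) → ℂ) (LeftQuotient Γ))
        (g' : HermitianMetric J'),
        (∃ a b : G, a * b ≠ b * a) ∧
        J.IsNilpotentComplexStructure ∧ IsInvariantCoframe J α ∧
        SatisfiesStructureEquations A B α ∧ QuadraticCondition A B ∧
        IsCocompactLattice Γ ∧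
        IsLocalDiffeomorph 𝓘(ℝ, Fin (m + 1) → ℂ) 𝓘(ℝ, Fin (m + 1) → ℂ) ∞ (leftQuotientMk Γ) ∧
        J'.IsInducedBy J ∧ g.IsLeftInvariant ∧ g'.IsInducedBy g ∧
        g'.IsAsthenoKahler (m + 1)) := by
  refine ⟨?_, ?_⟩
  · intro m hm E _ _ _ hE G _ _ _ _ _ _ _ _ J α A B _ hα hs hq
    exact exists_isAsthenoKahler_of_isInvariantCoframe hm hE hα hs hq
  · intro m hm
    let d : Fin m → ℂ := nilmanifoldEntries
    let Γ := TwoStepGroup.gaussianLattice d nilmanifoldEntries_mem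
    have hq : QuadraticCondition 0 (Matrix.diagonal d) :=
      quadraticCondition_diagonal nilmanifoldEntries_mul_conj_re
    have hsep : ∀ v : Fin (m + 1) → ℂ, (∀ i, coordForm i v = 0) → v = 0 := fun v hv => funext hv
    have hα := TwoStepGroup.coframe_isModelledOn (D := diagData d) (coordForm (m := m))
    have hα' := TwoStepGroup.quotientCoframe_isModelledOn Γ (coordForm (m := m))
    have hinv := TwoStepGroup.coframe_isInvariantCoframe (coordForm_j d) linearIndependent_coordForm
    have htype' := hα'.isTypeOneZero (coordForm_j d)
      (J := TwoStepGroup.quotientComplexStructure Γ) fun _ _ => rfl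
    obtain ⟨g, hg⟩ := exists_hermitianMetric_hasDiagonalForm hinv.isTypeOneZero
      hα.isSmoothCoframe (hα.isSeparatingCoframe hsep)
    obtain ⟨g', hg'⟩ := exists_hermitianMetric_hasDiagonalForm htype'
      hα'.isSmoothCoframe (hα'.isSeparatingCoframe hsep)
    have hd : d ⟨0, by omega⟩ ≠ 0 := by simp [d, nilmanifoldEntries]
    exact ⟨TwoStepGroup (diagData d), inferInstance, inferInstance, inferInstance, inferInstance,
      inferInstance, inferInstance, inferInstance, inferInstance,
      TwoStepGroup.complexStructure (diagData d), TwoStepGroup.coframe (diagData d) coordForm,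
      0, Matrix.diagonal d, g, Γ, TwoStepGroup.t2Space_leftQuotient Γ, inferInstance, inferInstance,
      TwoStepGroup.quotientComplexStructure Γ, g',
      TwoStepGroup.exists_mul_ne_mul hd,
      TwoStepGroup.complexStructure_isNilpotentComplexStructure, hinv,
      ⟨hα.isStructuredCoframe.closed, hα.isStructuredCoframe.last⟩, hq,
      TwoStepGroup.isCocompactLattice_gaussianLattice,
      TwoStepGroup.isLocalDiffeomorph_leftQuotientMk Γ,
      TwoStepGroup.quotientComplexStructure_isInducedBy Γ,
      hg.isLeftInvariant hinv.leftInvariant,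
      TwoStepGroup.quotientMetric_isInducedBy Γ hg hg',
      isAsthenoKahler_of_hasDiagonalForm (by omega) htype' hα'.isStructuredCoframe hq hg'⟩
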